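/- **Definitions.** A *unital commutative distributive $\ell$-monoid* is an algebra $\langle M;+,\lor,\land,0,1,-1\rangle$ such that $\langle M;\lor,\land\rangle$ is a distributive lattice, $\langle M;+,0\rangle$ is a commutative monoid, $+$ distributes over $\lor$ and $\land$, $-1+1=0$, $-1\le 0\le 1$, and for every $x\in M$ there is an integer $n\geq 1$ with $n(-1)\le x\le n1$. An *MV-monoidal algebra* is an algebra $\langle A;\oplus,\odot,\lor,\land,0,1\rangle$ such that $\langle A;\lor,\land\rangle$ is a distributive lattice, $\langle A;\oplus,0\rangle$ and $\langle A;\odot,1\rangle$ are commutative monoids, $\oplus$ and $\odot$ distribute over $\lor$ and $\land$, and $$(x\oplus y)\odot((x\odot y)\oplus z)=(x\odot(y\oplus z))\oplus(y\odot z),\qquad (x\odot y)\oplus((x\oplus y)\odot z)=(x\oplus(y\odot z))\odot(y\oplus z),$$ $$(x\odot y)\oplus z=((x\oplus y)\odot((x\odot y)\oplus z))\lor z,\qquad (x\oplus y)\odot z=((x\odot y)\oplus((x\oplus y)\odot z))\land z.$$ Let $\mathsf{ULM}$ and $\mathsf{MVM}$ be the categories of these algebras and all homomorphisms. A *unital Abelian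 $\ell$-group* is an algebra $\langle G;+,\lor,\land,0,-,1\rangle$ consisting of an Abelian group and a lattice such that $+$ distributes over $\lor$ and $\land$, with $0\le 1$ and such that for every $x$ there is $n\in\mathbb N$ with $x\le n1$. An *MV-algebra* is an algebra $\langle A;\oplus,\lnot,0\rangle$ such that $\langle A;\oplus,0\rangle$ is a commutative monoid, $\lnot 0\oplus x=\lnot 0$, $\lnot\lnot x=x$ and $\lnot(\lnot x\oplus y)\oplus y=\lnot(\lnot y\oplus x)\oplus x$. Let $\mathsf{ULG}$ and $\mathsf{MV}$ be the categories of these algebras and all homomorphisms. A unital Abelian $\ell$-group has a $\{+,\lor,\land,0,1,-1\}$-reduct, in which $-1$ is the inverse of $1$; an MV-algebra has a $\{\oplus,\odot,\lor,\land,0,1\}$-reduct, in which $1=\lnot 0$, $x\odot y=\lnot(\lnot x\oplus\lnot y)$, $x\lor y=(x\odot\lnot y)\oplus y$ and $x\land y=x\odot(\lnot x\oplus y)$. For $M\in\mathsf{ULM}$ let $\Gamma(M)=\{x\in M: 0\le x\le 1\}$ with $0,1,\lor,\land$ restricted from $M$, $x\oplus y=(x+y)\land 1$ and $x\odot y=(x+y+(-1))\lor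 0$; on homomorphisms $\Gamma$ is restriction. For $A\in\mathsf{MVM}$, a *good $\mathbb Z$-sequence* is a function $a\colon\mathbb Z\to A$ which is $1$ at all sufficiently small and $0$ at all sufficiently large integers and satisfies $a(k)\oplus a(k+1)=a(k)$ and $a(k)\odot a(k+1)=a(k+1)$ for all $k$. Let $\Xi(A)$ be the set of good $\mathbb Z$-sequences in $A$ with pointwise $\lor,\land$, with $(a+b)(n)=\bigodot_{k\in\mathbb Z}a(k)\oplus b(n-k)$, and with the constant $m\in\{0,1,-1\}$ given by the sequence that is $1$ at all $n<m$ and $0$ at all $n\ge m$; for a homomorphism $f$ let $\Xi(f)(a)(n)=f(a(n))$. For $G\in\mathsf{ULG}$ let $\Gamma'(G)=\{x\in G:0\le x\le 1\}$ with $0$, $x\oplus y=(x+y)\land 1$ and $\lnot x=1-x$ (Mundici's functor); on homomorphisms $\Gamma'$ is restriction. **Theorem.** 1. The above constructions define functors $\Gamma\colon\mathsf{ULM}\to\mathsf{MVM}$, $\Xi\colon\mathsf{MVM}\to\mathsf{ULM}$ and $\Gamma'\colon\mathsf{ULG}\to\mathsf{MV}$, and the reducts define functors $I\colon\mathsf{ULG}\to\mathsf{ULM}$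 and $J\colon\mathsf{MV}\to\mathsf{MVM}$ that are full, faithful and injective on objects. 2. There is an adjunction $\Gamma\dashv\Xi$ whose unit and counit are isomorphisms, namely $x\mapsto\big(n\mapsto((x-n)\lor 0)\land 1\big)$ for $x\in M\in\mathsf{ULM}$ and $a\mapsto a(0)$ for $a\in\Gamma\Xi(A)$, $A\in\mathsf{MVM}$. In particular $\Gamma$ and $\Xi$ are quasi-inverse equivalences. 3. This equivalence restricts to Mundici's equivalence between $\mathsf{ULG}$ and $\mathsf{MV}$: there are a functor $\Xi'\colon\mathsf{MV}\to\mathsf{ULG}$, an adjunction $\Gamma'\dashv\Xi'$ whose unit and counit are isomorphisms, and natural isomorphisms $\alpha\colon\Gamma I\cong J\Gamma'$ and $\beta\colon\Xi J\cong I\Xi'$, where $\alpha$ is the identity on underlying sets, such that $\alpha$ and $\beta$ carry the unit and the counit of $\Gamma\dashv\Xi$ (at objects in the images of $I$ and $J$) to the images under $I$ and $J$ of the unit and the counit of $\Gamma'\dashv\Xi'$. -/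

import Mathlib

open CategoryTheory

universe u

/-! ### Lattices as algebras -/

/-- The order of a lattice, expressed through its join. -/
def LatLE {L : Type*} [Max L] (x y : L) : Prop := x ⊔ y = y

/-- `⟨L; ∨, ∧⟩` is a lattice. -/
structure IsLatticeAlg (L : Type*) [Max L] [Min L] : Prop where
  sup_comm : ∀ x y : L, x ⊔ y = y ⊔ x
  inf_comm : ∀ x y : L, x ⊓ y = y ⊓ x
  sup_assoc : ∀ x y z : L, (x ⊔ y) ⊔ z = x ⊔ (y ⊔ z)
  inf_assoc : ∀ x y z : L, (x ⊓ y) ⊓ z = x ⊓ (y ⊓ z)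
  sup_inf_self : ∀ x y : L, x ⊔ (x ⊓ y) = x
  inf_sup_self : ∀ x y : L, x ⊓ (x ⊔ y) = x

/-- `⟨L; ∨, ∧⟩` is a distributive lattice. -/
structure IsDistribLatticeAlg (L : Type*) [Max L] [Min L] : Prop extends IsLatticeAlg L where
  sup_inf_left : ∀ x y z : L, x ⊔ (y ⊓ z) = (x ⊔ y) ⊓ (x ⊔ z)

/-- `⟨M; +, ∨, ∧, 0⟩` is a commutative lattice-ordered monoid. -/
structure IsCommLMonoid (M : Type*) [Add M] [Max M] [Min M] [Zero M] : Prop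
    extends IsLatticeAlg M where
  add_assoc : ∀ x y z : M, (x + y) + z = x + (y + z)
  add_comm : ∀ x y : M, x + y = y + x
  add_zero : ∀ x : M, x + 0 = x
  sup_add : ∀ x y z : M, (x ⊔ y) + z = (x + z) ⊔ (y + z)
  inf_add : ∀ x y z : M, (x ⊓ y) + z = (x + z) ⊓ (y + z)

/-- The `n`-fold sum `x + ⋯ + x`. -/
def natMul {M : Type*} [Add M] [Zero M] : ℕ → M → M
  | 0, _ => 0
  | n + 1, x => natMul n x + x

/-- The set of elements `x` with `0 ≤ x ≤ 1`. -/
abbrev UnitSegment (M : Type*) [Max M] [Zero M] [One M] : Type _ :=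
  {x : M // LatLE 0 x ∧ LatLE x 1}

section lattice_facts

variable {L : Type*} [Max L] [Min L]

/-- The Mathlib lattice given by a lattice in the algebraic sense; its order is `LatLE`. -/
abbrev IsLatticeAlg.toLattice (h : IsLatticeAlg L) : Lattice L :=
  Lattice.mk' h.sup_comm h.sup_assoc h.inf_comm h.inf_assoc h.sup_inf_self h.inf_sup_self

theorem IsLatticeAlg.le_inf (h : IsLatticeAlg L) {x y z : L} (hy : LatLE x y) (hz : LatLE x z) :
    LatLE x (y ⊓ z) := @_root_.le_inf L h.toLattice.toSemilatticeInf x y z hy hz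

theorem IsLatticeAlg.sup_le (h : IsLatticeAlg L) {x y z : L} (hy : LatLE x z) (hz : LatLE y z) :
    LatLE (x ⊔ y) z := @_root_.sup_le L h.toLattice.toSemilatticeSup x y z hy hz

theorem IsLatticeAlg.le_refl (h : IsLatticeAlg L) (x : L) : LatLE x x :=
  @_root_.le_refl L h.toLattice.toPartialOrder.toPreorder x

theorem IsLatticeAlg.le_trans (h : IsLatticeAlg L) {x y z : L} (hy : LatLE x y)
    (hz : LatLE y z) : LatLE x z :=
  @_root_.le_trans L h.toLattice.toPartialOrder.toPreorder x y z hy hz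

theorem IsLatticeAlg.inf_le_left (h : IsLatticeAlg L) (x y : L) : LatLE (x ⊓ y) x :=
  @_root_.inf_le_left L h.toLattice.toSemilatticeInf x y

theorem IsLatticeAlg.inf_le_right (h : IsLatticeAlg L) (x y : L) : LatLE (x ⊓ y) y :=
  @_root_.inf_le_right L h.toLattice.toSemilatticeInf x y

theorem IsLatticeAlg.le_sup_left (h : IsLatticeAlg L) (x y : L) : LatLE x (x ⊔ y) :=
  @_root_.le_sup_left L h.toLattice.toSemilatticeSup x y

theorem IsLatticeAlg.le_sup_right (h : IsLatticeAlg L) (x y : L) : LatLE y (x ⊔ y) :=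
  @_root_.le_sup_right L h.toLattice.toSemilatticeSup x y

theorem IsCommLMonoid.add_le_add [Add L] [Zero L] (h : IsCommLMonoid L) {a b c d : L}
    (hab : LatLE a b) (hcd : LatLE c d) : LatLE (a + c) (b + d) := by
  have key : ∀ {p q : L} (r : L), LatLE p q → LatLE (p + r) (q + r) := by
    intro p q r hpq
    change (p + r) ⊔ (q + r) = q + r
    rw [← h.sup_add, hpq]
  refine h.le_trans (key c hab) ?_
  rw [h.add_comm b c, h.add_comm b d]
  exact key b hcd

theorem IsCommLMonoid.zero_add [Add L] [Zero L] (h : IsCommLMonoid L) (x : L) : 0 + x = x := by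
  rw [h.add_comm, h.add_zero]

end lattice_facts

/-! ### Unital commutative distributive `ℓ`-monoids -/

/-- The signature `{+, ∨, ∧, 0, 1, -1}`. -/
class ULMSig (M : Type u) extends Add M, Max M, Min M, Zero M, One M where
  /-- the constant `-1` -/
  negUnit : M

/-- `M` is a unital commutative distributive lattice-ordered monoid. -/
structure IsUnitalCommDistribLMonoid (M : Type u) [ULMSig M] : Prop
    extends IsCommLMonoid M, IsDistribLatticeAlg M where
  negUnit_add_one : (ULMSig.negUnit : M) + 1 = 0
  negUnit_le_zero : LatLE (ULMSig.negUnit : M) 0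
  zero_le_one : LatLE (0 : M) 1
  bounded : ∀ x : M, ∃ n : ℕ, 0 < n ∧
    LatLE (natMul n (ULMSig.negUnit : M)) x ∧ LatLE x (natMul n (1 : M))

/-- An algebra in the signature `{+, ∨, ∧, 0, 1, -1}`. -/
structure ULMAlg : Type (u + 1) where
  carrier : Type u
  [sig : ULMSig carrier]

attribute [instance] ULMAlg.sig

/-- A homomorphism of algebras in the signature `{+, ∨, ∧, 0, 1, -1}`. -/
@[ext] structure ULMAlg.Hom (M N : ULMAlg.{u}) where
  toFun : M.carrier → N.carrier
  map_add : ∀ x y, toFun (x + y) = toFun x + toFun y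
  map_sup : ∀ x y, toFun (x ⊔ y) = toFun x ⊔ toFun y
  map_inf : ∀ x y, toFun (x ⊓ y) = toFun x ⊓ toFun y
  map_zero : toFun 0 = 0
  map_one : toFun 1 = 1
  map_negUnit : toFun ULMSig.negUnit = ULMSig.negUnit

instance : Category.{u} ULMAlg.{u} where
  Hom := ULMAlg.Hom
  id M := ⟨id, fun _ _ => rfl, fun _ _ => rfl, fun _ _ => rfl, rfl, rfl, rfl⟩
  comp f g := ⟨g.toFun ∘ f.toFun,
    fun x y => by simp [f.map_add, g.map_add], fun x y => by simp [f.map_sup, g.map_sup],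
    fun x y => by simp [f.map_inf, g.map_inf], by simp [f.map_zero, g.map_zero],
    by simp [f.map_one, g.map_one], by simp [f.map_negUnit, g.map_negUnit]⟩

/-- The class of unital commutative distributive `ℓ`-monoids. -/
def isULM : ObjectProperty ULMAlg.{u} := fun M => IsUnitalCommDistribLMonoid M.carrier

/-- The category of unital commutative distributive `ℓ`-monoids and homomorphisms. -/
abbrev ULM : Type (u + 1) := isULM.{u}.FullSubcategory

/-- The integer `n`, as an element of an algebra with constants `1` and `-1`. -/
def intElt {M : Type u} [ULMSig M] : ℤ → M
  | Int.ofNat k => natMul k 1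
  | Int.negSucc k => natMul (k + 1) ULMSig.negUnit

/-! ### MV-monoidal algebras -/

/-- A type with a binary operation `⊕`. -/
class OPlus (A : Type u) where
  oplus : A → A → A

/-- A type with a binary operation `⊙`. -/
class ODot (A : Type u) where
  odot : A → A → A

infixl:65 " ⊕ₘ " => OPlus.oplus
infixl:70 " ⊙ₘ " => ODot.odot

/-- The signature `{⊕, ⊙, ∨, ∧, 0, 1}`. -/
class MVMSig (A : Type u) extends OPlus A, ODot A, Max A, Min A, Zero A, One A

/-- `A` is an MV-monoidal algebra. -/
structure IsMVMonoidalAlgebra (A : Type u) [MVMSig A] : Prop extends IsDistribLatticeAlg A where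
  oplus_assoc : ∀ x y z : A, (x ⊕ₘ y) ⊕ₘ z = x ⊕ₘ (y ⊕ₘ z)
  oplus_comm : ∀ x y : A, x ⊕ₘ y = y ⊕ₘ x
  oplus_zero : ∀ x : A, x ⊕ₘ 0 = x
  odot_assoc : ∀ x y z : A, (x ⊙ₘ y) ⊙ₘ z = x ⊙ₘ (y ⊙ₘ z)
  odot_comm : ∀ x y : A, x ⊙ₘ y = y ⊙ₘ x
  odot_one : ∀ x : A, x ⊙ₘ 1 = x
  sup_oplus : ∀ x y z : A, (x ⊔ y) ⊕ₘ z = (x ⊕ₘ z) ⊔ (y ⊕ₘ z)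
  inf_oplus : ∀ x y z : A, (x ⊓ y) ⊕ₘ z = (x ⊕ₘ z) ⊓ (y ⊕ₘ z)
  sup_odot : ∀ x y z : A, (x ⊔ y) ⊙ₘ z = (x ⊙ₘ z) ⊔ (y ⊙ₘ z)
  inf_odot : ∀ x y z : A, (x ⊓ y) ⊙ₘ z = (x ⊙ₘ z) ⊓ (y ⊙ₘ z)
  ax4 : ∀ x y z : A,
    (x ⊕ₘ y) ⊙ₘ ((x ⊙ₘ y) ⊕ₘ z) = (x ⊙ₘ (y ⊕ₘ z)) ⊕ₘ (y ⊙ₘ z)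
  ax5 : ∀ x y z : A,
    (x ⊙ₘ y) ⊕ₘ ((x ⊕ₘ y) ⊙ₘ z) = (x ⊕ₘ (y ⊙ₘ z)) ⊙ₘ (y ⊕ₘ z)
  ax6 : ∀ x y z : A, (x ⊙ₘ y) ⊕ₘ z = ((x ⊕ₘ y) ⊙ₘ ((x ⊙ₘ y) ⊕ₘ z)) ⊔ z
  ax7 : ∀ x y z : A, (x ⊕ₘ y) ⊙ₘ z = ((x ⊙ₘ y) ⊕ₘ ((x ⊕ₘ y) ⊙ₘ z)) ⊓ z

/-- An algebra in the signature `{⊕, ⊙, ∨, ∧, 0, 1}`. -/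
structure MVMAlg : Type (u + 1) where
  carrier : Type u
  [sig : MVMSig carrier]

attribute [instance] MVMAlg.sig

/-- A homomorphism of algebras in the signature `{⊕, ⊙, ∨, ∧, 0, 1}`. -/
@[ext] structure MVMAlg.Hom (A B : MVMAlg.{u}) where
  toFun : A.carrier → B.carrier
  map_oplus : ∀ x y, toFun (x ⊕ₘ y) = toFun x ⊕ₘ toFun y
  map_odot : ∀ x y, toFun (x ⊙ₘ y) = toFun x ⊙ₘ toFun y
  map_sup : ∀ x y, toFun (x ⊔ y) = toFun x ⊔ toFun y
  map_inf : ∀ x y, toFun (x ⊓ y) = toFun x ⊓ toFun y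
  map_zero : toFun 0 = 0
  map_one : toFun 1 = 1

instance : Category.{u} MVMAlg.{u} where
  Hom := MVMAlg.Hom
  id A := ⟨id, fun _ _ => rfl, fun _ _ => rfl, fun _ _ => rfl, fun _ _ => rfl, rfl, rfl⟩
  comp f g := ⟨g.toFun ∘ f.toFun,
    fun x y => by simp [f.map_oplus, g.map_oplus], fun x y => by simp [f.map_odot, g.map_odot],
    fun x y => by simp [f.map_sup, g.map_sup], fun x y => by simp [f.map_inf, g.map_inf],
    by simp [f.map_zero, g.map_zero], by simp [f.map_one, g.map_one]⟩

/-- The class of MV-monoidal algebras. -/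
def isMVM : ObjectProperty MVMAlg.{u} := fun A => IsMVMonoidalAlgebra A.carrier

/-- The category of MV-monoidal algebras and homomorphisms. -/
abbrev MVM : Type (u + 1) := isMVM.{u}.FullSubcategory

/-! ### Unital Abelian `ℓ`-groups -/

/-- The signature `{+, ∨, ∧, 0, -, 1}`. -/
class ULGSig (G : Type u) extends Add G, Max G, Min G, Zero G, Neg G, One G

/-- `G` is a unital Abelian lattice-ordered group. -/
structure IsUnitalAbelianLGroup (G : Type u) [ULGSig G] : Prop extends IsCommLMonoid G where
  neg_add_cancel : ∀ x : G, -x + x = 0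
  zero_le_one : LatLE (0 : G) 1
  strong_unit : ∀ x : G, ∃ n : ℕ, LatLE x (natMul n (1 : G))

/-- An algebra in the signature `{+, ∨, ∧, 0, -, 1}`. -/
structure ULGAlg : Type (u + 1) where
  carrier : Type u
  [sig : ULGSig carrier]

attribute [instance] ULGAlg.sig

/-- A homomorphism of algebras in the signature `{+, ∨, ∧, 0, -, 1}`. -/
@[ext] structure ULGAlg.Hom (G H : ULGAlg.{u}) where
  toFun : G.carrier → H.carrier
  map_add : ∀ x y, toFun (x + y) = toFun x + toFun y
  map_sup : ∀ x y, toFun (x ⊔ y) = toFun x ⊔ toFun y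
  map_inf : ∀ x y, toFun (x ⊓ y) = toFun x ⊓ toFun y
  map_zero : toFun 0 = 0
  map_neg : ∀ x, toFun (-x) = -toFun x
  map_one : toFun 1 = 1

instance : Category.{u} ULGAlg.{u} where
  Hom := ULGAlg.Hom
  id G := ⟨id, fun _ _ => rfl, fun _ _ => rfl, fun _ _ => rfl, rfl, fun _ => rfl, rfl⟩
  comp f g := ⟨g.toFun ∘ f.toFun,
    fun x y => by simp [f.map_add, g.map_add], fun x y => by simp [f.map_sup, g.map_sup],
    fun x y => by simp [f.map_inf, g.map_inf], by simp [f.map_zero, g.map_zero],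
    fun x => by simp [f.map_neg, g.map_neg], by simp [f.map_one, g.map_one]⟩

/-- The class of unital Abelian `ℓ`-groups. -/
def isULG : ObjectProperty ULGAlg.{u} := fun G => IsUnitalAbelianLGroup G.carrier

/-- The category of unital Abelian `ℓ`-groups and homomorphisms. -/
abbrev ULG : Type (u + 1) := isULG.{u}.FullSubcategory

/-! ### MV-algebras -/

/-- The signature `{⊕, ¬, 0}`. -/
class MVSig (A : Type u) extends OPlus A, Zero A where
  /-- the operation `¬` -/
  mneg : A → A

prefix:max "¬ₘ" => MVSig.mneg

/-- `A` is an MV-algebra. -/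
structure IsMVAlgebra (A : Type u) [MVSig A] : Prop where
  oplus_assoc : ∀ x y z : A, (x ⊕ₘ y) ⊕ₘ z = x ⊕ₘ (y ⊕ₘ z)
  oplus_comm : ∀ x y : A, x ⊕ₘ y = y ⊕ₘ x
  oplus_zero : ∀ x : A, x ⊕ₘ 0 = x
  mneg_zero_oplus : ∀ x : A, ¬ₘ(0 : A) ⊕ₘ x = ¬ₘ(0 : A)
  mneg_mneg : ∀ x : A, ¬ₘ(¬ₘx) = x
  mneg_oplus_oplus : ∀ x y : A, ¬ₘ(¬ₘx ⊕ₘ y) ⊕ₘ y = ¬ₘ(¬ₘy ⊕ₘ x) ⊕ₘ x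

/-- An algebra in the signature `{⊕, ¬, 0}`. -/
structure MVAlg : Type (u + 1) where
  carrier : Type u
  [sig : MVSig carrier]

attribute [instance] MVAlg.sig

/-- A homomorphism of algebras in the signature `{⊕, ¬, 0}`. -/
@[ext] structure MVAlg.Hom (A B : MVAlg.{u}) where
  toFun : A.carrier → B.carrier
  map_oplus : ∀ x y, toFun (x ⊕ₘ y) = toFun x ⊕ₘ toFun y
  map_mneg : ∀ x, toFun (¬ₘx) = ¬ₘ(toFun x)
  map_zero : toFun 0 = 0

instance : Category.{u} MVAlg.{u} where
  Hom := MVAlg.Hom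
  id A := ⟨id, fun _ _ => rfl, fun _ => rfl, rfl⟩
  comp f g := ⟨g.toFun ∘ f.toFun,
    fun x y => by simp [f.map_oplus, g.map_oplus], fun x => by simp [f.map_mneg, g.map_mneg],
    by simp [f.map_zero, g.map_zero]⟩

/-- The class of MV-algebras. -/
def isMV : ObjectProperty MVAlg.{u} := fun A => IsMVAlgebra A.carrier

/-- The category of MV-algebras and homomorphisms. -/
abbrev MV : Type (u + 1) := isMV.{u}.FullSubcategory

/-! ### Reducts -/

/-- The `{+, ∨, ∧, 0, 1, -1}`-reduct of a unital Abelian `ℓ`-group; the constant `-1` is the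
additive inverse of `1`. -/
def groupReduct : ULG.{u} ⥤ ULMAlg.{u} where
  obj G :=
    { carrier := G.obj.carrier
      sig := { (inferInstance : Add G.obj.carrier), (inferInstance : Max G.obj.carrier),
               (inferInstance : Min G.obj.carrier), (inferInstance : Zero G.obj.carrier),
               (inferInstance : One G.obj.carrier) with
               negUnit := -(1 : G.obj.carrier) } }
  map f :=
    { toFun := f.hom.toFun
      map_add := f.hom.map_add
      map_sup := f.hom.map_sup
      map_inf := f.hom.map_inf
      map_zero := f.hom.map_zero
      map_one := f.hom.map_one
      map_negUnit := (f.hom.map_neg 1).trans (congrArg _ f.hom.map_one) }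

/-- The `{⊕, ⊙, ∨, ∧, 0, 1}`-reduct of an MV-algebra: `1 = ¬0`, `x ⊙ y = ¬(¬x ⊕ ¬y)`,
`x ∨ y = (x ⊙ ¬y) ⊕ y` and `x ∧ y = x ⊙ (¬x ⊕ y)`. -/
def mvReduct : MV.{u} ⥤ MVMAlg.{u} where
  obj A :=
    { carrier := A.obj.carrier
      sig :=
        { oplus := fun x y => x ⊕ₘ y
          odot := fun x y => ¬ₘ(¬ₘx ⊕ₘ ¬ₘy)
          max := fun x y => ¬ₘ(¬ₘx ⊕ₘ ¬ₘ(¬ₘy)) ⊕ₘ y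
          min := fun x y => ¬ₘ(¬ₘx ⊕ₘ ¬ₘ(¬ₘx ⊕ₘ y))
          zero := 0
          one := ¬ₘ0 } }
  map {A B} f :=
    have ho := f.hom.map_oplus
    have hn := f.hom.map_mneg
    { toFun := f.hom.toFun
      map_oplus := f.hom.map_oplus
      map_odot := fun x y => by
        change f.hom.toFun (¬ₘ(¬ₘ(x : A.obj.carrier) ⊕ₘ ¬ₘ(y : A.obj.carrier))) =
          ¬ₘ(¬ₘ(f.hom.toFun x) ⊕ₘ ¬ₘ(f.hom.toFun y))
        simp only [ho, hn]
      map_sup := fun x y => by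
        change f.hom.toFun
            (¬ₘ(¬ₘ(x : A.obj.carrier) ⊕ₘ ¬ₘ(¬ₘ(y : A.obj.carrier))) ⊕ₘ (y : A.obj.carrier)) =
          ¬ₘ(¬ₘ(f.hom.toFun x) ⊕ₘ ¬ₘ(¬ₘ(f.hom.toFun y))) ⊕ₘ f.hom.toFun y
        simp only [ho, hn]
      map_inf := fun x y => by
        change f.hom.toFun
            (¬ₘ(¬ₘ(x : A.obj.carrier) ⊕ₘ ¬ₘ(¬ₘ(x : A.obj.carrier) ⊕ₘ (y : A.obj.carrier)))) =
          ¬ₘ(¬ₘ(f.hom.toFun x) ⊕ₘ ¬ₘ(¬ₘ(f.hom.toFun x) ⊕ₘ f.hom.toFun y))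
        simp only [ho, hn]
      map_zero := f.hom.map_zero
      map_one := (hn 0).trans (congrArg _ f.hom.map_zero) }

/-! ### The unit interval `Γ` -/

section unit_interval

variable {M : Type u} [ULMSig M]

/-- The algebra of all `x` with `0 ≤ x ≤ 1`, where `x ⊕ y = (x + y) ∧ 1` and
`x ⊙ y = (x + y - 1) ∨ 0`, and the other operations are restrictions. -/
abbrev unitIntervalSig (h : IsUnitalCommDistribLMonoid M) : MVMSig (UnitSegment M) where
  oplus x y := ⟨(x.1 + y.1) ⊓ 1,
    h.le_inf (by simpa [h.add_zero] using h.add_le_add x.2.1 y.2.1) h.zero_le_one,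
    h.inf_le_right _ _⟩
  odot x y := ⟨(x.1 + y.1 + ULMSig.negUnit) ⊔ 0, h.le_sup_right _ _,
    h.sup_le (by
      have h1 := h.add_le_add (h.add_le_add x.2.2 y.2.2) (h.le_refl (ULMSig.negUnit : M))
      rwa [h.add_assoc 1 1, h.add_comm 1 ULMSig.negUnit, h.negUnit_add_one, h.add_zero] at h1)
      h.zero_le_one⟩
  max x y := ⟨x.1 ⊔ y.1, h.le_trans x.2.1 (h.le_sup_left _ _), h.sup_le x.2.2 y.2.2⟩
  min x y := ⟨x.1 ⊓ y.1, h.le_inf x.2.1 y.2.1, h.le_trans (h.inf_le_left _ _) x.2.2⟩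
  zero := ⟨0, h.le_refl _, h.zero_le_one⟩
  one := ⟨1, h.zero_le_one, h.le_refl _⟩

end unit_interval

/-- `Γ` on unital commutative distributive `ℓ`-monoids; a homomorphism is sent to its
restriction. -/
def gammaULM : ULM.{u} ⥤ MVMAlg.{u} where
  obj M := { carrier := UnitSegment M.obj.carrier, sig := unitIntervalSig M.property }
  map {M N} f :=
    { toFun := fun x => ⟨f.hom.toFun x.1,
        (f.hom.map_zero ▸ (f.hom.map_sup _ _).symm.trans (congrArg _ x.2.1) :
          (0 : N.obj.carrier) ⊔ f.hom.toFun x.1 = f.hom.toFun x.1),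
        (f.hom.map_one ▸ (f.hom.map_sup _ _).symm.trans (congrArg _ x.2.2) :
          f.hom.toFun x.1 ⊔ (1 : N.obj.carrier) = 1)⟩
      map_oplus := fun x y => Subtype.ext <| by
        change f.hom.toFun ((x.1 + y.1) ⊓ 1) = (f.hom.toFun x.1 + f.hom.toFun y.1) ⊓ 1
        rw [f.hom.map_inf, f.hom.map_add, f.hom.map_one]
      map_odot := fun x y => Subtype.ext <| by
        change f.hom.toFun ((x.1 + y.1 + ULMSig.negUnit) ⊔ 0) =
          (f.hom.toFun x.1 + f.hom.toFun y.1 + ULMSig.negUnit) ⊔ 0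
        rw [f.hom.map_sup, f.hom.map_add, f.hom.map_add, f.hom.map_zero, f.hom.map_negUnit]
      map_sup := fun x y => Subtype.ext (f.hom.map_sup x.1 y.1)
      map_inf := fun x y => Subtype.ext (f.hom.map_inf x.1 y.1)
      map_zero := Subtype.ext f.hom.map_zero
      map_one := Subtype.ext f.hom.map_one }

/-- The algebra of all `x` with `0 ≤ x ≤ 1` in a unital Abelian `ℓ`-group, where
`x ⊕ y = (x + y) ∧ 1` and `¬x = 1 - x`. -/
abbrev groupUnitIntervalSig {G : Type u} [ULGSig G] (h : IsUnitalAbelianLGroup G) :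
    MVSig (UnitSegment G) where
  oplus x y := ⟨(x.1 + y.1) ⊓ 1,
    h.le_inf (by simpa [h.add_zero] using h.add_le_add x.2.1 y.2.1) h.zero_le_one,
    h.inf_le_right _ _⟩
  zero := ⟨0, h.le_refl _, h.zero_le_one⟩
  mneg x := ⟨1 + -x.1, by
      have h1 := h.add_le_add x.2.2 (h.le_refl (-x.1))
      rwa [h.add_comm x.1, h.neg_add_cancel] at h1, by
      have h1 := h.add_le_add (h.le_refl (1 + -x.1)) x.2.1
      rwa [h.add_zero, h.add_assoc, h.neg_add_cancel, h.add_zero] at h1⟩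

/-- Mundici's functor `Γ` on unital Abelian `ℓ`-groups; a homomorphism is sent to its
restriction. -/
def gammaULG : ULG.{u} ⥤ MVAlg.{u} where
  obj G := { carrier := UnitSegment G.obj.carrier, sig := groupUnitIntervalSig G.property }
  map {G H} f :=
    { toFun := fun x => ⟨f.hom.toFun x.1,
        (f.hom.map_zero ▸ (f.hom.map_sup _ _).symm.trans (congrArg _ x.2.1) :
          (0 : H.obj.carrier) ⊔ f.hom.toFun x.1 = f.hom.toFun x.1),
        (f.hom.map_one ▸ (f.hom.map_sup _ _).symm.trans (congrArg _ x.2.2) :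
          f.hom.toFun x.1 ⊔ (1 : H.obj.carrier) = 1)⟩
      map_oplus := fun x y => Subtype.ext <| by
        change f.hom.toFun ((x.1 + y.1) ⊓ 1) = (f.hom.toFun x.1 + f.hom.toFun y.1) ⊓ 1
        rw [f.hom.map_inf, f.hom.map_add, f.hom.map_one]
      map_mneg := fun x => Subtype.ext <| by
        change f.hom.toFun (1 + -x.1) = 1 + -(f.hom.toFun x.1)
        rw [f.hom.map_add, f.hom.map_neg, f.hom.map_one]
      map_zero := Subtype.ext f.hom.map_zero }

/-! ### Good `ℤ`-sequences and `Ξ` -/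

section good_sequences

variable {A : Type u} [MVMSig A]

/-- `(x₀, x₁)` is a good pair. -/
def IsGoodPair (x₀ x₁ : A) : Prop := x₀ ⊕ₘ x₁ = x₀ ∧ x₀ ⊙ₘ x₁ = x₁

/-- `a` is a good `ℤ`-sequence. -/
structure IsGoodSeq (a : ℤ → A) : Prop where
  eventually_one : ∃ n : ℤ, ∀ k : ℤ, k < n → a k = 1
  eventually_zero : ∃ m : ℤ, ∀ k : ℤ, m ≤ k → a k = 0
  good : ∀ k : ℤ, IsGoodPair (a k) (a (k + 1))

variable (A) in
/-- The set of good `ℤ`-sequences in `A`. -/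
abbrev GoodSeq : Type u := {a : ℤ → A // IsGoodSeq a}

/-- The commutative monoid `⟨A; ⊙, 1⟩`. -/
abbrev odotMonoid (h : IsMVMonoidalAlgebra A) : CommMonoid A where
  mul := fun x y => x ⊙ₘ y
  one := 1
  mul_assoc := h.odot_assoc
  mul_comm := h.odot_comm
  mul_one := h.odot_one
  one_mul := fun x => (h.odot_comm 1 x).trans (h.odot_one x)

/-- `(a + b)(n) = ⨀_{k ∈ ℤ} a(k) ⊕ b(n - k)`; for good `ℤ`-sequences all but finitely many of the
terms of this product are equal to `1`. -/
noncomputable def seqAdd (h : IsMVMonoidalAlgebra A) (a b : ℤ → A) (n : ℤ) : A :=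
  letI := odotMonoid h
  ∏ᶠ k : ℤ, (a k ⊕ₘ b (n - k))

/-- The `ℤ`-sequence that is `1` at all `n < m` and `0` at all `n ≥ m`. -/
def stepSeq (m : ℤ) (n : ℤ) : A := if n < m then 1 else 0

theorem IsMVMonoidalAlgebra.odot_zero (h : IsMVMonoidalAlgebra A) (x : A) : x ⊙ₘ 0 = 0 := by
  have key : ∀ y : A, LatLE 0 y := fun y => by
    have h6 := h.ax6 y 1 0
    rw [h.odot_one, h.oplus_zero] at h6
    rw [h6]
    exact h.le_sup_right _ _
  have htop : LatLE x 1 := by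
    have h7 := h.ax7 x 0 1
    rw [h.oplus_zero, h.odot_one] at h7
    rw [h7]
    exact h.inf_le_right _ _
  have h1 := h.sup_odot x 1 0
  rw [htop, h.odot_comm 1 0, h.odot_one, h.sup_comm] at h1
  exact (h1.trans (key _)).symm

theorem IsMVMonoidalAlgebra.one_oplus (h : IsMVMonoidalAlgebra A) (x : A) : 1 ⊕ₘ x = 1 := by
  have key : ∀ y : A, LatLE y 1 := fun y => by
    have h7 := h.ax7 y 0 1
    rw [h.oplus_zero, h.odot_one] at h7
    rw [h7]
    exact h.inf_le_right _ _
  have hbot : LatLE 0 x := by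
    have h6 := h.ax6 x 1 0
    rw [h.odot_one, h.oplus_zero] at h6
    rw [h6]
    exact h.le_sup_right _ _
  have h1 := h.sup_oplus 0 x 1
  rw [hbot, h.oplus_comm 0 1, h.oplus_zero] at h1
  rw [h.oplus_comm, h1, h.sup_comm]
  exact key _

theorem isGoodSeq_stepSeq (h : IsMVMonoidalAlgebra A) (m : ℤ) :
    IsGoodSeq (stepSeq m : ℤ → A) where
  eventually_one := ⟨m, fun k hk => if_pos hk⟩
  eventually_zero := ⟨m, fun k hk => if_neg (not_lt.mpr hk)⟩
  good k := by
    unfold stepSeq IsGoodPair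
    split_ifs with h1 h2 h2
    · exact ⟨h.one_oplus 1, h.odot_one 1⟩
    · exact ⟨h.oplus_zero 1, h.odot_zero 1⟩
    · omega
    · exact ⟨h.oplus_zero 0, h.odot_zero 0⟩

theorem seqAdd_hasFiniteMulSupport (h : IsMVMonoidalAlgebra A) {a b : ℤ → A} (ha : IsGoodSeq a)
    (hb : IsGoodSeq b) (n : ℤ) :
    letI := odotMonoid h
    Function.HasFiniteMulSupport fun k : ℤ => a k ⊕ₘ b (n - k) := by
  let _ := odotMonoid h
  obtain ⟨p, hp⟩ := ha.eventually_one
  obtain ⟨q, hq⟩ := hb.eventually_one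
  refine (Set.finite_Icc p (n - q)).subset fun k hk => ?_
  rw [Function.mem_mulSupport] at hk
  by_contra hc
  apply hk
  rw [Set.mem_Icc, not_and_or, not_le, not_le] at hc
  rcases hc with hc | hc
  · rw [hp k hc]
    exact h.one_oplus _
  · rw [hq (n - k) (by omega), h.oplus_comm]
    exact h.one_oplus _

variable (A) in
/-- The good `ℤ`-sequences are closed under `+`, `∨` and `∧`. -/
def GoodSeqClosed (h : IsMVMonoidalAlgebra A) : Prop :=
  ∀ a b : ℤ → A, IsGoodSeq a → IsGoodSeq b →
    IsGoodSeq (seqAdd h a b) ∧ IsGoodSeq (fun n => a n ⊔ b n) ∧ IsGoodSeq (fun n => a n ⊓ b n)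

/-- The algebra of good `ℤ`-sequences. -/
noncomputable abbrev goodSeqSig (h : IsMVMonoidalAlgebra A) (hc : GoodSeqClosed A h) :
    ULMSig (GoodSeq A) where
  add a b := ⟨seqAdd h a.1 b.1, (hc a.1 b.1 a.2 b.2).1⟩
  max a b := ⟨fun n => a.1 n ⊔ b.1 n, (hc a.1 b.1 a.2 b.2).2.1⟩
  min a b := ⟨fun n => a.1 n ⊓ b.1 n, (hc a.1 b.1 a.2 b.2).2.2⟩
  zero := ⟨stepSeq 0, isGoodSeq_stepSeq h 0⟩
  one := ⟨stepSeq 1, isGoodSeq_stepSeq h 1⟩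
  negUnit := ⟨stepSeq (-1), isGoodSeq_stepSeq h (-1)⟩

end good_sequences

section good_sequence_maps

variable {A B : MVMAlg.{u}} (f : A ⟶ B)

theorem IsGoodSeq.map {a : ℤ → A.carrier} (ha : IsGoodSeq a) :
    IsGoodSeq fun n => f.toFun (a n) where
  eventually_one := ha.eventually_one.imp fun _ hn k hk => by rw [hn k hk, f.map_one]
  eventually_zero := ha.eventually_zero.imp fun _ hn k hk => by rw [hn k hk, f.map_zero]
  good k := ⟨by rw [← f.map_oplus, (ha.good k).1], by rw [← f.map_odot, (ha.good k).2]⟩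

theorem map_seqAdd (hA : IsMVMonoidalAlgebra A.carrier) (hB : IsMVMonoidalAlgebra B.carrier)
    {a b : ℤ → A.carrier} (ha : IsGoodSeq a) (hb : IsGoodSeq b) (n : ℤ) :
    f.toFun (seqAdd hA a b n) =
      seqAdd hB (fun k => f.toFun (a k)) (fun k => f.toFun (b k)) n := by
  let _ := odotMonoid hA
  let _ := odotMonoid hB
  let g : A.carrier →* B.carrier :=
    { toFun := f.toFun, map_one' := f.map_one, map_mul' := f.map_odot }
  refine (g.map_finprod (seqAdd_hasFiniteMulSupport hA ha hb n)).trans ?_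
  exact finprod_congr fun k => f.map_oplus _ _

theorem map_stepSeq (m n : ℤ) : f.toFun (stepSeq m n) = stepSeq m n := by
  unfold stepSeq
  split_ifs
  · exact f.map_one
  · exact f.map_zero

end good_sequence_maps

/-- `Ξ` on MV-monoidal algebras: `Ξ(A)` is the algebra of good `ℤ`-sequences in `A`, and
`Ξ(f)(a)(n) = f(a(n))`. -/
noncomputable def xiMVM (hc : ∀ A : MVM.{u}, GoodSeqClosed A.obj.carrier A.property) :
    MVM.{u} ⥤ ULMAlg.{u} where
  obj A := { carrier := GoodSeq A.obj.carrier, sig := goodSeqSig A.property (hc A) }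
  map {A B} f :=
    { toFun := fun a => ⟨fun n => f.hom.toFun (a.1 n), a.2.map f.hom⟩
      map_add := fun a b => Subtype.ext <| funext fun n =>
        map_seqAdd f.hom A.property B.property a.2 b.2 n
      map_sup := fun a b => Subtype.ext <| funext fun n => f.hom.map_sup (a.1 n) (b.1 n)
      map_inf := fun a b => Subtype.ext <| funext fun n => f.hom.map_inf (a.1 n) (b.1 n)
      map_zero := Subtype.ext <| funext fun n => map_stepSeq f.hom 0 n
      map_one := Subtype.ext <| funext fun n => map_stepSeq f.hom 1 n
      map_negUnit := Subtype.ext <| funext fun n => map_stepSeq f.hom (-1) n }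

/-! ### Elementary theory of MV-monoidal algebras -/

/-! The difficulty lies in the sums of good sequences: closure, associativity and distributivity are
identities about long `⊙`-products. They become short in a pure algebra, one whose only good pairs
are `(1, q)` and `(p, 0)`. There a good sequence has at most one term that is not forced, `…, 1, x,
0, …`. The sum of two such is `…, 1, x ⊕ y, x ⊙ y, 0, …`, and the sum of three has middle term `mid
x y z`. Associativity then amounts to the cyclic symmetry of `mid`, which comes from `ax4`.

Pure algebras suffice, since homomorphisms to them separate points (`exists_pure_hom`). Indeed, a
congruence maximal among those separating two points `p` and `q` has a quotient in which every
nontrivial congruence identifies `p` and `q`. A good pair `(x, y)` of the quotient yields two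
congruences: one compares elements up to added copies of `y`, the other up to factors `x`. By
`le_of_goodPair_iterate` they meet in equality, so one of them is trivial, and `y = 0` or `x = 1`.
Every identity between terms of good sequences is thus checked in pure algebras.

For the unit, an element of an `ℓ`-monoid is determined by the truncations of its translates
(`eq_of_clamp_eq`), and the monoid is generated by its unit interval and `-1`. That the truncations
turn sums into sums (`etaSeq_add`) is again tested in a pure `B`: a homomorphism from the unit
interval to `B` does not distinguish a suitable translate of `x` from its truncation
(`hom_toUnit_add`), and only elements of the unit interval remain to be added. The counit is
bijective because a good sequence between `0` and `1` is free only at place `0`. By a triangle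
identity `Γ` makes the unit invertible, and `Γ` reflects bijectivity.

For Mundici's equivalence, negation is determined by the reduct: `¬x` is the only complement of `x`,
and a negative in a monoid is unique. So the reducts embed `ULG` and `MV` as full subcategories.
Complements in the unit interval yield negatives in the whole monoid, so `Ξ` sends MV-algebras to
groups up to isomorphism, and the adjunction restricts along the two fully faithful inclusions. -/

instance IsDistribLatticeAlg.instDistribLattice {A : Type u} [MVMSig A]
    [h : Fact (IsMVMonoidalAlgebra A)] : DistribLattice A :=
  let _ := h.out.toLattice
  { h.out.toLattice with
    le_sup_inf := fun x y z => le_of_eq (h.out.sup_inf_left x y z).symm }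

namespace MVMonoidal

section iterates

variable {A : Type u} [MVMSig A]

/-- The `n`-fold `⊕`-sum added to `b`. -/
def addN (x : A) : ℕ → A → A
  | 0, b => b
  | n + 1, b => addN x n b ⊕ₘ x

/-- The `n`-fold `⊙`-product multiplied with `b`. -/
def mulN (x : A) : ℕ → A → A
  | 0, b => b
  | n + 1, b => mulN x n b ⊙ₘ x

theorem addN_add (x : A) (m n : ℕ) (b : A) : addN x (m + n) b = addN x n (addN x m b) := by
  induction n with
  | zero => rfl
  | succ n ih => rw [← add_assoc, addN, ih, addN]

theorem mulN_add (x : A) (m n : ℕ) (b : A) : mulN x (m + n) b = mulN x n (mulN x m b) := by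
  induction n with
  | zero => rfl
  | succ n ih => rw [← add_assoc, mulN, ih, mulN]

end iterates

section basic

variable {A : Type u} [MVMSig A] [hA : Fact (IsMVMonoidalAlgebra A)]

/-- The bounds are not axioms: `ax6` at `(x, 1, 0)` displays `x` as a join with `0`, and dually
`ax7` gives the upper bound. -/
theorem zero_le (x : A) : 0 ≤ x := by
  have h := hA.out.ax6 x 1 0
  rw [hA.out.odot_one, hA.out.oplus_zero] at h
  rw [h]
  exact le_sup_right

theorem le_one (x : A) : x ≤ 1 := by
  have h := hA.out.ax7 x 0 1
  rw [hA.out.oplus_zero, hA.out.odot_one] at h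
  rw [h]
  exact inf_le_right

theorem eq_one_of_le {x : A} (h : 1 ≤ x) : x = 1 := le_antisymm (le_one x) h

theorem eq_zero_of_le {x : A} (h : x ≤ 0) : x = 0 := le_antisymm h (zero_le x)

theorem oplus_comm (x y : A) : x ⊕ₘ y = y ⊕ₘ x := hA.out.oplus_comm x y

theorem odot_comm (x y : A) : x ⊙ₘ y = y ⊙ₘ x := hA.out.odot_comm x y

theorem oplus_zero (x : A) : x ⊕ₘ 0 = x := hA.out.oplus_zero x

theorem zero_oplus (x : A) : 0 ⊕ₘ x = x := by rw [oplus_comm, oplus_zero]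

theorem odot_one (x : A) : x ⊙ₘ 1 = x := hA.out.odot_one x

theorem one_odot (x : A) : 1 ⊙ₘ x = x := by rw [odot_comm, odot_one]

theorem odot_zero (x : A) : x ⊙ₘ 0 = 0 := hA.out.odot_zero x

theorem zero_odot (x : A) : 0 ⊙ₘ x = 0 := by rw [odot_comm, odot_zero]

theorem one_oplus (x : A) : 1 ⊕ₘ x = 1 := hA.out.one_oplus x

theorem oplus_one (x : A) : x ⊕ₘ 1 = 1 := by rw [oplus_comm, one_oplus]

theorem oplus_assoc (x y z : A) : x ⊕ₘ y ⊕ₘ z = x ⊕ₘ (y ⊕ₘ z) := hA.out.oplus_assoc x y z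

theorem odot_assoc (x y z : A) : x ⊙ₘ y ⊙ₘ z = x ⊙ₘ (y ⊙ₘ z) := hA.out.odot_assoc x y z

theorem oplus_le_oplus {a b c d : A} (h₁ : a ≤ b) (h₂ : c ≤ d) : a ⊕ₘ c ≤ b ⊕ₘ d := by
  have key : ∀ {p q : A} (r : A), p ≤ q → p ⊕ₘ r ≤ q ⊕ₘ r := fun {p q} r h => by
    rw [← sup_eq_right.2 h, hA.out.sup_oplus]
    exact le_sup_left
  refine (key c h₁).trans ?_
  rw [oplus_comm b c, oplus_comm b d]
  exact key b h₂

theorem odot_le_odot {a b c d : A} (h₁ : a ≤ b) (h₂ : c ≤ d) : a ⊙ₘ c ≤ b ⊙ₘ d := by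
  have key : ∀ {p q : A} (r : A), p ≤ q → p ⊙ₘ r ≤ q ⊙ₘ r := fun {p q} r h => by
    rw [← sup_eq_right.2 h, hA.out.sup_odot]
    exact le_sup_left
  refine (key c h₁).trans ?_
  rw [odot_comm b c, odot_comm b d]
  exact key b h₂

theorem le_oplus_left (x y : A) : x ≤ x ⊕ₘ y := by
  simpa only [oplus_zero] using oplus_le_oplus (le_refl x) (zero_le y)

theorem le_oplus_right (x y : A) : y ≤ x ⊕ₘ y := by
  rw [oplus_comm]; exact le_oplus_left y x

theorem odot_le_left (x y : A) : x ⊙ₘ y ≤ x := by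
  simpa only [odot_one] using odot_le_odot (le_refl x) (le_one y)

theorem odot_le_right (x y : A) : x ⊙ₘ y ≤ y := by
  rw [odot_comm]; exact odot_le_left y x

/-- The source of all nontrivial good pairs: `ax5` at `z = 1` and `ax4` at `z = 0`. -/
theorem isGoodPair_oplus_odot (x y : A) : IsGoodPair (x ⊕ₘ y) (x ⊙ₘ y) := by
  constructor
  · have h := hA.out.ax5 x y 1
    rwa [odot_one, odot_one, oplus_one, odot_one, oplus_comm] at h
  · have h := hA.out.ax4 x y 0
    rwa [oplus_zero, oplus_zero, odot_zero, oplus_zero] at h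

theorem isGoodPair_zero (x : A) : IsGoodPair x 0 := ⟨oplus_zero x, odot_zero x⟩

theorem isGoodPair_one (x : A) : IsGoodPair 1 x := ⟨one_oplus x, one_odot x⟩

/-- For a good pair, `ax4` at `(q, p, z)` rewrites the left side as `(q ⊙ (p ⊕ z)) ⊕ (p ⊙ z)`, whose
first summand is below `q`. -/
theorem odot_oplus_le_of_goodPair {p q : A} (h : IsGoodPair p q) (z : A) :
    p ⊙ₘ (q ⊕ₘ z) ≤ q ⊕ₘ (p ⊙ₘ z) := by
  have h4 := hA.out.ax4 q p z
  rw [oplus_comm q p, odot_comm q p, h.1, h.2] at h4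
  rw [h4]
  exact oplus_le_oplus (odot_le_left _ _) le_rfl

theorem oplus_odot_le (x y z : A) : (x ⊕ₘ y) ⊙ₘ z ≤ x ⊕ₘ (y ⊙ₘ z) := by
  calc (x ⊕ₘ y) ⊙ₘ z ≤ (x ⊕ₘ y) ⊙ₘ (x ⊙ₘ y ⊕ₘ z) := odot_le_odot le_rfl (le_oplus_right _ _)
    _ = (x ⊙ₘ (y ⊕ₘ z)) ⊕ₘ (y ⊙ₘ z) := hA.out.ax4 x y z
    _ ≤ x ⊕ₘ (y ⊙ₘ z) := oplus_le_oplus (odot_le_left _ _) le_rfl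

/-- The truncation of `x + y + z - 1` to the unit interval. -/
def mid (x y z : A) : A := (x ⊕ₘ y) ⊙ₘ (x ⊙ₘ y ⊕ₘ z)

/-- Applied to the good pair `(y ⊕ z, y ⊙ z)`, the preceding inequality compares `mid` with its
rotation. Going once round the 3-cycle forces equality. -/
theorem mid_rotate (x y z : A) : mid x y z = mid y z x := by
  have key : ∀ x y z : A, mid y z x ≤ mid x y z := fun x y z => by
    have h := odot_oplus_le_of_goodPair (isGoodPair_oplus_odot y z) x
    rw [mid, mid, hA.out.ax4 x y z, oplus_comm (x ⊙ₘ _), odot_comm x (y ⊕ₘ z)]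
    exact h
  exact le_antisymm ((key z x y).trans (key y z x)) (key x y z)

/-- A cancellation law. By `ax6`, `q ⊕ b` is the join of `b` with `p ⊙ (q ⊕ b)`. By distributivity
it then suffices to bound the meet of `a` with the latter. That meet lies below `(q ⊕ (p ⊙ a)) ⊓ a`,
which `ax7` identifies with `p ⊙ a`. -/
theorem le_of_goodPair {p q a b : A} (h : IsGoodPair p q) (h₁ : a ≤ b ⊕ₘ q) (h₂ : a ⊙ₘ p ≤ b) :
    a ≤ b := by
  -- Replacing `b` by `a ⊓ b` preserves both hypotheses, because `⊕` distributes over meets.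
  wlog hba : b ≤ a generalizing b with H
  · refine (H (b := a ⊓ b) ?_ ?_ inf_le_left).trans inf_le_right
    · rw [hA.out.inf_oplus]
      exact le_inf (le_oplus_left _ _) h₁
    · exact le_inf (odot_le_left _ _) h₂
  have h6 := hA.out.ax6 p q b
  rw [h.1, h.2] at h6
  have h7 := hA.out.ax7 p q a
  rw [h.1, h.2] at h7
  have h8 : a ⊓ (p ⊙ₘ (q ⊕ₘ b)) ≤ b := by
    refine le_trans ?_ h₂
    rw [odot_comm a p, h7, inf_comm]
    refine inf_le_inf_right _ ?_
    exact (odot_le_odot le_rfl (oplus_le_oplus le_rfl hba)).trans (odot_oplus_le_of_goodPair h a)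
  rw [oplus_comm, h6] at h₁
  calc a = a ⊓ ((p ⊙ₘ (q ⊕ₘ b)) ⊔ b) := (inf_eq_left.2 h₁).symm
    _ = a ⊓ (p ⊙ₘ (q ⊕ₘ b)) ⊔ a ⊓ b := inf_sup_left _ _ _
    _ ≤ b := sup_le h8 inf_le_right

theorem le_addN (x : A) (n : ℕ) (b : A) : b ≤ addN x n b := by
  induction n with
  | zero => exact le_rfl
  | succ n ih => exact ih.trans (le_oplus_left _ _)

theorem mulN_le (x : A) (n : ℕ) (b : A) : mulN x n b ≤ b := by
  induction n with
  | zero => exact le_rfl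
  | succ n ih => exact (odot_le_left _ _).trans ih

theorem addN_eq (x : A) (n : ℕ) (b : A) : addN x n b = b ⊕ₘ addN x n 0 := by
  induction n with
  | zero => exact (oplus_zero b).symm
  | succ n ih => rw [addN, ih, oplus_assoc, addN]

theorem mulN_eq (x : A) (n : ℕ) (b : A) : mulN x n b = b ⊙ₘ mulN x n 1 := by
  induction n with
  | zero => exact (odot_one b).symm
  | succ n ih => rw [mulN, ih, odot_assoc, mulN]

/-- The summands `q` are removed one at a time while the factor `p` is single; the resulting
implication then removes the factors `p` one at a time. -/
theorem le_of_goodPair_iterate {p q a b : A} (h : IsGoodPair p q) {m n : ℕ}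
    (h₁ : a ≤ addN q m b) (h₂ : mulN p n a ≤ b) : a ≤ b := by
  have key : ∀ a : A, a ⊙ₘ p ≤ b → a ≤ addN q m b → a ≤ b := by
    clear h₁
    induction m with
    | zero => exact fun a _ h => h
    | succ m ih =>
      intro a ha ha'
      exact ih a ha (le_of_goodPair h ha' (ha.trans (le_addN _ _ _)))
  induction n with
  | zero => exact h₂
  | succ n ih => exact ih (key _ h₂ ((mulN_le _ _ _).trans h₁))

end basic

/-! ### Congruences and quotients -/

/-- A set of pairs is a congruence. -/
structure IsCongruence {A : Type u} [MVMSig A] (R : Set (A × A)) : Prop where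
  refl : ∀ a, (a, a) ∈ R
  symm : ∀ {a b}, (a, b) ∈ R → (b, a) ∈ R
  trans : ∀ {a b c}, (a, b) ∈ R → (b, c) ∈ R → (a, c) ∈ R
  oplus : ∀ {a b c d}, (a, b) ∈ R → (c, d) ∈ R → (a ⊕ₘ c, b ⊕ₘ d) ∈ R
  odot : ∀ {a b c d}, (a, b) ∈ R → (c, d) ∈ R → (a ⊙ₘ c, b ⊙ₘ d) ∈ R
  sup : ∀ {a b c d}, (a, b) ∈ R → (c, d) ∈ R → (a ⊔ c, b ⊔ d) ∈ R
  inf : ∀ {a b c d}, (a, b) ∈ R → (c, d) ∈ R → (a ⊓ c, b ⊓ d) ∈ R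

/-- An algebra is pure if its good pairs are the trivial ones. -/
def IsPure (A : Type u) [MVMSig A] : Prop := ∀ p q : A, IsGoodPair p q → p = 1 ∨ q = 0

section congruence

variable {A : Type u} [MVMSig A]

theorem isCongruence_of_le (r : A → A → Prop) (refl : ∀ a, r a a)
    (trans : ∀ {a b c}, r a b → r b c → r a c)
    (oplus : ∀ {a b c d}, r a b → r c d → r (a ⊕ₘ c) (b ⊕ₘ d))
    (odot : ∀ {a b c d}, r a b → r c d → r (a ⊙ₘ c) (b ⊙ₘ d))
    (sup : ∀ {a b c d}, r a b → r c d → r (a ⊔ c) (b ⊔ d))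
    (inf : ∀ {a b c d}, r a b → r c d → r (a ⊓ c) (b ⊓ d)) :
    IsCongruence {x : A × A | r x.1 x.2 ∧ r x.2 x.1} where
  refl a := ⟨refl a, refl a⟩
  symm h := ⟨h.2, h.1⟩
  trans h h' := ⟨trans h.1 h'.1, trans h'.2 h.2⟩
  oplus h h' := ⟨oplus h.1 h'.1, oplus h.2 h'.2⟩
  odot h h' := ⟨odot h.1 h'.1, odot h.2 h'.2⟩
  sup h h' := ⟨sup h.1 h'.1, sup h.2 h'.2⟩
  inf h h' := ⟨inf h.1 h'.1, inf h.2 h'.2⟩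

end congruence

/-! ### The congruences that identify an element with `0` or with `1` -/

section congruence

variable {A : Type u} [MVMSig A] [hA : Fact (IsMVMonoidalAlgebra A)]

theorem addN_mono (x : A) {m n : ℕ} {a b : A} (hmn : m ≤ n) (hab : a ≤ b) :
    addN x m a ≤ addN x n b := by
  obtain ⟨k, rfl⟩ := Nat.exists_eq_add_of_le hmn
  rw [addN_add]
  refine le_trans ?_ (le_addN _ _ _)
  rw [addN_eq x m a, addN_eq x m b]
  exact oplus_le_oplus hab le_rfl

theorem mulN_mono (x : A) {m n : ℕ} {a b : A} (hmn : m ≤ n) (hab : a ≤ b) :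
    mulN x n a ≤ mulN x m b := by
  obtain ⟨k, rfl⟩ := Nat.exists_eq_add_of_le hmn
  rw [mulN_add]
  refine (mulN_le _ _ _).trans ?_
  rw [mulN_eq x m a, mulN_eq x m b]
  exact odot_le_odot hab le_rfl

theorem addN_oplus (x : A) (m n : ℕ) (a b : A) :
    addN x m a ⊕ₘ addN x n b = addN x (m + n) (a ⊕ₘ b) := by
  rw [addN_add, addN_eq x n (addN x m _), addN_eq x m (a ⊕ₘ b), addN_eq x m a, addN_eq x n b]
  rw [oplus_assoc, oplus_assoc, oplus_assoc, ← oplus_assoc _ b, ← oplus_assoc b,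
    oplus_comm _ b]

theorem mulN_odot (x : A) (m n : ℕ) (a b : A) :
    mulN x m a ⊙ₘ mulN x n b = mulN x (m + n) (a ⊙ₘ b) := by
  rw [mulN_add, mulN_eq x n (mulN x m _), mulN_eq x m (a ⊙ₘ b), mulN_eq x m a, mulN_eq x n b]
  rw [odot_assoc, odot_assoc, odot_assoc, ← odot_assoc _ b, ← odot_assoc b,
    odot_comm _ b]

/-- Two uses of the weak distributive law `oplus_odot_le` move the copies of `x` out of the product.
This makes comparison up to copies of `x` compatible with `⊙`; `le_mulN_oplus` is the dual. -/
theorem addN_odot_le (x : A) (m n : ℕ) (a b : A) :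
    addN x m a ⊙ₘ addN x n b ≤ addN x (m + n) (a ⊙ₘ b) := by
  rw [addN_add, addN_eq x n (addN x m _), addN_eq x m (a ⊙ₘ b), addN_eq x m a, addN_eq x n b]
  calc (a ⊕ₘ addN x m 0) ⊙ₘ (b ⊕ₘ addN x n 0)
      ≤ addN x m 0 ⊕ₘ (a ⊙ₘ (b ⊕ₘ addN x n 0)) := by
        rw [oplus_comm a]; exact oplus_odot_le _ _ _
    _ ≤ addN x m 0 ⊕ₘ (addN x n 0 ⊕ₘ (b ⊙ₘ a)) := by
        refine oplus_le_oplus le_rfl ?_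
        rw [odot_comm a, oplus_comm b]; exact oplus_odot_le _ _ _
    _ = _ := by rw [odot_comm b, oplus_comm (addN x n 0), ← oplus_assoc, oplus_comm _ (a ⊙ₘ b)]

theorem le_mulN_oplus (x : A) (m n : ℕ) (a b : A) :
    mulN x (m + n) (a ⊕ₘ b) ≤ mulN x m a ⊕ₘ mulN x n b := by
  rw [mulN_add, mulN_eq x n (mulN x m _), mulN_eq x m (a ⊕ₘ b), mulN_eq x m a, mulN_eq x n b]
  calc ((a ⊕ₘ b) ⊙ₘ mulN x m 1) ⊙ₘ mulN x n 1
      ≤ (b ⊕ₘ (a ⊙ₘ mulN x m 1)) ⊙ₘ mulN x n 1 := by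
        refine odot_le_odot ?_ le_rfl
        rw [oplus_comm a]; exact oplus_odot_le _ _ _
    _ ≤ _ := by
        rw [oplus_comm b]
        exact oplus_odot_le _ _ _

/-- This congruence identifies `x` with `0`, and `isCongruence_mulN` identifies `x` with `1`.
Neither needs any hypothesis on `x`. -/
theorem isCongruence_addN (x : A) : IsCongruence
    {y : A × A | (∃ n, y.1 ≤ addN x n y.2) ∧ ∃ n, y.2 ≤ addN x n y.1} := by
  refine isCongruence_of_le (fun a b => ∃ n, a ≤ addN x n b) (fun a => ⟨0, le_rfl⟩) ?_ ?_ ?_ ?_ ?_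
  · rintro a b c ⟨m, hm⟩ ⟨n, hn⟩
    exact ⟨n + m, by rw [addN_add]; exact hm.trans (addN_mono x le_rfl hn)⟩
  · rintro a b c d ⟨m, hm⟩ ⟨n, hn⟩
    exact ⟨m + n, by rw [← addN_oplus]; exact oplus_le_oplus hm hn⟩
  · rintro a b c d ⟨m, hm⟩ ⟨n, hn⟩
    exact ⟨m + n, (odot_le_odot hm hn).trans (addN_odot_le x m n b d)⟩
  · rintro a b c d ⟨m, hm⟩ ⟨n, hn⟩
    exact ⟨m + n, sup_le (hm.trans (addN_mono x (by omega) le_sup_left))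
      (hn.trans (addN_mono x (by omega) le_sup_right))⟩
  · rintro a b c d ⟨m, hm⟩ ⟨n, hn⟩
    refine ⟨m + n, ?_⟩
    rw [addN_eq, hA.out.inf_oplus, ← addN_eq, ← addN_eq]
    exact inf_le_inf (hm.trans (addN_mono x (by omega) le_rfl))
      (hn.trans (addN_mono x (by omega) le_rfl))

theorem isCongruence_mulN (x : A) : IsCongruence
    {y : A × A | (∃ n, mulN x n y.1 ≤ y.2) ∧ ∃ n, mulN x n y.2 ≤ y.1} := by
  refine isCongruence_of_le (fun a b => ∃ n, mulN x n a ≤ b) (fun a => ⟨0, le_rfl⟩) ?_ ?_ ?_ ?_ ?_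
  · rintro a b c ⟨m, hm⟩ ⟨n, hn⟩
    exact ⟨m + n, by rw [mulN_add]; exact (mulN_mono x le_rfl hm).trans hn⟩
  · rintro a b c d ⟨m, hm⟩ ⟨n, hn⟩
    exact ⟨m + n, (le_mulN_oplus x m n a c).trans (oplus_le_oplus hm hn)⟩
  · rintro a b c d ⟨m, hm⟩ ⟨n, hn⟩
    exact ⟨m + n, by rw [← mulN_odot]; exact odot_le_odot hm hn⟩
  · rintro a b c d ⟨m, hm⟩ ⟨n, hn⟩
    refine ⟨m + n, ?_⟩
    rw [mulN_eq, hA.out.sup_odot, ← mulN_eq, ← mulN_eq]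
    exact sup_le_sup ((mulN_mono x (by omega) le_rfl).trans hm)
      ((mulN_mono x (by omega) le_rfl).trans hn)
  · rintro a b c d ⟨m, hm⟩ ⟨n, hn⟩
    exact ⟨m + n, le_inf ((mulN_mono x (by omega) inf_le_left).trans hm)
      ((mulN_mono x (by omega) inf_le_right).trans hn)⟩

end congruence

/-! ### Quotients and separation of points by pure algebras -/

section quotient

variable {A : Type u} [MVMSig A]

/-- The equivalence relation of a congruence. -/
def IsCongruence.setoid {R : Set (A × A)} (h : IsCongruence R) : Setoid A :=
  ⟨fun a b => (a, b) ∈ R, h.refl, h.symm, h.trans⟩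

/-- The quotient by a congruence. -/
def IsCongruence.quotient {R : Set (A × A)} (h : IsCongruence R) : MVMAlg.{u} where
  carrier := Quotient h.setoid
  sig :=
    { oplus := Quotient.map₂ (· ⊕ₘ ·) fun _ _ h₁ _ _ h₂ => h.oplus h₁ h₂
      odot := Quotient.map₂ (· ⊙ₘ ·) fun _ _ h₁ _ _ h₂ => h.odot h₁ h₂
      max := Quotient.map₂ (· ⊔ ·) fun _ _ h₁ _ _ h₂ => h.sup h₁ h₂
      min := Quotient.map₂ (· ⊓ ·) fun _ _ h₁ _ _ h₂ => h.inf h₁ h₂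
      zero := Quotient.mk _ 0
      one := Quotient.mk _ 1 }

theorem IsCongruence.isMVM_quotient {R : Set (A × A)} (h : IsCongruence R)
    (hA : IsMVMonoidalAlgebra A) : IsMVMonoidalAlgebra h.quotient.carrier where
  sup_comm := by rintro ⟨x⟩ ⟨y⟩; exact congrArg (Quotient.mk _) (hA.sup_comm x y)
  inf_comm := by rintro ⟨x⟩ ⟨y⟩; exact congrArg (Quotient.mk _) (hA.inf_comm x y)
  sup_assoc := by rintro ⟨x⟩ ⟨y⟩ ⟨z⟩; exact congrArg (Quotient.mk _) (hA.sup_assoc x y z)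
  inf_assoc := by rintro ⟨x⟩ ⟨y⟩ ⟨z⟩; exact congrArg (Quotient.mk _) (hA.inf_assoc x y z)
  sup_inf_self := by rintro ⟨x⟩ ⟨y⟩; exact congrArg (Quotient.mk _) (hA.sup_inf_self x y)
  inf_sup_self := by rintro ⟨x⟩ ⟨y⟩; exact congrArg (Quotient.mk _) (hA.inf_sup_self x y)
  sup_inf_left := by rintro ⟨x⟩ ⟨y⟩ ⟨z⟩; exact congrArg (Quotient.mk _) (hA.sup_inf_left x y z)
  oplus_assoc := by rintro ⟨x⟩ ⟨y⟩ ⟨z⟩; exact congrArg (Quotient.mk _) (hA.oplus_assoc x y z)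
  oplus_comm := by rintro ⟨x⟩ ⟨y⟩; exact congrArg (Quotient.mk _) (hA.oplus_comm x y)
  oplus_zero := by rintro ⟨x⟩; exact congrArg (Quotient.mk _) (hA.oplus_zero x)
  odot_assoc := by rintro ⟨x⟩ ⟨y⟩ ⟨z⟩; exact congrArg (Quotient.mk _) (hA.odot_assoc x y z)
  odot_comm := by rintro ⟨x⟩ ⟨y⟩; exact congrArg (Quotient.mk _) (hA.odot_comm x y)
  odot_one := by rintro ⟨x⟩; exact congrArg (Quotient.mk _) (hA.odot_one x)
  sup_oplus := by rintro ⟨x⟩ ⟨y⟩ ⟨z⟩; exact congrArg (Quotient.mk _) (hA.sup_oplus x y z)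
  inf_oplus := by rintro ⟨x⟩ ⟨y⟩ ⟨z⟩; exact congrArg (Quotient.mk _) (hA.inf_oplus x y z)
  sup_odot := by rintro ⟨x⟩ ⟨y⟩ ⟨z⟩; exact congrArg (Quotient.mk _) (hA.sup_odot x y z)
  inf_odot := by rintro ⟨x⟩ ⟨y⟩ ⟨z⟩; exact congrArg (Quotient.mk _) (hA.inf_odot x y z)
  ax4 := by rintro ⟨x⟩ ⟨y⟩ ⟨z⟩; exact congrArg (Quotient.mk _) (hA.ax4 x y z)
  ax5 := by rintro ⟨x⟩ ⟨y⟩ ⟨z⟩; exact congrArg (Quotient.mk _) (hA.ax5 x y z)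
  ax6 := by rintro ⟨x⟩ ⟨y⟩ ⟨z⟩; exact congrArg (Quotient.mk _) (hA.ax6 x y z)
  ax7 := by rintro ⟨x⟩ ⟨y⟩ ⟨z⟩; exact congrArg (Quotient.mk _) (hA.ax7 x y z)

/-- The projection to the quotient by a congruence. -/
def IsCongruence.proj {R : Set (A × A)} (h : IsCongruence R) :
    MVMAlg.Hom ⟨A⟩ h.quotient where
  toFun a := Quotient.mk h.setoid a
  map_oplus _ _ := rfl
  map_odot _ _ := rfl
  map_sup _ _ := rfl
  map_inf _ _ := rfl
  map_zero := rfl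
  map_one := rfl

theorem IsCongruence.comap {A B : MVMAlg.{u}} (f : MVMAlg.Hom A B)
    {S : Set (B.carrier × B.carrier)} (h : IsCongruence S) :
    IsCongruence {x : A.carrier × A.carrier | (f.toFun x.1, f.toFun x.2) ∈ S} where
  refl _ := h.refl _
  symm h₁ := h.symm h₁
  trans h₁ h₂ := h.trans h₁ h₂
  oplus h₁ h₂ := by
    have := h.oplus h₁ h₂
    rwa [← f.map_oplus, ← f.map_oplus] at this
  odot h₁ h₂ := by
    have := h.odot h₁ h₂
    rwa [← f.map_odot, ← f.map_odot] at this
  sup h₁ h₂ := by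
    have := h.sup h₁ h₂
    rwa [← f.map_sup, ← f.map_sup] at this
  inf h₁ h₂ := by
    have := h.inf h₁ h₂
    rwa [← f.map_inf, ← f.map_inf] at this

theorem isCongruence_diagonal : IsCongruence {x : A × A | x.1 = x.2} where
  refl _ := rfl
  symm h := Eq.symm h
  trans h h' := Eq.trans h h'
  oplus {a b c d} (h : a = b) (h' : c = d) := by subst h h'; rfl
  odot {a b c d} (h : a = b) (h' : c = d) := by subst h h'; rfl
  sup {a b c d} (h : a = b) (h' : c = d) := by subst h h'; rfl
  inf {a b c d} (h : a = b) (h' : c = d) := by subst h h'; rfl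

/-- Each closure condition involves at most two related pairs, and in a chain these lie in a common
member. -/
theorem isCongruence_sUnion {c : Set (Set (A × A))} (hc : ∀ R ∈ c, IsCongruence R)
    (hchain : IsChain (· ⊆ ·) c) (hne : c.Nonempty) : IsCongruence (⋃₀ c) := by
  have two : ∀ {x y : A × A}, x ∈ ⋃₀ c → y ∈ ⋃₀ c → ∃ R ∈ c, x ∈ R ∧ y ∈ R := by
    rintro x y ⟨R, hR, hx⟩ ⟨S, hS, hy⟩
    rcases hchain.total hR hS with h | h
    · exact ⟨S, hS, h hx, hy⟩
    · exact ⟨R, hR, hx, h hy⟩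
  refine ⟨fun a => ?_, ?_, ?_, ?_, ?_, ?_, ?_⟩
  · obtain ⟨R, hR⟩ := hne
    exact ⟨R, hR, (hc R hR).refl a⟩
  · rintro a b ⟨R, hR, h⟩
    exact ⟨R, hR, (hc R hR).symm h⟩
  all_goals
    intros
    rename_i h h'
    obtain ⟨R, hR, h₁, h₂⟩ := two h h'
  · exact ⟨R, hR, (hc R hR).trans h₁ h₂⟩
  · exact ⟨R, hR, (hc R hR).oplus h₁ h₂⟩
  · exact ⟨R, hR, (hc R hR).odot h₁ h₂⟩
  · exact ⟨R, hR, (hc R hR).sup h₁ h₂⟩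
  · exact ⟨R, hR, (hc R hR).inf h₁ h₂⟩

/-- Zorn's lemma, starting from the diagonal. Maximality makes the quotient subdirectly irreducible:
each of its congruences other than equality identifies the classes of `p` and `q`. -/
theorem exists_maximal_congruence {p q : A} (hpq : p ≠ q) :
    ∃ R : Set (A × A), IsCongruence R ∧ (p, q) ∉ R ∧
      ∀ S : Set (A × A), IsCongruence S → R ⊆ S → (p, q) ∉ S → S = R := by
  obtain ⟨R, -, hR⟩ := zorn_subset_nonempty {R : Set (A × A) | IsCongruence R ∧ (p, q) ∉ R}
    (fun c hc hchain hne => ⟨⋃₀ c, ⟨isCongruence_sUnion (fun R hR => (hc hR).1) hchain hne,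
      fun ⟨R, hR, h⟩ => (hc hR).2 h⟩, fun R hR => Set.subset_sUnion_of_mem hR⟩)
    {x : A × A | x.1 = x.2} ⟨isCongruence_diagonal, hpq⟩
  exact ⟨R, hR.prop.1, hR.prop.2, fun S hS hRS hpqS =>
    (hR.eq_of_subset ⟨hS, hpqS⟩ hRS).symm⟩

/-- Homomorphisms to pure algebras separate the points of an MV-monoidal algebra. -/
theorem exists_pure_hom (hA : IsMVMonoidalAlgebra A) {p q : A} (hpq : p ≠ q) :
    ∃ (B : MVMAlg.{u}) (f : MVMAlg.Hom ⟨A⟩ B), IsMVMonoidalAlgebra B.carrier ∧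
      IsPure B.carrier ∧ f.toFun p ≠ f.toFun q := by
  obtain ⟨R, hR, hpqR, hmax⟩ := exists_maximal_congruence hpq
  have hB := hR.isMVM_quotient hA
  have : Fact (IsMVMonoidalAlgebra hR.quotient.carrier) := ⟨hB⟩
  have hne : hR.proj.toFun p ≠ hR.proj.toFun q := fun h => hpqR (Quotient.exact h)
  -- A congruence of the quotient pulls back to one containing `R`. If it still separates `p` and
  -- `q`, maximality makes it equal to `R`.
  have key : ∀ S : Set (hR.quotient.carrier × hR.quotient.carrier), IsCongruence S →
      (hR.proj.toFun p, hR.proj.toFun q) ∉ S → ∀ x y, (x, y) ∈ S → x = y := by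
    rintro S hS hpqS ⟨x⟩ ⟨y⟩ hxy
    have h := hmax _ (hS.comap hR.proj) (fun z hz => by
      have h1 : hR.proj.toFun z.1 = hR.proj.toFun z.2 := Quotient.sound hz
      change (_, _) ∈ S
      rw [h1]
      exact hS.refl _) hpqS
    refine Quotient.sound (?_ : (x, y) ∈ R)
    rw [← h]
    exact hxy
  refine ⟨hR.quotient, hR.proj, hB, fun x y hxy => ?_, hne⟩
  -- If adding copies of `y` identifies the two classes, multiplying by powers of `x` cannot, since
  -- together both would make the classes equal. So one of the two congruences is equality: the
  -- second then gives `x = 1`, the first `y = 0`.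
  by_cases h₁ : (hR.proj.toFun p, hR.proj.toFun q) ∈ {z : hR.quotient.carrier × hR.quotient.carrier
      | (∃ n, z.1 ≤ addN y n z.2) ∧ ∃ n, z.2 ≤ addN y n z.1}
  · left
    refine key _ (isCongruence_mulN x) (fun h₂ => hne ?_) x 1
      ⟨⟨0, le_one _⟩, 1, odot_le_right _ _⟩
    obtain ⟨⟨m, hm⟩, n, hn⟩ := h₁
    obtain ⟨⟨m', hm'⟩, n', hn'⟩ := h₂
    exact le_antisymm (le_of_goodPair_iterate hxy hm hm') (le_of_goodPair_iterate hxy hn hn')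
  · right
    exact key _ (isCongruence_addN y) h₁ y 0 ⟨⟨1, le_oplus_right _ _⟩, 0, zero_le _⟩

/-- The transfer principle: an equation between two elements may be checked in pure algebras. -/
theorem ext_pure (hA : IsMVMonoidalAlgebra A) {p q : A}
    (h : ∀ (B : MVMAlg.{u}) (f : MVMAlg.Hom ⟨A⟩ B), IsMVMonoidalAlgebra B.carrier →
      IsPure B.carrier → f.toFun p = f.toFun q) : p = q := by
  by_contra hpq
  obtain ⟨B, f, hB, hpure, hne⟩ := exists_pure_hom hA hpq
  exact hne (h B f hB hpure)

end quotient

end MVMonoidal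

/-! ### Good sequences in pure algebras -/

namespace MVMonoidal

section sequences

variable {A : Type u} [MVMSig A]

/-- The sequence `…, 1, 1, x, y, z, 0, 0, …` with `x` at place `n`. -/
def triple (n : ℤ) (x y z : A) (k : ℤ) : A :=
  if k < n then 1 else if k = n then x else if k = n + 1 then y else if k = n + 2 then z else 0

/-- The sequence `…, 1, 1, x, 0, 0, …` with `x` at place `n`. -/
abbrev single (n : ℤ) (x : A) : ℤ → A := triple n x 0 0

theorem triple_of_lt {n k : ℤ} (x y z : A) (h : k < n) : triple n x y z k = 1 := if_pos h

theorem triple_self (n : ℤ) (x y z : A) : triple n x y z n = x := by simp [triple]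

theorem triple_add_one (n : ℤ) (x y z : A) : triple n x y z (n + 1) = y := by simp [triple]

theorem triple_add_two (n : ℤ) (x y z : A) : triple n x y z (n + 2) = z := by simp [triple]

theorem triple_of_gt {n k : ℤ} (x y z : A) (h : n + 2 < k) : triple n x y z k = 0 := by
  simp only [triple]
  rw [if_neg (by omega), if_neg (by omega), if_neg (by omega), if_neg (by omega)]

theorem single_of_lt {n k : ℤ} (x : A) (h : k < n) : single n x k = 1 := if_pos h

theorem single_self (n : ℤ) (x : A) : single n x n = x := triple_self n x 0 0

theorem single_of_gt {n k : ℤ} (x : A) (h : n < k) : single n x k = 0 := by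
  simp only [single, triple, ite_self]
  rw [if_neg (by omega), if_neg (by omega)]

theorem eq_triple {a : ℤ → A} {n : ℤ} {x y z : A} (h₁ : ∀ k < n, a k = 1) (hx : a n = x)
    (hy : a (n + 1) = y) (hz : a (n + 2) = z) (h₀ : ∀ k, n + 2 < k → a k = 0) :
    a = triple n x y z := by
  funext k
  rcases lt_or_ge k n with h | h
  · rw [triple_of_lt _ _ _ h, h₁ k h]
  rcases lt_or_ge (n + 2) k with h' | h'
  · rw [triple_of_gt _ _ _ h', h₀ k h']
  obtain rfl | rfl | rfl : k = n ∨ k = n + 1 ∨ k = n + 2 := by omega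
  · rw [triple_self, hx]
  · rw [triple_add_one, hy]
  · rw [triple_add_two, hz]

theorem stepSeq_eq_single (m : ℤ) : (stepSeq m : ℤ → A) = single m 0 := by
  funext k
  simp only [single, triple, stepSeq, ite_self]

theorem IsGoodSeq.one_of_le {a : ℤ → A} (hA : IsMVMonoidalAlgebra A) (ha : IsGoodSeq a) {k l : ℤ}
    (hk : a k = 1) (h : l ≤ k) : a l = 1 := by
  obtain ⟨d, rfl⟩ := Int.le.dest h
  clear h
  induction d with
  | zero => simpa using hk
  | succ d ih =>
    apply ih
    have := (ha.good (l + d)).1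
    rw [add_assoc, ← Nat.cast_succ, hk, hA.oplus_comm, hA.one_oplus] at this
    exact this.symm

theorem IsGoodSeq.zero_of_le {a : ℤ → A} (hA : IsMVMonoidalAlgebra A) (ha : IsGoodSeq a) {k l : ℤ}
    (hk : a k = 0) (h : k ≤ l) : a l = 0 := by
  obtain ⟨d, rfl⟩ := Int.le.dest h
  clear h
  induction d with
  | zero => simpa using hk
  | succ d ih =>
    have := (ha.good (k + d)).2
    rw [ih, hA.odot_comm, hA.odot_zero] at this
    rw [Nat.cast_succ, ← add_assoc]
    exact this.symm

theorem isGoodSeq_triple (hA : IsMVMonoidalAlgebra A) (n : ℤ) {x y : A} (h : IsGoodPair x y) :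
    IsGoodSeq (triple n x y 0) where
  eventually_one := ⟨n, fun k hk => triple_of_lt _ _ _ hk⟩
  eventually_zero := ⟨n + 3, fun k hk => triple_of_gt _ _ _ (by omega)⟩
  good k := by
    have : Fact (IsMVMonoidalAlgebra A) := ⟨hA⟩
    rcases lt_or_ge k n with hk | hk
    · rw [triple_of_lt _ _ _ hk]
      exact isGoodPair_one _
    rcases eq_or_lt_of_le hk with rfl | hk
    · rwa [triple_self, triple_add_one]
    · have : triple n x y 0 (k + 1) = 0 := by
        rcases eq_or_lt_of_le (Int.add_one_le_of_lt hk) with rfl | hk'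
        · rw [add_assoc]; exact triple_add_two _ _ _ _
        · exact triple_of_gt _ _ _ (by omega)
      rw [this]
      exact isGoodPair_zero _

theorem isGoodSeq_single (hA : IsMVMonoidalAlgebra A) (n : ℤ) (x : A) : IsGoodSeq (single n x) :=
  have : Fact (IsMVMonoidalAlgebra A) := ⟨hA⟩
  isGoodSeq_triple hA n (isGoodPair_zero x)

/-- Purity says that a term is `1` or its successor is `0`. Walking left from a zero, one meets
either a `1`, which makes the place in between the only free one, or another zero. -/
theorem exists_eq_single (hA : IsMVMonoidalAlgebra A) (hp : IsPure A) {a : ℤ → A}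
    (ha : IsGoodSeq a) : ∃ n x, a = single n x := by
  obtain ⟨p, hp'⟩ := ha.eventually_one
  obtain ⟨q, hq⟩ := ha.eventually_zero
  -- At `p - 1` the sequence is already `1`, so the base case of the induction arises only if `1 =
  -- 0`.
  have key : ∀ d : ℕ, a (p - 1 + d) = 0 → ∃ n x, a = single n x := by
    intro d
    induction d with
    | zero =>
      intro h
      refine ⟨p - 1, a (p - 1), eq_triple (fun k hk => hp' k (by omega)) rfl ?_ ?_ fun k hk => ?_⟩
      all_goals exact IsGoodSeq.zero_of_le hA ha h (by simp; try omega)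
    | succ d ih =>
      intro h
      rw [Nat.cast_succ, ← add_assoc] at h
      rcases hp _ _ (ha.good (p - 1 + d - 1)) with h1 | h0
      · exact ⟨p - 1 + d, a (p - 1 + d), eq_triple
          (fun k hk => IsGoodSeq.one_of_le hA ha h1 (by omega)) rfl h
          (IsGoodSeq.zero_of_le hA ha h (by omega))
          fun k hk => IsGoodSeq.zero_of_le hA ha h (by omega)⟩
      · rw [sub_add_cancel] at h0
        exact ih h0
  refine key (q - (p - 1)).toNat (hq _ ?_)
  omega

end sequences

/-! ### Sums of good sequences, computed in pure algebras -/

section addition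

variable {A : Type u} [MVMSig A] (hA : IsMVMonoidalAlgebra A)

include hA in
theorem seqAdd_eq_of_three {a b : ℤ → A} {i c : ℤ}
    (h : ∀ k, k < c ∨ c + 2 < k → a k ⊕ₘ b (i - k) = 1) :
    seqAdd hA a b i = (a c ⊕ₘ b (i - c)) ⊙ₘ (a (c + 1) ⊕ₘ b (i - (c + 1))) ⊙ₘ
      (a (c + 2) ⊕ₘ b (i - (c + 2))) := by
  let _ := odotMonoid hA
  have hs : Function.mulSupport (fun k => a k ⊕ₘ b (i - k)) ⊆
      (({c, c + 1, c + 2} : Finset ℤ) : Set ℤ) := by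
    intro k hk
    by_contra hc
    simp only [Finset.coe_insert, Finset.coe_singleton, Set.mem_insert_iff,
      Set.mem_singleton_iff] at hc
    exact hk (h k (by omega))
  refine (finprod_eq_prod_of_mulSupport_subset _ hs).trans ?_
  rw [Finset.prod_insert (by simp), Finset.prod_insert (by simp), Finset.prod_singleton,
    ← mul_assoc]
  rfl

theorem seqAdd_eq_zero {a b : ℤ → A} (ha : IsGoodSeq a) (hb : IsGoodSeq b) {i : ℤ} (c : ℤ)
    (hac : a c = 0) (hbc : b (i - c) = 0) : seqAdd hA a b i = 0 := by
  let _ := odotMonoid hA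
  have hf := seqAdd_hasFiniteMulSupport hA ha hb i
  -- The place `c` is inserted by hand: its factor `0 ⊕ 0` lies outside the support when `0 = 1`.
  refine (finprod_eq_prod_of_mulSupport_subset (s := insert c hf.toFinset) _ ?_).trans ?_
  · intro k hk
    exact Finset.mem_coe.2 (Finset.mem_insert_of_mem (hf.mem_toFinset.2 hk))
  · rw [← Finset.mul_prod_erase _ _ (Finset.mem_insert_self _ _), hac, hbc, hA.oplus_zero]
    exact (hA.odot_comm _ _).trans (hA.odot_zero _)

theorem seqAdd_eq_one {a b : ℤ → A} {i : ℤ} (h : ∀ k, a k ⊕ₘ b (i - k) = 1) :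
    seqAdd hA a b i = 1 := by
  rw [seqAdd_eq_of_three hA (c := 0) fun k _ => h k, h, h, h, hA.odot_one, hA.odot_one]

/-- Reindexing by `k ↦ i - k` exchanges the two summands. -/
theorem seqAdd_comm (a b : ℤ → A) : seqAdd hA a b = seqAdd hA b a := by
  funext i
  let _ := odotMonoid hA
  refine (finprod_comp_equiv (Equiv.subLeft i)).symm.trans (finprod_congr fun k => ?_)
  simp only [Equiv.subLeft_apply, sub_sub_cancel]
  exact hA.oplus_comm _ _

/-- At each of the three places, all factors of the product are `1` except those with `m ≤ k ≤ m +
2`. The last term is `x ⊙ y ⊙ z`, which the good pair `(x, y)` shortens to `y ⊙ z`. -/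
theorem seqAdd_triple_single (m n : ℤ) {x y : A} (z : A) (h : IsGoodPair x y) :
    seqAdd hA (triple m x y 0) (single n z) =
      triple (m + n) (x ⊕ₘ z) (x ⊙ₘ (y ⊕ₘ z)) (y ⊙ₘ z) := by
  have : Fact (IsMVMonoidalAlgebra A) := ⟨hA⟩
  have h₁ : ∀ i, i ≤ m + n + 2 → ∀ k, k < m ∨ m + 2 < k →
      triple m x y 0 k ⊕ₘ single n z (i - k) = 1 := by
    rintro i hi k (hk | hk)
    · rw [triple_of_lt _ _ _ hk, one_oplus]
    · rw [single_of_lt (n := n) (k := i - k) _ (by omega), oplus_one]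
  apply eq_triple
  · refine fun i hi => seqAdd_eq_one hA fun k => ?_
    rcases lt_or_ge k m with hk | hk
    · rw [triple_of_lt _ _ _ hk, one_oplus]
    · rw [single_of_lt (n := n) (k := i - k) _ (by omega), oplus_one]
  · rw [seqAdd_eq_of_three hA (h₁ _ (by omega)), triple_self,
      single_of_lt (k := m + n - (m + 1)) _ (by omega),
      single_of_lt (k := m + n - (m + 2)) _ (by omega), oplus_one, oplus_one, odot_one, odot_one,
      add_sub_cancel_left, single_self]
  · rw [seqAdd_eq_of_three hA (h₁ _ (by omega)), triple_self,
      single_of_gt (k := m + n + 1 - m) _ (by omega),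
      single_of_lt (k := m + n + 1 - (m + 2)) _ (by omega), oplus_one, odot_one, oplus_zero,
      triple_add_one, show m + n + 1 - (m + 1) = n by ring, single_self]
  · rw [seqAdd_eq_of_three hA (h₁ _ (by omega)), triple_self,
      single_of_gt (k := m + n + 2 - m) _ (by omega),
      single_of_gt (k := m + n + 2 - (m + 1)) _ (by omega), triple_add_one, triple_add_two,
      show m + n + 2 - (m + 2) = n by ring, single_self, oplus_zero, oplus_zero, zero_oplus, h.2]
  · intro i hi
    refine seqAdd_eq_zero hA (isGoodSeq_triple hA m h) (isGoodSeq_single hA n z) (m + 2) ?_ ?_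
    · exact triple_add_two _ _ _ _
    · exact single_of_gt _ (by omega)

theorem seqAdd_single_single (m n : ℤ) (x y : A) :
    seqAdd hA (single m x) (single n y) = triple (m + n) (x ⊕ₘ y) (x ⊙ₘ y) 0 := by
  have : Fact (IsMVMonoidalAlgebra A) := ⟨hA⟩
  rw [seqAdd_triple_single hA m n y (isGoodPair_zero x), zero_oplus, zero_odot]

theorem seqAdd_assoc_single (l m n : ℤ) (x y z : A) :
    seqAdd hA (seqAdd hA (single l x) (single m y)) (single n z) =
      triple (l + m + n) (x ⊕ₘ y ⊕ₘ z) (mid x y z) (x ⊙ₘ y ⊙ₘ z) := by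
  have : Fact (IsMVMonoidalAlgebra A) := ⟨hA⟩
  rw [seqAdd_single_single, seqAdd_triple_single hA _ _ _ (isGoodPair_oplus_odot x y)]
  rfl

theorem seqAdd_isGoodPair_of_pure (hp : IsPure A) {a b : ℤ → A} (ha : IsGoodSeq a)
    (hb : IsGoodSeq b) (i : ℤ) : IsGoodPair (seqAdd hA a b i) (seqAdd hA a b (i + 1)) := by
  have : Fact (IsMVMonoidalAlgebra A) := ⟨hA⟩
  obtain ⟨m, x, rfl⟩ := exists_eq_single hA hp ha
  obtain ⟨n, y, rfl⟩ := exists_eq_single hA hp hb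
  rw [seqAdd_single_single]
  exact (isGoodSeq_triple hA _ (isGoodPair_oplus_odot x y)).good i

/-- After commuting the outer sum, both bracketings have the shape of `seqAdd_assoc_single`. Their
outer terms agree by associativity and commutativity of `⊕` and `⊙`, their middle terms by
`mid_rotate`. -/
theorem seqAdd_assoc_of_pure (hp : IsPure A) {a b c : ℤ → A} (ha : IsGoodSeq a)
    (hb : IsGoodSeq b) (hc : IsGoodSeq c) :
    seqAdd hA (seqAdd hA a b) c = seqAdd hA a (seqAdd hA b c) := by
  have : Fact (IsMVMonoidalAlgebra A) := ⟨hA⟩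
  obtain ⟨l, x, rfl⟩ := exists_eq_single hA hp ha
  obtain ⟨m, y, rfl⟩ := exists_eq_single hA hp hb
  obtain ⟨n, z, rfl⟩ := exists_eq_single hA hp hc
  rw [seqAdd_assoc_single, seqAdd_comm hA (single l x), seqAdd_assoc_single, mid_rotate,
    oplus_assoc, oplus_comm x, odot_assoc, odot_comm x, add_assoc, add_comm l]

theorem seqAdd_stepSeq_of_pure (hp : IsPure A) {a : ℤ → A} (ha : IsGoodSeq a) (m i : ℤ) :
    seqAdd hA a (stepSeq m) i = a (i - m) := by
  have : Fact (IsMVMonoidalAlgebra A) := ⟨hA⟩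
  obtain ⟨n, x, rfl⟩ := exists_eq_single hA hp ha
  rw [stepSeq_eq_single, seqAdd_single_single, oplus_zero, odot_zero]
  simp only [single, triple, ite_self]
  congr 1
  · simp only [eq_iff_iff]; omega
  · congr 1
    simp only [eq_iff_iff]; omega

theorem single_le_of_lt [Fact (IsMVMonoidalAlgebra A)] {m n : ℤ} (x y : A) (h : m < n) (k : ℤ) :
    single m x k ≤ single n y k := by
  rcases lt_or_ge k n with hk | hk
  · rw [single_of_lt y hk]
    exact le_one _
  · rw [single_of_gt x (by omega)]
    exact zero_le _

/-- The hypothesis `hy` matters only for `n = m + 1`, where `y` and `x'` occupy the same place. -/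
theorem triple_le_of_lt [Fact (IsMVMonoidalAlgebra A)] {m n : ℤ} (x y x' y' : A) (h : m < n)
    (hy : y ≤ x') (k : ℤ) : triple m x y 0 k ≤ triple n x' y' 0 k := by
  rcases lt_trichotomy k n with hk | rfl | hk
  · rw [triple_of_lt (n := n) _ _ _ hk]
    exact le_one _
  · rw [triple_self]
    rcases eq_or_lt_of_le (Int.add_one_le_of_lt h) with rfl | h'
    · rwa [triple_add_one]
    · rcases eq_or_lt_of_le (Int.add_one_le_of_lt h') with rfl | h''
      · rw [add_assoc]
        exact (triple_add_two m x y 0).trans_le (zero_le _)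
      · rw [triple_of_gt _ _ _ (by omega)]
        exact zero_le _
  · have : triple m x y 0 k = 0 := by
      rcases eq_or_lt_of_le (show m + 2 ≤ k by omega) with rfl | h'
      · exact triple_add_two _ _ _ _
      · exact triple_of_gt _ _ _ h'
    rw [this]
    exact zero_le _

theorem sup_triple [Fact (IsMVMonoidalAlgebra A)] (n : ℤ) (x y x' y' : A) (k : ℤ) :
    triple n x y 0 k ⊔ triple n x' y' 0 k = triple n (x ⊔ x') (y ⊔ y') 0 k := by
  simp only [triple]
  split_ifs <;> first | rfl | exact sup_idem _

theorem inf_triple [Fact (IsMVMonoidalAlgebra A)] (n : ℤ) (x y x' y' : A) (k : ℤ) :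
    triple n x y 0 k ⊓ triple n x' y' 0 k = triple n (x ⊓ x') (y ⊓ y') 0 k := by
  simp only [triple]
  split_ifs <;> first | rfl | exact inf_idem _

include hA in
-- Sequences with different free places are comparable, so join and meet merely select one of them.
-- With a common free place they act on that one term.
theorem isGoodSeq_lattice_of_pure (hp : IsPure A) {a b : ℤ → A} (ha : IsGoodSeq a)
    (hb : IsGoodSeq b) : IsGoodSeq (fun i => a i ⊔ b i) ∧ IsGoodSeq (fun i => a i ⊓ b i) := by
  have : Fact (IsMVMonoidalAlgebra A) := ⟨hA⟩
  obtain ⟨m, x, rfl⟩ := exists_eq_single hA hp ha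
  obtain ⟨n, y, rfl⟩ := exists_eq_single hA hp hb
  rcases lt_trichotomy m n with h | rfl | h
  · simpa only [sup_eq_right.2 (single_le_of_lt x y h _), inf_eq_left.2 (single_le_of_lt x y h _)]
      using ⟨hb, ha⟩
  · simp only [sup_triple, inf_triple, sup_idem, inf_idem]
    exact ⟨isGoodSeq_single hA _ _, isGoodSeq_single hA _ _⟩
  · simpa only [sup_eq_left.2 (single_le_of_lt y x h _), inf_eq_right.2 (single_le_of_lt y x h _)]
      using ⟨ha, hb⟩

theorem seqAdd_single_le_of_lt [Fact (IsMVMonoidalAlgebra A)] {m n : ℤ} (x y : A) (h : m < n)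
    (l : ℤ) (z : A) (k : ℤ) :
    seqAdd hA (single m x) (single l z) k ≤ seqAdd hA (single n y) (single l z) k := by
  rw [seqAdd_single_single, seqAdd_single_single]
  exact triple_le_of_lt _ _ _ _ (by omega) ((odot_le_right _ _).trans (le_oplus_right _ _)) k

/-- The same case split: for different places addition preserves the comparison, and for a common
place the claim is the distributivity of `⊕` and `⊙` over the lattice operations. -/
theorem lattice_seqAdd_of_pure (hp : IsPure A) {a b c : ℤ → A} (ha : IsGoodSeq a)
    (hb : IsGoodSeq b) (hc : IsGoodSeq c) (i : ℤ) :
    seqAdd hA (fun k => a k ⊔ b k) c i = seqAdd hA a c i ⊔ seqAdd hA b c i ∧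
    seqAdd hA (fun k => a k ⊓ b k) c i = seqAdd hA a c i ⊓ seqAdd hA b c i := by
  have : Fact (IsMVMonoidalAlgebra A) := ⟨hA⟩
  obtain ⟨m, x, rfl⟩ := exists_eq_single hA hp ha
  obtain ⟨n, y, rfl⟩ := exists_eq_single hA hp hb
  obtain ⟨l, z, rfl⟩ := exists_eq_single hA hp hc
  rcases lt_trichotomy m n with h | rfl | h
  · simp only [sup_eq_right.2 (single_le_of_lt x y h _), inf_eq_left.2 (single_le_of_lt x y h _),
      sup_eq_right.2 (seqAdd_single_le_of_lt hA x y h l z _),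
      inf_eq_left.2 (seqAdd_single_le_of_lt hA x y h l z _), and_self]
  · have h₁ : (fun k => single m x k ⊔ single m y k) = single m (x ⊔ y) :=
      funext fun k => by rw [sup_triple, sup_idem]
    have h₂ : (fun k => single m x k ⊓ single m y k) = single m (x ⊓ y) :=
      funext fun k => by rw [inf_triple, inf_idem]
    rw [h₁, h₂]
    simp only [seqAdd_single_single, sup_triple, inf_triple, hA.sup_oplus, hA.inf_oplus,
      hA.sup_odot, hA.inf_odot, and_self]
  · simp only [sup_eq_left.2 (single_le_of_lt y x h _), inf_eq_right.2 (single_le_of_lt y x h _),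
      sup_eq_left.2 (seqAdd_single_le_of_lt hA y x h l z _),
      inf_eq_right.2 (seqAdd_single_le_of_lt hA y x h l z _), and_self]

end addition

/-! ### Good sequences in arbitrary MV-monoidal algebras -/

section transfer

variable {A : Type u} [MVMSig A] (hA : IsMVMonoidalAlgebra A)

include hA in
-- Being a good pair is a conjunction of two equations, so the transfer principle applies.
theorem isGoodPair_of_pure {p q : A}
    (h : ∀ (B : MVMAlg.{u}) (f : MVMAlg.Hom ⟨A⟩ B), IsMVMonoidalAlgebra B.carrier →
      IsPure B.carrier → IsGoodPair (f.toFun p) (f.toFun q)) : IsGoodPair p q :=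
  ⟨ext_pure hA fun B f hB hp => (f.map_oplus p q).trans (h B f hB hp).1,
    ext_pure hA fun B f hB hp => (f.map_odot p q).trans (h B f hB hp).2⟩

theorem goodSeqClosed : GoodSeqClosed A hA := by
  have : Fact (IsMVMonoidalAlgebra A) := ⟨hA⟩
  intro a b ha hb
  obtain ⟨p, hp⟩ := ha.eventually_one
  obtain ⟨q, hq⟩ := hb.eventually_one
  obtain ⟨p', hp'⟩ := ha.eventually_zero
  obtain ⟨q', hq'⟩ := hb.eventually_zero
  refine ⟨⟨⟨p + q - 1, fun i hi => seqAdd_eq_one hA fun k => ?_⟩, ⟨p' + q', fun i hi => ?_⟩,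
    fun i => isGoodPair_of_pure hA fun B f hB hpure => ?_⟩, ?_, ?_⟩
  · rcases lt_or_ge k p with hk | hk
    · rw [hp k hk, one_oplus]
    · rw [hq _ (by omega), oplus_one]
  · exact seqAdd_eq_zero hA ha hb p' (hp' _ le_rfl) (hq' _ (by omega))
  · have h₁ := map_seqAdd (B := B) f hA hB ha hb
    have h₂ := seqAdd_isGoodPair_of_pure hB hpure (ha.map (B := B) f) (hb.map (B := B) f) i
    rwa [← h₁, ← h₁] at h₂
  · refine ⟨⟨min p q, fun i hi => ?_⟩, ⟨max p' q', fun i hi => ?_⟩,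
      fun i => isGoodPair_of_pure hA fun B f hB hpure => ?_⟩
    · rw [hp _ (by omega), hq _ (by omega), sup_idem]
    · rw [hp' _ (by omega), hq' _ (by omega), sup_idem]
    · have h₂ := (isGoodSeq_lattice_of_pure hB hpure (ha.map (B := B) f)
        (hb.map (B := B) f)).1.good i
      exact (f.map_sup _ _).symm ▸ (f.map_sup _ _).symm ▸ h₂
  · refine ⟨⟨min p q, fun i hi => ?_⟩, ⟨max p' q', fun i hi => ?_⟩,
      fun i => isGoodPair_of_pure hA fun B f hB hpure => ?_⟩
    · rw [hp _ (by omega), hq _ (by omega), inf_idem]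
    · rw [hp' _ (by omega), hq' _ (by omega), inf_idem]
    · have h₂ := (isGoodSeq_lattice_of_pure hB hpure (ha.map (B := B) f)
        (hb.map (B := B) f)).2.good i
      exact (f.map_inf _ _).symm ▸ (f.map_inf _ _).symm ▸ h₂

/-- Adding an integer translates the sequence. This gives the neutral element, the inverse of `1`
and the multiples of the constants. -/
theorem seqAdd_stepSeq {a : ℤ → A} (ha : IsGoodSeq a) (m i : ℤ) :
    seqAdd hA a (stepSeq m) i = a (i - m) :=
  ext_pure hA fun B f hB hp => by
    rw [map_seqAdd (B := B) f hA hB ha (isGoodSeq_stepSeq hA m)]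
    rw [funext fun k => map_stepSeq (B := B) f m k]
    exact seqAdd_stepSeq_of_pure hB hp (ha.map (B := B) f) m i

theorem seqAdd_assoc {a b c : ℤ → A} (ha : IsGoodSeq a) (hb : IsGoodSeq b) (hc : IsGoodSeq c) :
    seqAdd hA (seqAdd hA a b) c = seqAdd hA a (seqAdd hA b c) :=
  funext fun i => ext_pure hA fun B f hB hp => by
    rw [map_seqAdd (B := B) f hA hB (goodSeqClosed hA a b ha hb).1 hc,
      map_seqAdd (B := B) f hA hB ha (goodSeqClosed hA b c hb hc).1,
      funext fun k => map_seqAdd (B := B) f hA hB ha hb k,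
      funext fun k => map_seqAdd (B := B) f hA hB hb hc k]
    exact congrFun (seqAdd_assoc_of_pure hB hp (ha.map (B := B) f) (hb.map (B := B) f)
      (hc.map (B := B) f)) i

theorem sup_seqAdd {a b c : ℤ → A} (ha : IsGoodSeq a) (hb : IsGoodSeq b) (hc : IsGoodSeq c)
    (i : ℤ) : seqAdd hA (fun k => a k ⊔ b k) c i = seqAdd hA a c i ⊔ seqAdd hA b c i :=
  ext_pure hA fun B f hB hp => by
    rw [map_seqAdd (B := B) f hA hB (goodSeqClosed hA a b ha hb).2.1 hc, f.map_sup,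
      map_seqAdd (B := B) f hA hB ha hc, map_seqAdd (B := B) f hA hB hb hc,
      funext fun k => f.map_sup (a k) (b k)]
    exact (lattice_seqAdd_of_pure hB hp (ha.map (B := B) f) (hb.map (B := B) f)
      (hc.map (B := B) f) i).1

theorem inf_seqAdd {a b c : ℤ → A} (ha : IsGoodSeq a) (hb : IsGoodSeq b) (hc : IsGoodSeq c)
    (i : ℤ) : seqAdd hA (fun k => a k ⊓ b k) c i = seqAdd hA a c i ⊓ seqAdd hA b c i :=
  ext_pure hA fun B f hB hp => by
    rw [map_seqAdd (B := B) f hA hB (goodSeqClosed hA a b ha hb).2.2 hc, f.map_inf,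
      map_seqAdd (B := B) f hA hB ha hc, map_seqAdd (B := B) f hA hB hb hc,
      funext fun k => f.map_inf (a k) (b k)]
    exact (lattice_seqAdd_of_pure hB hp (ha.map (B := B) f) (hb.map (B := B) f)
      (hc.map (B := B) f) i).2

theorem stepSeq_sup_of_le [Fact (IsMVMonoidalAlgebra A)] {m n : ℤ} (h : m ≤ n) (k : ℤ) :
    (stepSeq m k : A) ⊔ stepSeq n k = stepSeq n k := by
  unfold stepSeq
  split_ifs with h₁ h₂ h₂
  · exact sup_idem _
  · omega
  · exact sup_eq_right.2 (zero_le _)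
  · exact sup_idem _

theorem natMul_goodSeq (hc : GoodSeqClosed A hA) (m : ℤ) (n : ℕ) {s : GoodSeq A}
    (hs : s.1 = stepSeq m) :
    letI := goodSeqSig hA hc
    (natMul n s).1 = stepSeq (n * m) := by
  let _ := goodSeqSig hA hc
  induction n with
  | zero => simp only [Nat.cast_zero, zero_mul]; rfl
  | succ n ih =>
    funext i
    change seqAdd hA (natMul n s).1 s.1 i = _
    rw [ih, hs, seqAdd_stepSeq hA (isGoodSeq_stepSeq hA _)]
    unfold stepSeq
    push_cast
    rw [add_mul, one_mul]
    congr 1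
    simp only [eq_iff_iff]; omega

theorem isULM_goodSeq (hc : GoodSeqClosed A hA) :
    @IsUnitalCommDistribLMonoid (GoodSeq A) (goodSeqSig hA hc) := by
  have hF : Fact (IsMVMonoidalAlgebra A) := ⟨hA⟩
  let _ := goodSeqSig hA hc
  have hle : ∀ {a : GoodSeq A} {b : GoodSeq A}, (∀ k, a.1 k ⊔ b.1 k = b.1 k) → LatLE a b :=
    fun h => Subtype.ext (funext h)
  exact
  { sup_comm := fun x y => Subtype.ext <| funext fun k => sup_comm (x.1 k) (y.1 k)
    inf_comm := fun x y => Subtype.ext <| funext fun k => inf_comm (x.1 k) (y.1 k)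
    sup_assoc := fun x y z => Subtype.ext <| funext fun k => sup_assoc (x.1 k) (y.1 k) (z.1 k)
    inf_assoc := fun x y z => Subtype.ext <| funext fun k => inf_assoc (x.1 k) (y.1 k) (z.1 k)
    sup_inf_self := fun x y => Subtype.ext <| funext fun k => sup_inf_self (a := x.1 k) (b := y.1 k)
    inf_sup_self := fun x y => Subtype.ext <| funext fun k => inf_sup_self (a := x.1 k) (b := y.1 k)
    sup_inf_left := fun x y z => Subtype.ext <| funext fun k =>
      sup_inf_left (x.1 k) (y.1 k) (z.1 k)
    add_assoc := fun x y z => Subtype.ext (seqAdd_assoc hA x.2 y.2 z.2)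
    add_comm := fun x y => Subtype.ext (seqAdd_comm hA x.1 y.1)
    add_zero := fun x => Subtype.ext <| funext fun k =>
      (seqAdd_stepSeq hA x.2 0 k).trans (by rw [sub_zero])
    sup_add := fun x y z => Subtype.ext <| funext fun k => sup_seqAdd hA x.2 y.2 z.2 k
    inf_add := fun x y z => Subtype.ext <| funext fun k => inf_seqAdd hA x.2 y.2 z.2 k
    negUnit_add_one := Subtype.ext <| funext fun k =>
      (seqAdd_stepSeq hA (isGoodSeq_stepSeq hA (-1)) 1 k).trans (by
        change (stepSeq (-1) (k - 1) : A) = stepSeq 0 k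
        unfold stepSeq
        congr 1
        simp only [eq_iff_iff]; omega)
    negUnit_le_zero := hle fun k => stepSeq_sup_of_le (by omega) k
    zero_le_one := hle fun k => stepSeq_sup_of_le (by omega) k
    bounded := fun x => by
      obtain ⟨p, hp⟩ := x.2.eventually_one
      obtain ⟨q, hq⟩ := x.2.eventually_zero
      -- The bound dominates both `-p` and `q`; the summand `1` keeps it positive.
      refine ⟨p.natAbs + q.natAbs + 1, by omega, hle fun k => ?_, hle fun k => ?_⟩
      · rw [natMul_goodSeq hA hc (-1) _ rfl]
        unfold stepSeq
        split_ifs with h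
        · rw [hp k (by omega)]
          exact sup_idem _
        · exact sup_eq_right.2 (zero_le _)
      · rw [natMul_goodSeq hA hc 1 _ rfl]
        unfold stepSeq
        split_ifs with h
        · exact sup_eq_right.2 (le_one _)
        · rw [hq k (by omega)]
          exact sup_idem _ }

end transfer

end MVMonoidal

/-! ### Elementary theory of unital commutative distributive `ℓ`-monoids -/

section instances

variable {M : Type u} [ULMSig M] [h : Fact (IsUnitalCommDistribLMonoid M)]

instance IsUnitalCommDistribLMonoid.instDistribLattice : DistribLattice M :=
  let _ := h.out.toLattice
  { h.out.toLattice with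
    le_sup_inf := fun x y z => le_of_eq (h.out.sup_inf_left x y z).symm }

instance IsUnitalCommDistribLMonoid.instAddCommMonoid : AddCommMonoid M where
  add_assoc := h.out.add_assoc
  add_comm := h.out.add_comm
  zero_add := h.out.zero_add
  add_zero := h.out.add_zero
  nsmul := natMul
  nsmul_zero _ := rfl
  nsmul_succ _ _ := rfl

instance IsUnitalCommDistribLMonoid.instIsOrderedAddMonoid : IsOrderedAddMonoid M where
  add_le_add_left _ _ hab _ := h.out.add_le_add hab (h.out.le_refl _)

end instances

namespace ULMonoid

open ULMSig (negUnit)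

section basic

variable {M : Type u} [ULMSig M] [hM : Fact (IsUnitalCommDistribLMonoid M)]

theorem neg_add_one : (negUnit : M) + 1 = 0 := hM.out.negUnit_add_one

theorem one_add_neg : (1 : M) + negUnit = 0 := by rw [add_comm, neg_add_one]

theorem zero_le_one : (0 : M) ≤ 1 := hM.out.zero_le_one

theorem neg_le_zero : (negUnit : M) ≤ 0 := hM.out.negUnit_le_zero

theorem sup_add (x y z : M) : (x ⊔ y) + z = (x + z) ⊔ (y + z) := hM.out.sup_add x y z

theorem inf_add (x y z : M) : (x ⊓ y) + z = (x + z) ⊓ (y + z) := hM.out.inf_add x y z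

theorem add_sup (x y z : M) : z + (x ⊔ y) = (z + x) ⊔ (z + y) := by
  rw [add_comm, sup_add, add_comm x, add_comm y]

theorem add_inf (x y z : M) : z + (x ⊓ y) = (z + x) ⊓ (z + y) := by
  rw [add_comm, inf_add, add_comm x, add_comm y]

/-- Both inequalities come from distributing one factor and using monotonicity; no cancellation is
needed. -/
theorem inf_add_sup (x y : M) : (x ⊓ y) + (x ⊔ y) = x + y := by
  apply le_antisymm
  · rw [add_sup]
    refine sup_le ?_ (add_le_add inf_le_left le_rfl)
    rw [add_comm x]
    exact add_le_add inf_le_right le_rfl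
  · rw [inf_add]
    refine le_inf (add_le_add le_rfl le_sup_right) ?_
    rw [add_comm x]
    exact add_le_add le_rfl le_sup_left

theorem add_one_add_neg (x : M) : x + 1 + negUnit = x := by
  rw [add_assoc, one_add_neg, add_zero]

theorem add_neg_add_one (x : M) : x + negUnit + 1 = x := by
  rw [add_assoc, neg_add_one, add_zero]

theorem add_neg_sup_zero (x : M) : (x + negUnit) ⊔ 0 = (x ⊔ 1) + negUnit := by
  rw [sup_add, one_add_neg]

/-- The instance of `inf_add_sup` at `1`, where the unit `1` can be cancelled. It splits an element
into its part below `1` and the excess. -/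
theorem inf_one_add (x : M) : (x ⊓ 1) + ((x + negUnit) ⊔ 0) = x := by
  rw [add_neg_sup_zero, ← add_assoc, inf_add_sup, add_one_add_neg]

theorem inf_zero_add (x : M) : (x ⊔ 0) + (x ⊓ 0) = x := by
  rw [add_comm, inf_add_sup, add_zero]

/-- The truncation of an element to the unit interval. -/
def clamp (x : M) : M := (x ⊔ 0) ⊓ 1

theorem clamp_eq (x : M) : clamp x = (x ⊓ 1) ⊔ 0 := by
  rw [clamp, sup_inf_right, sup_eq_left.2 (zero_le_one (M := M))]

theorem clamp_nonneg (x : M) : 0 ≤ clamp x := le_inf le_sup_right zero_le_one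

theorem clamp_le_one (x : M) : clamp x ≤ 1 := inf_le_right

theorem clamp_mono {x y : M} (h : x ≤ y) : clamp x ≤ clamp y :=
  inf_le_inf_right _ (sup_le_sup_right h _)

theorem clamp_of_le_zero {x : M} (h : x ≤ 0) : clamp x = 0 := by
  rw [clamp, sup_eq_right.2 h, inf_eq_left.2 zero_le_one]

theorem clamp_of_one_le {x : M} (h : 1 ≤ x) : clamp x = 1 := by
  rw [clamp, sup_eq_left.2 (zero_le_one.trans h), inf_eq_right.2 h]

theorem clamp_of_mem {x : M} (h₀ : 0 ≤ x) (h₁ : x ≤ 1) : clamp x = x := by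
  rw [clamp, sup_eq_left.2 h₀, inf_eq_left.2 h₁]

theorem clamp_sup (x y : M) : clamp (x ⊔ y) = clamp x ⊔ clamp y := by
  rw [clamp, clamp, clamp, ← inf_sup_right, sup_sup_sup_comm, sup_idem]

theorem clamp_inf (x y : M) : clamp (x ⊓ y) = clamp x ⊓ clamp y := by
  rw [clamp, clamp, clamp, sup_inf_right, inf_inf_inf_comm, inf_idem]

theorem clamp_sup_of_le_zero (x : M) {y : M} (h : y ≤ 0) : clamp (x ⊔ y) = clamp x := by
  rw [clamp_sup, clamp_of_le_zero h, sup_eq_left.2 (clamp_nonneg x)]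

theorem clamp_inf_of_one_le (x : M) {y : M} (h : 1 ≤ y) : clamp (x ⊓ y) = clamp x := by
  rw [clamp_inf, clamp_of_one_le h, inf_eq_left.2 (clamp_le_one x)]

/-- The peeling identity behind the inductions below: removing the truncation leaves an excess whose
upper bound is smaller by `1`. -/
theorem clamp_add (x : M) : clamp x + ((x + negUnit) ⊔ 0) = x ⊔ 0 := by
  have h := inf_one_add (x ⊔ 0)
  rwa [sup_add, zero_add, sup_assoc, sup_eq_right.2 (neg_le_zero (M := M))] at h

theorem clamp_add_add (x : M) : clamp x + ((x + negUnit) ⊔ 0) + (x ⊓ 0) = x := by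
  rw [clamp_add, inf_zero_add]

theorem clamp_add_inf (x : M) : clamp x + (x ⊓ 0) = x ⊓ 1 := by
  have h := inf_zero_add (x ⊓ 1)
  rwa [← clamp_eq, inf_assoc, inf_eq_right.2 (zero_le_one (M := M))] at h

/-- For `s = x + y` the terms `s ⊓ 1` and `(s + negUnit) ⊔ 0` are `x ⊕ y` and `x ⊙ y`. With
`oplus_odot` this shows that both sides of `ax4` and of `ax5` are the truncation of `x + y + z - 1`.
-/
theorem odot_oplus (s : M) {z : M} (hz : z ≤ 1) :
    (s ⊓ 1 + ((s + negUnit) ⊔ 0 + z) ⊓ 1 + negUnit) ⊔ 0 = clamp (s + z + negUnit) := by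
  rw [add_inf, inf_add, ← add_assoc, inf_one_add, add_one_add_neg, ← inf_assoc, clamp_eq]
  congr 2
  refine inf_eq_left.2 ?_
  calc s + z + negUnit ≤ s + 1 + negUnit := add_le_add (add_le_add le_rfl hz) le_rfl
    _ = s := add_one_add_neg s

theorem oplus_odot (s : M) {z : M} (hz : 0 ≤ z) :
    ((s + negUnit) ⊔ 0 + (s ⊓ 1 + z + negUnit) ⊔ 0) ⊓ 1 = clamp (s + z + negUnit) := by
  have h : (s + negUnit) ⊔ 0 + (s ⊓ 1 + z + negUnit) = s + z + negUnit := by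
    rw [← add_assoc, ← add_assoc, add_comm ((s + negUnit) ⊔ 0), inf_one_add]
  rw [add_sup, h, add_zero, ← sup_assoc, clamp]
  congr 2
  refine sup_eq_left.2 ?_
  calc s + negUnit = s + 0 + negUnit := by rw [add_zero]
    _ ≤ s + z + negUnit := add_le_add (add_le_add le_rfl hz) le_rfl

end basic

/-! ### The unit interval is an MV-monoidal algebra -/

section unit_interval

variable {M : Type u} [ULMSig M]

theorem isMVM_unitInterval (h : IsUnitalCommDistribLMonoid M) :
    @IsMVMonoidalAlgebra (UnitSegment M) (unitIntervalSig h) := by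
  have : Fact (IsUnitalCommDistribLMonoid M) := ⟨h⟩
  let _ := unitIntervalSig h
  exact
  { sup_comm := fun x y => Subtype.ext (sup_comm x.1 y.1)
    inf_comm := fun x y => Subtype.ext (inf_comm x.1 y.1)
    sup_assoc := fun x y z => Subtype.ext (sup_assoc x.1 y.1 z.1)
    inf_assoc := fun x y z => Subtype.ext (inf_assoc x.1 y.1 z.1)
    sup_inf_self := fun x y => Subtype.ext (sup_inf_self (a := x.1) (b := y.1))
    inf_sup_self := fun x y => Subtype.ext (inf_sup_self (a := x.1) (b := y.1))
    sup_inf_left := fun x y z => Subtype.ext (sup_inf_left x.1 y.1 z.1)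
    oplus_assoc := fun x y z => Subtype.ext <| by
      have key : ∀ s z : M, 0 ≤ z → (s ⊓ 1 + z) ⊓ 1 = (s + z) ⊓ 1 := fun s z hz => by
        rw [inf_add, inf_assoc, inf_eq_right.2 (le_add_of_nonneg_right hz)]
      change ((x.1 + y.1) ⊓ 1 + z.1) ⊓ 1 = (x.1 + (y.1 + z.1) ⊓ 1) ⊓ 1
      rw [key _ _ z.2.1, add_comm x.1 (_ ⊓ _), key _ _ x.2.1, add_assoc, add_comm x.1]
    oplus_comm := fun x y => Subtype.ext (congrArg (· ⊓ 1) (add_comm x.1 y.1))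
    oplus_zero := fun x => Subtype.ext <| by
      change (x.1 + 0) ⊓ 1 = x.1
      rw [add_zero]
      exact inf_eq_left.2 x.2.2
    odot_assoc := fun x y z => Subtype.ext <| by
      have key : ∀ s z : M, z ≤ 1 →
          ((s + negUnit) ⊔ 0 + z + negUnit) ⊔ 0 = (s + z + (negUnit + negUnit)) ⊔ 0 := by
        intro s z hz
        have hz' : z + negUnit ≤ 0 := (add_le_add hz le_rfl).trans_eq one_add_neg
        rw [sup_add, sup_add, sup_assoc, zero_add, sup_eq_right.2 hz', add_right_comm s, add_assoc]
      change ((x.1 + y.1 + negUnit) ⊔ 0 + z.1 + negUnit) ⊔ 0 =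
        (x.1 + ((y.1 + z.1 + negUnit) ⊔ 0) + negUnit) ⊔ 0
      rw [key _ _ z.2.2, add_comm x.1 (_ ⊔ _), key _ _ x.2.2, add_comm (y.1 + z.1), add_assoc x.1]
    odot_comm := fun x y => Subtype.ext (congrArg (fun t => (t + negUnit) ⊔ 0)
      (add_comm x.1 y.1))
    odot_one := fun x => Subtype.ext <| by
      change (x.1 + 1 + negUnit) ⊔ 0 = x.1
      rw [add_one_add_neg]
      exact sup_eq_left.2 x.2.1
    sup_oplus := fun x y z => Subtype.ext <| by
      change ((x.1 ⊔ y.1) + z.1) ⊓ 1 = (x.1 + z.1) ⊓ 1 ⊔ (y.1 + z.1) ⊓ 1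
      rw [sup_add, inf_sup_right]
    inf_oplus := fun x y z => Subtype.ext <| by
      change ((x.1 ⊓ y.1) + z.1) ⊓ 1 = (x.1 + z.1) ⊓ 1 ⊓ ((y.1 + z.1) ⊓ 1)
      rw [inf_add, inf_inf_inf_comm, inf_idem]
    sup_odot := fun x y z => Subtype.ext <| by
      change ((x.1 ⊔ y.1) + z.1 + negUnit) ⊔ 0 =
        (x.1 + z.1 + negUnit) ⊔ 0 ⊔ ((y.1 + z.1 + negUnit) ⊔ 0)
      rw [sup_add, sup_add, sup_sup_sup_comm, sup_idem]
    inf_odot := fun x y z => Subtype.ext <| by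
      change ((x.1 ⊓ y.1) + z.1 + negUnit) ⊔ 0 =
        ((x.1 + z.1 + negUnit) ⊔ 0) ⊓ ((y.1 + z.1 + negUnit) ⊔ 0)
      rw [inf_add, inf_add, sup_inf_right]
    ax4 := fun x y z => Subtype.ext <| by
      refine (odot_oplus (x.1 + y.1) z.2.2).trans ?_
      refine Eq.trans ?_ ((oplus_odot (y.1 + z.1) x.2.1).symm.trans ?_)
      · rw [add_assoc x.1, add_comm x.1]
      · rw [add_comm ((y.1 + z.1) ⊓ 1), add_comm ((_ : M) ⊔ 0)]
        rfl
    ax5 := fun x y z => Subtype.ext <| by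
      refine (oplus_odot (x.1 + y.1) z.2.1).trans ?_
      refine Eq.trans ?_ ((odot_oplus (y.1 + z.1) x.2.2).symm.trans ?_)
      · rw [add_assoc x.1, add_comm x.1]
      · rw [add_comm ((y.1 + z.1) ⊓ 1), add_comm ((_ : M) ⊔ 0)]
        rfl
    ax6 := fun x y z => Subtype.ext <| by
      refine Eq.trans ?_ (congrArg (· ⊔ z.1) (odot_oplus (x.1 + y.1) z.2.2).symm)
      change ((x.1 + y.1 + negUnit) ⊔ 0 + z.1) ⊓ 1 = clamp (x.1 + y.1 + z.1 + negUnit) ⊔ z.1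
      rw [clamp_eq, sup_assoc, sup_eq_right.2 (show 0 ≤ z.1 from z.2.1), sup_add, zero_add,
        inf_sup_right,
        inf_eq_left.2 (show z.1 ≤ 1 from z.2.2), add_right_comm]
    ax7 := fun x y z => Subtype.ext <| by
      refine Eq.trans ?_ (congrArg (· ⊓ z.1) (oplus_odot (x.1 + y.1) z.2.1).symm)
      change ((x.1 + y.1) ⊓ 1 + z.1 + negUnit) ⊔ 0 = clamp (x.1 + y.1 + z.1 + negUnit) ⊓ z.1
      rw [clamp, inf_assoc, inf_eq_right.2 (show z.1 ≤ 1 from z.2.2), inf_add, inf_add,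
        add_comm 1 z.1,
        add_one_add_neg, sup_inf_right, sup_eq_left.2 (show 0 ≤ z.1 from z.2.1)] }

end unit_interval

/-! ### Integer translations, separation by truncations and generation -/

section integers

variable {M : Type u} [ULMSig M] [hM : Fact (IsUnitalCommDistribLMonoid M)]

variable (M) in
/-- The constant `1` as an additive unit. -/
def oneUnit : AddUnits M := ⟨1, negUnit, one_add_neg, neg_add_one⟩

/-- The constant `1` is invertible, so its integer multiples can be taken in the group of additive
units, where additivity in `n` is known. -/
theorem intElt_eq (n : ℤ) : (intElt n : M) = ((n • oneUnit M : AddUnits M) : M) := by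
  cases n with
  | ofNat k =>
    rw [Int.ofNat_eq_natCast, natCast_zsmul, AddUnits.val_nsmul_eq_nsmul_val]
    rfl
  | negSucc k =>
    rw [negSucc_zsmul, ← neg_nsmul, AddUnits.val_nsmul_eq_nsmul_val]
    rfl

theorem intElt_add (m n : ℤ) : (intElt (m + n) : M) = intElt m + intElt n := by
  rw [intElt_eq, intElt_eq, intElt_eq, add_zsmul, AddUnits.val_add]

omit hM in
theorem intElt_zero : (intElt 0 : M) = 0 := rfl

theorem intElt_one : (intElt 1 : M) = 1 := zero_add 1

theorem intElt_neg_one : (intElt (-1) : M) = negUnit := zero_add _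

theorem intElt_natCast (n : ℕ) : (intElt n : M) = n • 1 := rfl

theorem intElt_neg_natCast (n : ℕ) : (intElt (-n) : M) = n • negUnit := by
  rw [intElt_eq, neg_zsmul, natCast_zsmul, ← neg_nsmul, AddUnits.val_nsmul_eq_nsmul_val]
  rfl

theorem intElt_mono {m n : ℤ} (h : m ≤ n) : (intElt m : M) ≤ intElt n := by
  obtain ⟨k, rfl⟩ := Int.le.dest h
  rw [intElt_add, intElt_natCast]
  exact le_add_of_nonneg_right (nsmul_nonneg zero_le_one k)

theorem exists_intElt_bound (x : M) : ∃ n : ℕ, intElt (-n) ≤ x ∧ x ≤ intElt n := by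
  obtain ⟨n, -, h₁, h₂⟩ := hM.out.bounded x
  exact ⟨n, by rw [intElt_neg_natCast]; exact h₁, h₂⟩

theorem add_intElt_neg_cancel (x : M) (n : ℤ) : x + intElt n + intElt (-n) = x := by
  rw [add_assoc, ← intElt_add, add_neg_cancel, intElt_zero, add_zero]

/-- After a translation downwards, the cut at `0` is no longer visible to the truncation. -/
theorem add_neg_nsmul_succ_sup (x : M) (k : ℕ) :
    clamp ((x + negUnit) ⊔ 0 + k • negUnit) = clamp (x + (k + 1) • negUnit) := by
  rw [sup_add, zero_add, clamp_sup_of_le_zero _ (nsmul_nonpos neg_le_zero k), add_assoc,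
    succ_nsmul']

theorem add_neg_sup_zero_le {x : M} {n : ℕ} (h : x ≤ (n + 1) • 1) :
    (x + negUnit) ⊔ 0 ≤ n • 1 := by
  refine sup_le ?_ (nsmul_nonneg zero_le_one n)
  calc x + negUnit ≤ (n + 1) • 1 + negUnit := add_le_add h le_rfl
    _ = n • 1 := by rw [succ_nsmul, add_one_add_neg]

/-- An element is determined by the truncations of its translates. -/
theorem eq_of_clamp_eq {x y : M} (h : ∀ n : ℤ, clamp (x + intElt n) = clamp (y + intElt n)) :
    x = y := by
  -- For elements of `[0, n]` the downward translates suffice: the truncations agree, and the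
  -- excesses over `1` lie in `[0, n - 1]` and again have equal truncations.
  have key : ∀ (n : ℕ) (x y : M), 0 ≤ x → 0 ≤ y → x ≤ n • 1 → y ≤ n • 1 →
      (∀ k : ℕ, clamp (x + k • negUnit) = clamp (y + k • negUnit)) → x = y := by
    intro n
    induction n with
    | zero =>
      intro x y hx hy hx' hy' _
      rw [zero_nsmul] at hx' hy'
      rw [le_antisymm hx' hx, le_antisymm hy' hy]
    | succ n ih =>
      intro x y hx hy hx' hy' hk
      have h₀ := hk 0
      rw [zero_nsmul, add_zero, add_zero] at h₀
      have h₁ := ih _ _ le_sup_right le_sup_right (add_neg_sup_zero_le hx')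
        (add_neg_sup_zero_le hy') fun k => by
          rw [add_neg_nsmul_succ_sup, add_neg_nsmul_succ_sup, hk]
      rw [← sup_eq_left.2 hx, ← sup_eq_left.2 hy, ← clamp_add x, ← clamp_add y, h₀, h₁]
  obtain ⟨m, hm, hm'⟩ := exists_intElt_bound x
  obtain ⟨n, hn, hn'⟩ := exists_intElt_bound y
  -- Translation by `m + n` moves both elements into `[0, 2(m + n)]`; it is undone at the end.
  have h₁ : ∀ {z : M} {k : ℕ}, intElt (-k) ≤ z → k ≤ m + n → 0 ≤ z + intElt ((m + n : ℕ) : ℤ) := by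
    intro z k hz hk
    calc (0 : M) ≤ intElt (-(k : ℤ) + (m + n : ℕ)) := by
          rw [← intElt_zero]; exact intElt_mono (by omega)
      _ ≤ _ := by rw [intElt_add]; exact add_le_add hz le_rfl
  have h₂ : ∀ {z : M} {k : ℕ}, z ≤ intElt k → k ≤ m + n →
      z + intElt ((m + n : ℕ) : ℤ) ≤ (2 * (m + n)) • 1 := by
    intro z k hz hk
    refine (add_le_add hz le_rfl).trans ?_
    rw [← intElt_add, ← intElt_natCast]
    exact intElt_mono (by push_cast; omega)
  have h₃ := key _ _ _ (h₁ hm (by omega)) (h₁ hn (by omega)) (h₂ hm' (by omega))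
    (h₂ hn' (by omega)) fun k => by
      rw [← intElt_neg_natCast, add_assoc, add_assoc, ← intElt_add, h]
  rw [← add_intElt_neg_cancel x ((m + n : ℕ) : ℤ), h₃, add_intElt_neg_cancel]

/-- A unital commutative distributive `ℓ`-monoid is generated, as a monoid, by its unit interval
and `-1`. -/
theorem unitInterval_induction {p : M → Prop} (h_neg : p negUnit)
    (h_mem : ∀ x, 0 ≤ x → x ≤ 1 → p x) (h_add : ∀ x y, p x → p y → p (x + y)) (x : M) : p x := by
  -- Peeling off truncations writes an element of `[0, n]` as a sum of elements of the unit
  -- interval. A general element is first translated upwards, and copies of `-1` compensate.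
  have key : ∀ (n : ℕ) (x : M), 0 ≤ x → x ≤ n • 1 → p x := by
    intro n
    induction n with
    | zero =>
      intro x hx hx'
      rw [zero_nsmul] at hx'
      exact h_mem x hx (hx'.trans zero_le_one)
    | succ n ih =>
      intro x hx hx'
      rw [← sup_eq_left.2 hx, ← clamp_add x]
      exact h_add _ _ (h_mem _ (clamp_nonneg x) (clamp_le_one x))
        (ih _ le_sup_right (add_neg_sup_zero_le hx'))
  have hneg : ∀ n : ℕ, p (n • negUnit) := by
    intro n
    induction n with
    | zero => rw [zero_nsmul]; exact h_mem 0 le_rfl zero_le_one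
    | succ n ih => rw [succ_nsmul]; exact h_add _ _ ih h_neg
  obtain ⟨n, hn, hn'⟩ := exists_intElt_bound x
  rw [← add_intElt_neg_cancel x n, intElt_neg_natCast]
  refine h_add _ _ (key (2 * n) _ ?_ ?_) (hneg n)
  · calc (0 : M) = intElt (-(n : ℤ) + n) := by rw [neg_add_cancel, intElt_zero]
      _ ≤ _ := by rw [intElt_add]; exact add_le_add hn le_rfl
  · refine (add_le_add hn' le_rfl).trans ?_
    rw [← intElt_add, ← intElt_natCast]
    exact intElt_mono (by push_cast; omega)

end integers

end ULMonoid

/-! ### The good sequence of an element -/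

namespace ULMonoid

open ULMSig (negUnit)
open MVMonoidal

section unit

variable {M : Type u} [ULMSig M] [hM : Fact (IsUnitalCommDistribLMonoid M)]

variable (M) in
/-- The unit interval, as an algebra. -/
def unitIntervalAlg : MVMAlg.{u} where
  carrier := UnitSegment M
  sig := unitIntervalSig hM.out

/-- The truncation of an element, as a member of the unit interval. -/
def toUnit (x : M) : (unitIntervalAlg M).carrier := ⟨clamp x, clamp_nonneg x, clamp_le_one x⟩

theorem toUnit_congr {x y : M} (h : clamp x = clamp y) : toUnit x = toUnit y := Subtype.ext h

section hom

variable {B : MVMAlg.{u}} (f : MVMAlg.Hom (unitIntervalAlg M) B)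

theorem hom_toUnit_of_one_le {x : M} (h : 1 ≤ x) : f.toFun (toUnit x) = 1 :=
  (congrArg f.toFun (Subtype.ext (clamp_of_one_le h))).trans f.map_one

theorem hom_toUnit_of_le_zero {x : M} (h : x ≤ 0) : f.toFun (toUnit x) = 0 :=
  (congrArg f.toFun (Subtype.ext (clamp_of_le_zero h))).trans f.map_zero

end hom

/-! ### What a homomorphism from the unit interval cannot detect -/

section hom

variable {B : MVMAlg.{u}} [hB : Fact (IsMVMonoidalAlgebra B.carrier)]
  (f : MVMAlg.Hom (unitIntervalAlg M) B)

theorem hom_mono {x y : (unitIntervalAlg M).carrier} (h : x.1 ≤ y.1) : f.toFun x ≤ f.toFun y := by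
  refine sup_eq_right.1 ?_
  rw [← f.map_sup]
  exact congrArg f.toFun (Subtype.ext (sup_eq_right.2 h))

theorem hom_toUnit_mono {x y : M} (h : x ≤ y) : f.toFun (toUnit x) ≤ f.toFun (toUnit y) :=
  hom_mono f (clamp_mono h)

/-- By induction on a bound for `t`, peeling off `clamp t`. For that piece the truncation of `w +
clamp t` is at most `toUnit w ⊕ toUnit t`, whose image is that of `toUnit w`. -/
theorem hom_toUnit_add_of_nonneg {t : M} (ht : 0 ≤ t) (hf : f.toFun (toUnit t) = 0) (w : M) :
    f.toFun (toUnit (w + t)) = f.toFun (toUnit w) := by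
  have key : ∀ (n : ℕ) (t w : M), 0 ≤ t → t ≤ n • 1 → f.toFun (toUnit t) = 0 →
      f.toFun (toUnit (w + t)) = f.toFun (toUnit w) := by
    intro n
    induction n with
    | zero =>
      intro t w ht ht' _
      rw [zero_nsmul] at ht'
      rw [le_antisymm ht' ht, add_zero]
    | succ n ih =>
      intro t w ht ht' hf
      have h₁ : f.toFun (toUnit ((t + negUnit) ⊔ 0)) = 0 := by
        refine eq_zero_of_le ((hom_toUnit_mono f ?_).trans_eq hf)
        exact sup_le ((add_le_add le_rfl neg_le_zero).trans_eq (add_zero t)) ht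
      have h₂ : w + t = w + clamp t + ((t + negUnit) ⊔ 0) := by
        rw [add_assoc, clamp_add, sup_eq_left.2 ht]
      rw [h₂, ih _ _ le_sup_right (add_neg_sup_zero_le ht') h₁]
      apply le_antisymm
      · have h₃ : f.toFun (toUnit w ⊕ₘ toUnit t) =
            f.toFun (toUnit w) := by
          rw [f.map_oplus, hf, oplus_zero]
        refine (hom_mono f ?_).trans_eq h₃
        change ((w + clamp t) ⊔ 0) ⊓ 1 ≤ ((w ⊔ 0) ⊓ 1 + clamp t) ⊓ 1
        rw [inf_add, inf_assoc, inf_eq_right.2 (le_add_of_nonneg_right (clamp_nonneg t)), sup_add]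
        exact inf_le_inf_right _ (sup_le_sup_left (by rw [zero_add]; exact clamp_nonneg t) _)
      · exact hom_toUnit_mono f (le_add_of_nonneg_right (clamp_nonneg t))
  obtain ⟨n, -, hn⟩ := exists_intElt_bound t
  exact key n t w ht hn hf

/-- The dual of the previous argument. Here `s` splits into `s ⊔ -1` and `(s + 1) ⊓ 0`, and the
first piece is compared with the product of `toUnit w` and `toUnit (s + 1)`. -/
theorem hom_toUnit_add_of_nonpos {s : M} (hs : s ≤ 0) (hf : f.toFun (toUnit (s + 1)) = 1)
    (w : M) : f.toFun (toUnit (w + s)) = f.toFun (toUnit w) := by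
  have key : ∀ (n : ℕ) (s w : M), s ≤ 0 → n • negUnit ≤ s → f.toFun (toUnit (s + 1)) = 1 →
      f.toFun (toUnit (w + s)) = f.toFun (toUnit w) := by
    intro n
    induction n with
    | zero =>
      intro s w hs hs' _
      rw [zero_nsmul] at hs'
      rw [le_antisymm hs hs', add_zero]
    | succ n ih =>
      intro s w hs hs' hf
      have h₀ : s ≤ s + 1 := le_add_of_nonneg_right zero_le_one
      have h₁ : f.toFun (toUnit ((s + 1) ⊓ 0 + 1)) = 1 := by
        refine eq_one_of_le (hf.symm.trans_le ?_)
        rw [inf_add, zero_add, toUnit_congr (clamp_inf_of_one_le (s + 1 + 1) le_rfl)]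
        exact hom_toUnit_mono f (add_le_add h₀ le_rfl)
      have h₂ : (s ⊔ negUnit) + ((s + 1) ⊓ 0) = s := by
        have h : (s + 1) ⊓ 0 = (s ⊓ negUnit) + 1 := by rw [inf_add, neg_add_one]
        rw [h, ← add_assoc, add_comm (s ⊔ negUnit), inf_add_sup, add_neg_add_one]
      have h₃ : n • negUnit ≤ (s + 1) ⊓ 0 := by
        refine le_inf ?_ (nsmul_nonpos neg_le_zero n)
        calc n • negUnit = (n + 1) • negUnit + 1 := by rw [succ_nsmul, add_neg_add_one]
          _ ≤ s + 1 := add_le_add hs' le_rfl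
      have h₄ : w + s = w + (s ⊔ negUnit) + ((s + 1) ⊓ 0) := by rw [add_assoc, h₂]
      have h₅ : s ⊔ negUnit ≤ 0 := sup_le hs neg_le_zero
      rw [h₄, ih _ _ inf_le_right h₃ h₁]
      apply le_antisymm
      · exact hom_toUnit_mono f ((add_le_add le_rfl h₅).trans_eq (add_zero w))
      · have h₆ : f.toFun (toUnit w ⊙ₘ toUnit (s + 1)) =
            f.toFun (toUnit w) := by
          rw [f.map_odot, hf, odot_one]
        refine h₆.symm.trans_le (hom_mono f ?_)
        have h₇ : clamp (s + 1) = (s ⊔ negUnit) + 1 := by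
          rw [sup_add, neg_add_one, clamp]
          refine inf_eq_left.2 (sup_le ?_ zero_le_one)
          exact (add_le_add hs le_rfl).trans_eq (zero_add 1)
        change (clamp w + clamp (s + 1) + negUnit) ⊔ 0 ≤ clamp (w + (s ⊔ negUnit))
        rw [h₇, ← add_assoc, add_one_add_neg]
        refine sup_le ?_ (clamp_nonneg _)
        rw [clamp, clamp, inf_add, sup_add, zero_add]
        refine inf_le_inf (sup_le_sup_left h₅ _) ?_
        exact (add_le_add le_rfl h₅).trans_eq (add_zero 1)
  obtain ⟨n, hn, -⟩ := exists_intElt_bound s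
  rw [intElt_neg_natCast] at hn
  exact key n s w hs hn hf

/-- By `clamp_add_add`, `x` differs from `clamp x` by its excess over `1` and its negative part. The
two hypotheses say that the two preceding lemmas remove these. -/
theorem hom_toUnit_add {x : M} (h₁ : f.toFun (toUnit (x + 1)) = 1)
    (h₀ : f.toFun (toUnit (x + negUnit)) = 0) (w : M) :
    f.toFun (toUnit (x + w)) = f.toFun (toUnit (clamp x + w)) := by
  have e₁ : x + w = clamp x + w + ((x + negUnit) ⊔ 0) + (x ⊓ 0) := by
    rw [add_right_comm (clamp x), add_right_comm _ w, clamp_add_add]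
  rw [e₁, hom_toUnit_add_of_nonpos f inf_le_right, hom_toUnit_add_of_nonneg f le_sup_right]
  · rwa [toUnit_congr (clamp_sup_of_le_zero (x + negUnit) le_rfl)]
  · rwa [inf_add, zero_add, toUnit_congr (clamp_inf_of_one_le (x + 1) le_rfl)]

end hom

/-- The good sequence of an element. -/
def etaSeq (x : M) (n : ℤ) : (unitIntervalAlg M).carrier := toUnit (x + intElt (-n))

theorem isGoodPair_toUnit (z : M) :
    IsGoodPair (toUnit z) (toUnit (z + negUnit)) := by
  constructor
  · refine Subtype.ext ?_
    change (clamp z + clamp (z + negUnit)) ⊓ 1 = clamp z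
    apply le_antisymm
    · refine inf_le_inf_right _ ?_
      rw [← clamp_add z]
      exact add_le_add le_rfl inf_le_left
    · exact le_inf (le_add_of_nonneg_right (clamp_nonneg _)) (clamp_le_one z)
  · refine Subtype.ext ?_
    change (clamp z + clamp (z + negUnit) + negUnit) ⊔ 0 = clamp (z + negUnit)
    apply le_antisymm
    · refine sup_le ?_ (clamp_nonneg _)
      calc clamp z + clamp (z + negUnit) + negUnit ≤ 1 + clamp (z + negUnit) + negUnit :=
            add_le_add (add_le_add (clamp_le_one z) le_rfl) le_rfl
        _ = clamp (z + negUnit) := by rw [add_comm 1, add_one_add_neg]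
    · rw [clamp_eq (z + negUnit)]
      refine sup_le_sup_right ?_ _
      -- Below `1`, the element `z - 1` is its truncation plus its negative part, and this negative
      -- part is `(z ⊓ 1) - 1`, hence at most `clamp z - 1`.
      rw [← clamp_eq, ← clamp_add_inf (z + negUnit), add_comm (clamp z), add_assoc]
      refine add_le_add le_rfl ?_
      have h : (z + negUnit) ⊓ 0 = (z ⊓ 1) + negUnit := by rw [inf_add, one_add_neg]
      rw [h]
      refine add_le_add ?_ le_rfl
      rw [clamp_eq]
      exact le_sup_left

theorem isGoodSeq_etaSeq (x : M) : IsGoodSeq (etaSeq x) := by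
  obtain ⟨n, hn, hn'⟩ := exists_intElt_bound x
  refine ⟨⟨-n, fun k hk => Subtype.ext (clamp_of_one_le ?_)⟩,
    ⟨n, fun k hk => Subtype.ext (clamp_of_le_zero ?_)⟩, fun k => ?_⟩
  · calc (1 : M) = intElt 1 := intElt_one.symm
      _ ≤ intElt (-n + -k) := intElt_mono (by omega)
      _ ≤ _ := by rw [intElt_add]; exact add_le_add hn le_rfl
  · calc x + intElt (-k) ≤ intElt (n + -k) := by
          rw [intElt_add]; exact add_le_add hn' le_rfl
      _ ≤ intElt 0 := intElt_mono (by omega)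
  · have h := isGoodPair_toUnit (x + intElt (-k))
    rwa [add_assoc, ← intElt_neg_one, ← intElt_add, ← neg_add] at h

/-- Tested under a homomorphism `f` to a pure algebra, where the sequences of `x` and `y` have
single free places `m` and `n`. There `f` does not distinguish `p = x - m` and `q = y - n` from
their truncations. So only translates of `clamp p + clamp q` remain, an element between `0` and `2`.
-/
theorem etaSeq_add (x y : M) :
    etaSeq (x + y) = seqAdd (A := (unitIntervalAlg M).carrier) (isMVM_unitInterval hM.out)
      (etaSeq x) (etaSeq y) := by
  funext i
  refine ext_pure (A := (unitIntervalAlg M).carrier) (isMVM_unitInterval hM.out) fun B f hB hp => ?_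
  have hF : Fact (IsMVMonoidalAlgebra B.carrier) := ⟨hB⟩
  change MVMAlg.Hom (unitIntervalAlg M) B at f
  have hx := isGoodSeq_etaSeq x
  have hy := isGoodSeq_etaSeq y
  refine Eq.trans ?_ (map_seqAdd (A := unitIntervalAlg M) f _ hB hx hy i).symm
  obtain ⟨m, b, hb⟩ := exists_eq_single hB hp (hx.map (A := unitIntervalAlg M) f)
  obtain ⟨n, c, hc⟩ := exists_eq_single hB hp (hy.map (A := unitIntervalAlg M) f)
  -- The neighbours of the free place have images `1` and `0`, which are the hypotheses of
  -- `hom_toUnit_add`.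
  have red : ∀ (x : M) (m : ℤ) (b : B.carrier), (fun n => f.toFun (etaSeq x n)) = single m b →
      f.toFun (toUnit (x + intElt (-m))) = b ∧
      ∀ w, f.toFun (toUnit (x + intElt (-m) + w)) =
        f.toFun (toUnit (clamp (x + intElt (-m)) + w)) := by
    intro x m b hb
    refine ⟨(congrFun hb m).trans (single_self m b), hom_toUnit_add f ?_ ?_⟩
    · rw [add_assoc, ← intElt_one, ← intElt_add]
      have := (congrFun hb (m - 1)).trans (single_of_lt b (by omega))
      rwa [etaSeq, show -(m - 1) = -m + 1 by ring] at this
    · rw [add_assoc, ← intElt_neg_one, ← intElt_add]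
      have := (congrFun hb (m + 1)).trans (single_of_gt b (by omega))
      rwa [etaSeq, show -(m + 1) = -m + -1 by ring] at this
  obtain ⟨hb₁, hb₂⟩ := red x m b hb
  obtain ⟨hc₁, hc₂⟩ := red y n c hc
  rw [hb, hc, seqAdd_single_single hB]
  set p := x + intElt (-m) with hpdef
  set q := y + intElt (-n) with hqdef
  have key : ∀ i, f.toFun (etaSeq (x + y) i) =
      f.toFun (toUnit (clamp p + clamp q + intElt (m + n - i))) := by
    intro i
    have e : x + y + intElt (-i) = p + (q + intElt (m + n - i)) := by
      rw [hpdef, hqdef, show (-i : ℤ) = -m + (-n + (m + n - i)) by ring, intElt_add, intElt_add]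
      abel
    rw [etaSeq, e, hb₂, add_left_comm, hc₂, add_left_comm, add_assoc]
  refine congrFun (eq_triple (a := fun i => f.toFun (etaSeq (x + y) i)) (fun k hk => ?_) ?_ ?_ ?_
    fun k hk => ?_) i
  · rw [key]
    refine hom_toUnit_of_one_le f ?_
    calc (1 : M) ≤ intElt (m + n - k) := by rw [← intElt_one]; exact intElt_mono (by omega)
      _ ≤ _ := le_add_of_nonneg_left (add_nonneg (clamp_nonneg p) (clamp_nonneg q))
  · rw [key, sub_self, intElt_zero, add_zero, ← hb₁, ← hc₁, ← f.map_oplus]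
    refine congrArg f.toFun (Subtype.ext ?_)
    change ((clamp p + clamp q) ⊔ 0) ⊓ 1 = (clamp p + clamp q) ⊓ 1
    rw [sup_eq_left.2 (add_nonneg (clamp_nonneg p) (clamp_nonneg q))]
  · rw [key, show m + n - (m + n + 1) = -1 by ring, intElt_neg_one, ← hb₁, ← hc₁, ← f.map_odot]
    refine congrArg f.toFun (Subtype.ext ?_)
    change ((clamp p + clamp q + negUnit) ⊔ 0) ⊓ 1 = (clamp p + clamp q + negUnit) ⊔ 0
    refine inf_eq_left.2 (sup_le ?_ zero_le_one)
    calc clamp p + clamp q + negUnit ≤ 1 + 1 + negUnit :=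
          add_le_add (add_le_add (clamp_le_one p) (clamp_le_one q)) le_rfl
      _ = 1 := add_one_add_neg 1
  -- Place `m + n + 2` and all later ones: the sum of two truncations is at most `2`, so its
  -- translate is at most `0`.
  all_goals
    rw [key]
    refine hom_toUnit_of_le_zero f ?_
    calc clamp p + clamp q + intElt (m + n - _) ≤ intElt 1 + intElt 1 + intElt (-2) := by
          refine add_le_add (add_le_add ?_ ?_) (intElt_mono (by omega)) <;> rw [intElt_one] <;>
          exact clamp_le_one _
      _ = 0 := by rw [← intElt_add, ← intElt_add]; rfl

theorem etaSeq_intElt (m : ℤ) : etaSeq (intElt m : M) = stepSeq m := by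
  funext n
  unfold etaSeq stepSeq
  rw [← intElt_add]
  split_ifs with h
  · refine Subtype.ext (clamp_of_one_le ?_)
    rw [← intElt_one]
    exact intElt_mono (by omega)
  · refine Subtype.ext (clamp_of_le_zero ?_)
    rw [← intElt_zero]
    exact intElt_mono (by omega)

theorem etaSeq_sup (x y : M) : etaSeq (x ⊔ y) = fun n => etaSeq x n ⊔ etaSeq y n :=
  funext fun n => Subtype.ext <| by
    change clamp _ = clamp _ ⊔ clamp _
    rw [sup_add, clamp_sup]

theorem etaSeq_inf (x y : M) : etaSeq (x ⊓ y) = fun n => etaSeq x n ⊓ etaSeq y n :=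
  funext fun n => Subtype.ext <| by
    change clamp _ = clamp _ ⊓ clamp _
    rw [inf_add, clamp_inf]

end unit


end ULMonoid

/-! ### Elementary theory of MV-algebras -/

namespace MValgebra

section operations

variable {A : Type u} [MVSig A]

/-- The unit of the reduct of an MV-algebra. -/
local instance instOne : One A := ⟨¬ₘ0⟩

/-- The product of the reduct of an MV-algebra. -/
local instance instODot : ODot A := ⟨fun x y => ¬ₘ(¬ₘx ⊕ₘ ¬ₘy)⟩

/-- The join of the reduct of an MV-algebra. -/
local instance instMax : Max A := ⟨fun x y => ¬ₘ(¬ₘx ⊕ₘ ¬ₘ(¬ₘy)) ⊕ₘ y⟩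

/-- The meet of the reduct of an MV-algebra. -/
local instance instMin : Min A := ⟨fun x y => ¬ₘ(¬ₘx ⊕ₘ ¬ₘ(¬ₘx ⊕ₘ y))⟩

variable (A) in
/-- The reduct of an MV-algebra. -/
abbrev reductSig : MVMSig A where
  oplus x y := x ⊕ₘ y
  odot x y := ¬ₘ(¬ₘx ⊕ₘ ¬ₘy)
  max x y := ¬ₘ(¬ₘx ⊕ₘ ¬ₘ(¬ₘy)) ⊕ₘ y
  min x y := ¬ₘ(¬ₘx ⊕ₘ ¬ₘ(¬ₘx ⊕ₘ y))
  zero := 0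
  one := ¬ₘ0

theorem neg_zero : ¬ₘ(0 : A) = 1 := rfl

theorem sup_def (x y : A) : x ⊔ y = (x ⊙ₘ ¬ₘy) ⊕ₘ y := rfl

theorem inf_def (x y : A) : x ⊓ y = x ⊙ₘ (¬ₘx ⊕ₘ y) := rfl

variable [h : Fact (IsMVAlgebra A)]

theorem neg_neg (x : A) : ¬ₘ¬ₘx = x := h.out.mneg_mneg x

theorem oplus_comm (x y : A) : x ⊕ₘ y = y ⊕ₘ x := h.out.oplus_comm x y

theorem oplus_assoc (x y z : A) : x ⊕ₘ y ⊕ₘ z = x ⊕ₘ (y ⊕ₘ z) := h.out.oplus_assoc x y z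

theorem oplus_zero (x : A) : x ⊕ₘ 0 = x := h.out.oplus_zero x

theorem zero_oplus (x : A) : 0 ⊕ₘ x = x := by rw [oplus_comm, oplus_zero]

theorem one_oplus (x : A) : 1 ⊕ₘ x = 1 := h.out.mneg_zero_oplus x

theorem oplus_one (x : A) : x ⊕ₘ 1 = 1 := by rw [oplus_comm, one_oplus]

theorem neg_one : ¬ₘ(1 : A) = 0 := neg_neg 0

theorem neg_oplus (x y : A) : ¬ₘ(x ⊕ₘ y) = ¬ₘx ⊙ₘ ¬ₘy := by
  change _ = ¬ₘ(¬ₘ¬ₘx ⊕ₘ ¬ₘ¬ₘy)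
  rw [neg_neg, neg_neg]

theorem neg_odot (x y : A) : ¬ₘ(x ⊙ₘ y) = ¬ₘx ⊕ₘ ¬ₘy := neg_neg _

theorem odot_comm (x y : A) : x ⊙ₘ y = y ⊙ₘ x := congrArg (¬ₘ·) (oplus_comm _ _)

theorem odot_assoc (x y z : A) : x ⊙ₘ y ⊙ₘ z = x ⊙ₘ (y ⊙ₘ z) := by
  rw [← neg_neg (x ⊙ₘ y ⊙ₘ z), neg_odot, neg_odot, oplus_assoc, ← neg_odot y, ← neg_odot, neg_neg]

theorem odot_one (x : A) : x ⊙ₘ 1 = x := by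
  rw [← neg_neg (x ⊙ₘ 1), neg_odot, neg_one, oplus_zero, neg_neg]

theorem neg_oplus_self (x : A) : ¬ₘx ⊕ₘ x = 1 := by
  have e := h.out.mneg_oplus_oplus x 1
  rw [oplus_one, neg_one, zero_oplus] at e
  exact e.symm

theorem odot_neg_self (x : A) : x ⊙ₘ ¬ₘx = 0 := by
  rw [← neg_neg (x ⊙ₘ ¬ₘx), neg_odot, neg_neg, neg_oplus_self, neg_one]

theorem sup_comm' (x y : A) : x ⊔ y = y ⊔ x := by
  have e := h.out.mneg_oplus_oplus x y
  change ¬ₘ(¬ₘx ⊕ₘ ¬ₘ(¬ₘy)) ⊕ₘ y = ¬ₘ(¬ₘy ⊕ₘ ¬ₘ(¬ₘx)) ⊕ₘ x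
  rwa [neg_neg, neg_neg]

theorem neg_sup (x y : A) : ¬ₘ(x ⊔ y) = ¬ₘx ⊓ ¬ₘy := by
  rw [sup_comm', sup_def, inf_def, neg_oplus, neg_odot, odot_comm, neg_neg, oplus_comm]

theorem neg_inf (x y : A) : ¬ₘ(x ⊓ y) = ¬ₘx ⊔ ¬ₘy := by
  rw [← neg_neg (¬ₘx ⊔ ¬ₘy), neg_sup, neg_neg, neg_neg]

/-- The natural order of an MV-algebra. -/
local instance instPartialOrder : PartialOrder A where
  le x y := ¬ₘx ⊕ₘ y = 1
  le_refl x := neg_oplus_self x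
  le_trans x y z (hxy : ¬ₘx ⊕ₘ y = 1) (hyz : ¬ₘy ⊕ₘ z = 1) := by
    have e : z = (z ⊙ₘ ¬ₘy) ⊕ₘ y := by
      rw [← sup_def, sup_comm', sup_def, ← neg_neg (y ⊙ₘ ¬ₘz), neg_odot, neg_neg, hyz, neg_one,
        zero_oplus]
    change ¬ₘx ⊕ₘ z = 1
    rw [e, oplus_comm _ y, ← oplus_assoc, hxy, one_oplus]
  le_antisymm x y (hxy : ¬ₘx ⊕ₘ y = 1) (hyx : ¬ₘy ⊕ₘ x = 1) := by
    have e := h.out.mneg_oplus_oplus x y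
    rw [hxy, hyx, neg_one, zero_oplus, zero_oplus] at e
    exact e.symm

theorem le_iff {x y : A} : x ≤ y ↔ ¬ₘx ⊕ₘ y = 1 := Iff.rfl

theorem le_oplus_left (x y : A) : x ≤ x ⊕ₘ y := by
  rw [le_iff, ← oplus_assoc, neg_oplus_self, one_oplus]

theorem le_oplus_right (x y : A) : y ≤ x ⊕ₘ y := by
  rw [oplus_comm]
  exact le_oplus_left y x

theorem neg_le_neg {x y : A} (hxy : x ≤ y) : ¬ₘy ≤ ¬ₘx := by
  rw [le_iff, neg_neg, oplus_comm]
  exact hxy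

theorem eq_oplus_of_le {x y : A} (hxy : x ≤ y) : (y ⊙ₘ ¬ₘx) ⊕ₘ x = y := by
  rw [← sup_def, sup_comm', sup_def, ← neg_neg (x ⊙ₘ ¬ₘy), neg_odot, neg_neg, le_iff.1 hxy, neg_one,
    zero_oplus]

theorem oplus_le_oplus {a b c d : A} (h₁ : a ≤ b) (h₂ : c ≤ d) : a ⊕ₘ c ≤ b ⊕ₘ d := by
  have key : ∀ {p q : A} (r : A), p ≤ q → p ⊕ₘ r ≤ q ⊕ₘ r := fun {p q} r hpq => by
    rw [← eq_oplus_of_le hpq, oplus_assoc]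
    exact le_oplus_right _ _
  refine (key c h₁).trans ?_
  rw [oplus_comm b c, oplus_comm b d]
  exact key b h₂

theorem odot_le_odot {a b c d : A} (h₁ : a ≤ b) (h₂ : c ≤ d) : a ⊙ₘ c ≤ b ⊙ₘ d :=
  neg_le_neg (oplus_le_oplus (neg_le_neg h₁) (neg_le_neg h₂))

/-- Residuation; it makes `⊙` preserve joins and drives most inequalities below. -/
theorem odot_le_iff {x y z : A} : x ⊙ₘ y ≤ z ↔ x ≤ ¬ₘy ⊕ₘ z := by
  rw [le_iff, le_iff, neg_odot, oplus_assoc]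

theorem zero_le (x : A) : 0 ≤ x := one_oplus x

theorem le_one (x : A) : x ≤ 1 := oplus_one _

theorem odot_le_left (x y : A) : x ⊙ₘ y ≤ x := by
  simpa only [odot_one] using odot_le_odot (le_refl x) (le_one y)

theorem odot_le_right (x y : A) : x ⊙ₘ y ≤ y := by
  rw [odot_comm]
  exact odot_le_left y x

theorem sup_le' {x y z : A} (hx : x ≤ z) (hy : y ≤ z) : x ⊔ y ≤ z := by
  rw [sup_def]
  exact (oplus_le_oplus (odot_le_odot hx le_rfl) le_rfl).trans_eq (eq_oplus_of_le hy)

theorem le_sup_right' (x y : A) : y ≤ x ⊔ y := le_oplus_right _ _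

/-- The lattice of an MV-algebra. -/
local instance instLattice : Lattice A where
  sup x y := x ⊔ y
  inf x y := x ⊓ y
  le_sup_left x y := by
    rw [sup_comm']
    exact le_sup_right' y x
  le_sup_right := le_sup_right'
  sup_le _ _ _ := sup_le'
  inf_le_left x y := odot_le_left _ _
  inf_le_right x y := by
    rw [← neg_neg (x ⊓ y), neg_inf, ← neg_neg y]
    refine neg_le_neg ?_
    rw [neg_neg]
    exact le_sup_right' _ _
  le_inf x y z hy hz := by
    rw [← neg_neg (y ⊓ z), neg_inf, ← neg_neg x]
    exact neg_le_neg (sup_le' (neg_le_neg hy) (neg_le_neg hz))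

theorem odot_sup (x y z : A) : x ⊙ₘ (y ⊔ z) = x ⊙ₘ y ⊔ x ⊙ₘ z := by
  apply le_antisymm
  · rw [odot_comm, odot_le_iff]
    refine sup_le ?_ ?_ <;> rw [← odot_le_iff, odot_comm]
    · exact le_sup_left
    · exact le_sup_right
  · exact sup_le (odot_le_odot le_rfl le_sup_left) (odot_le_odot le_rfl le_sup_right)

theorem sup_odot (x y z : A) : (x ⊔ y) ⊙ₘ z = x ⊙ₘ z ⊔ y ⊙ₘ z := by
  rw [odot_comm, odot_sup, odot_comm x, odot_comm y]

theorem inf_oplus (x y z : A) : (x ⊓ y) ⊕ₘ z = (x ⊕ₘ z) ⊓ (y ⊕ₘ z) := by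
  rw [← neg_neg ((x ⊓ y) ⊕ₘ z), neg_oplus, neg_inf, sup_odot, neg_sup, neg_odot, neg_odot,
    neg_neg, neg_neg, neg_neg]

theorem eq_zero_of_le {x : A} (hx : x ≤ 0) : x = 0 := le_antisymm hx (zero_le x)

/-- With `d = y ⊙ ¬x`, the meet equals `¬y ⊙ (x ⊓ (y ⊕ d))`. Expanding the inner meet from the side
of `y ⊕ d` and residuating twice bounds it by `y ⊙ ¬(y ⊕ d)`, hence by `y ⊙ ¬y = 0`. -/
theorem sub_inf_sub (x y : A) : (x ⊙ₘ ¬ₘy) ⊓ (y ⊙ₘ ¬ₘx) = 0 := by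
  set d := y ⊙ₘ ¬ₘx with hd
  refine eq_zero_of_le ?_
  have e₁ : (x ⊙ₘ ¬ₘy) ⊓ d = ¬ₘy ⊙ₘ (x ⊓ (y ⊕ₘ d)) := by
    rw [inf_def, inf_def, neg_odot, neg_neg, oplus_assoc, odot_comm x, odot_assoc]
  have e₂ : x ⊓ (y ⊕ₘ d) = (y ⊕ₘ d) ⊙ₘ (¬ₘ(y ⊕ₘ d) ⊕ₘ x) := by rw [inf_comm, inf_def]
  have e₃ : ¬ₘy ⊙ₘ (y ⊕ₘ d) ≤ d := by
    rw [odot_comm, odot_le_iff, neg_neg]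
  rw [e₁, e₂, ← odot_assoc]
  calc ¬ₘy ⊙ₘ (y ⊕ₘ d) ⊙ₘ (¬ₘ(y ⊕ₘ d) ⊕ₘ x) ≤ d ⊙ₘ (¬ₘ(y ⊕ₘ d) ⊕ₘ x) := odot_le_odot e₃ le_rfl
    _ = y ⊙ₘ (¬ₘx ⊙ₘ (x ⊕ₘ ¬ₘ(y ⊕ₘ d))) := by rw [hd, odot_assoc, oplus_comm x]
    _ ≤ y ⊙ₘ ¬ₘ(y ⊕ₘ d) := by
        refine odot_le_odot le_rfl ?_
        rw [odot_comm, odot_le_iff, neg_neg]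
    _ ≤ y ⊙ₘ ¬ₘy := odot_le_odot le_rfl (neg_le_neg (le_oplus_left y d))
    _ = 0 := odot_neg_self y

/-- Prelinearity. Together with `le_of_sup_eq_one` it replaces a representation by chains: an
inequality is verified once under each of the two comparisons. -/
theorem imp_sup_imp (x y : A) : (¬ₘx ⊕ₘ y) ⊔ (¬ₘy ⊕ₘ x) = 1 := by
  have e := congrArg (¬ₘ·) (sub_inf_sub x y)
  simpa only [neg_inf, neg_odot, neg_neg, neg_zero] using e

/-- To prove an inequality, multiply the smaller side with two elements whose join is `1`. -/
theorem le_of_sup_eq_one {a b x y : A} (hab : a ⊔ b = 1) (h₁ : x ⊙ₘ a ≤ y) (h₂ : x ⊙ₘ b ≤ y) :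
    x ≤ y := by
  rw [← odot_one x, ← hab, odot_sup]
  exact sup_le h₁ h₂

theorem odot_imp_le (x y : A) : x ⊙ₘ (¬ₘx ⊕ₘ y) ≤ y := by
  rw [← inf_def]
  exact inf_le_right

theorem odot_inf (x y z : A) : x ⊙ₘ (y ⊓ z) = (x ⊙ₘ y) ⊓ (x ⊙ₘ z) := by
  apply le_antisymm
  · exact le_inf (odot_le_odot le_rfl inf_le_left) (odot_le_odot le_rfl inf_le_right)
  · refine le_of_sup_eq_one (imp_sup_imp y z) ?_ ?_
    · refine (odot_le_odot inf_le_left le_rfl).trans ?_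
      rw [odot_assoc, ← inf_def]
    · refine (odot_le_odot inf_le_right le_rfl).trans ?_
      rw [odot_assoc, ← inf_def, inf_comm]

theorem inf_odot (x y z : A) : (x ⊓ y) ⊙ₘ z = (x ⊙ₘ z) ⊓ (y ⊙ₘ z) := by
  rw [odot_comm, odot_inf, odot_comm x, odot_comm y]

theorem sup_oplus (x y z : A) : (x ⊔ y) ⊕ₘ z = (x ⊕ₘ z) ⊔ (y ⊕ₘ z) := by
  rw [← neg_neg ((x ⊔ y) ⊕ₘ z), neg_oplus, neg_sup, inf_odot, neg_inf, neg_odot, neg_odot,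
    neg_neg, neg_neg, neg_neg]

theorem inf_sup_le (x y z : A) : x ⊓ (y ⊔ z) ≤ (x ⊓ y) ⊔ (x ⊓ z) := by
  rw [inf_comm, inf_def, sup_odot]
  refine sup_le_sup (le_inf ?_ (odot_le_left _ _)) (le_inf ?_ (odot_le_left _ _))
  · exact (odot_le_odot le_sup_left le_rfl).trans (odot_imp_le _ _)
  · exact (odot_le_odot le_sup_right le_rfl).trans (odot_imp_le _ _)

theorem sup_inf_left' (x y z : A) : x ⊔ (y ⊓ z) = (x ⊔ y) ⊓ (x ⊔ z) :=
  (DistribLattice.ofInfSupLe (α := A) inf_sup_le).le_sup_inf x y z |>.antisymm' sup_inf_le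

theorem oplus_odot_le (x y z : A) : (x ⊕ₘ y) ⊙ₘ z ≤ x ⊕ₘ (y ⊙ₘ z) := by
  rw [odot_le_iff, oplus_comm x (y ⊙ₘ z), ← oplus_assoc, oplus_comm (¬ₘz), oplus_comm x]
  refine oplus_le_oplus ?_ le_rfl
  rw [oplus_comm, ← odot_le_iff]

/-- In a chain: `x ⊕ y = 1` or `x ⊙ y = 0`. This form of prelinearity gives `ax4` and `ax6`. -/
theorem oplus_sup_neg_odot (x y : A) : (x ⊕ₘ y) ⊔ ¬ₘ(x ⊙ₘ y) = 1 := by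
  have e := imp_sup_imp (¬ₘx) y
  rwa [neg_neg, oplus_comm (¬ₘy), ← neg_odot] at e

theorem odot_oplus_eq {r s : A} (hrs : r ⊔ ¬ₘs = 1) (x : A) : (x ⊙ₘ r) ⊕ₘ s = (x ⊕ₘ s) ⊙ₘ r := by
  apply le_antisymm
  · refine le_of_sup_eq_one hrs (odot_le_odot (oplus_le_oplus (odot_le_left _ _) le_rfl) le_rfl) ?_
    refine le_trans ?_ (odot_le_odot (le_oplus_left x s) le_rfl)
    rw [odot_le_iff, neg_neg, oplus_comm]
  · rw [oplus_comm x, oplus_comm _ s]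
    exact oplus_odot_le _ _ _

/-- The element `z` is split by `y`: the first summand is `z ⊓ ¬y`, written as a product. -/
theorem le_inf_oplus_odot (y z : A) : z ≤ (¬ₘy ⊙ₘ (y ⊕ₘ z)) ⊕ₘ (y ⊙ₘ z) := by
  have e : z ⊙ₘ ¬ₘ(y ⊙ₘ z) ≤ ¬ₘy ⊙ₘ (y ⊕ₘ z) := by
    rw [neg_odot, oplus_comm, ← inf_def, inf_comm, inf_def, neg_neg]
  rw [odot_le_iff, neg_neg] at e
  rwa [oplus_comm]

theorem odot_oplus_le {a b r : A} (hb : b ≤ ¬ₘa) (hr : ¬ₘa ≤ r) :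
    (a ⊙ₘ r) ⊕ₘ b ≤ (a ⊕ₘ b) ⊙ₘ r := by
  have h₁ : (a ⊙ₘ r) ⊕ₘ b ≤ r := by
    refine (oplus_le_oplus le_rfl hb).trans_eq ?_
    have e := eq_oplus_of_le hr
    rwa [neg_neg, odot_comm] at e
  have h₂ : ¬ₘr ⊕ₘ ((a ⊙ₘ r) ⊕ₘ b) ≤ a ⊕ₘ b := by
    rw [← oplus_assoc]
    refine oplus_le_oplus ?_ le_rfl
    have e : a ⊔ ¬ₘr ≤ a := sup_le le_rfl ((neg_le_neg hr).trans_eq (neg_neg a))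
    rwa [sup_def, neg_neg, oplus_comm] at e
  rw [← inf_eq_right.2 h₁, inf_def, odot_comm]
  exact odot_le_odot h₂ le_rfl

/-- Residuation moves `x ⊕ y` to the right, and `z` is split as in `le_inf_oplus_odot`. The link is
that `¬y ⊕ (x ⊙ y)` and `¬(x ⊕ y) ⊕ x` are both `x ⊔ ¬y`. -/
theorem oplus_odot_le_mid (x y z : A) :
    (x ⊕ₘ y) ⊙ₘ (x ⊙ₘ y ⊕ₘ z) ≤ (x ⊙ₘ (y ⊕ₘ z)) ⊕ₘ (y ⊙ₘ z) := by
  have h₁ : (¬ₘy ⊙ₘ (y ⊕ₘ z)) ⊕ₘ (x ⊙ₘ y) ≤ (¬ₘy ⊕ₘ (x ⊙ₘ y)) ⊙ₘ (y ⊕ₘ z) := by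
    apply odot_oplus_le
    · rw [neg_neg]; exact odot_le_right x y
    · rw [neg_neg]; exact le_oplus_left y z
  have h₂ : ¬ₘy ⊕ₘ (x ⊙ₘ y) = ¬ₘ(x ⊕ₘ y) ⊕ₘ x := by
    have e := sup_comm x (¬ₘy)
    rwa [sup_def, sup_def, neg_neg, oplus_comm, odot_comm (¬ₘy), ← neg_oplus] at e
  rw [odot_comm, odot_le_iff, ← oplus_assoc]
  calc (x ⊙ₘ y) ⊕ₘ z ≤ (x ⊙ₘ y) ⊕ₘ ((¬ₘy ⊙ₘ (y ⊕ₘ z)) ⊕ₘ (y ⊙ₘ z)) :=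
        oplus_le_oplus le_rfl (le_inf_oplus_odot y z)
    _ = (¬ₘy ⊙ₘ (y ⊕ₘ z)) ⊕ₘ (x ⊙ₘ y) ⊕ₘ (y ⊙ₘ z) := by
        rw [← oplus_assoc, oplus_comm (x ⊙ₘ y)]
    _ ≤ (¬ₘ(x ⊕ₘ y) ⊕ₘ x) ⊙ₘ (y ⊕ₘ z) ⊕ₘ (y ⊙ₘ z) :=
        oplus_le_oplus (h₁.trans_eq (by rw [h₂])) le_rfl
    _ ≤ ¬ₘ(x ⊕ₘ y) ⊕ₘ (x ⊙ₘ (y ⊕ₘ z)) ⊕ₘ (y ⊙ₘ z) :=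
        oplus_le_oplus (oplus_odot_le _ _ _) le_rfl

/-- The right side is the left side for the rotated triple `(y, z, x)`, so the inequality
`oplus_odot_le_mid`, taken round the 3-cycle, becomes an equality. -/
theorem oplus_odot_eq_mid (x y z : A) :
    (x ⊕ₘ y) ⊙ₘ (x ⊙ₘ y ⊕ₘ z) = (x ⊙ₘ (y ⊕ₘ z)) ⊕ₘ (y ⊙ₘ z) := by
  have e : ∀ x y z : A, (x ⊙ₘ (y ⊕ₘ z)) ⊕ₘ (y ⊙ₘ z) = (y ⊕ₘ z) ⊙ₘ (y ⊙ₘ z ⊕ₘ x) := fun x y z => by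
    rw [odot_oplus_eq (oplus_sup_neg_odot y z), odot_comm, oplus_comm x]
  have key : ∀ x y z : A, (x ⊕ₘ y) ⊙ₘ (x ⊙ₘ y ⊕ₘ z) ≤ (y ⊕ₘ z) ⊙ₘ (y ⊙ₘ z ⊕ₘ x) :=
    fun x y z => (oplus_odot_le_mid x y z).trans_eq (e x y z)
  rw [e]
  exact le_antisymm (key x y z) ((key y z x).trans (key z x y))

theorem odot_oplus_eq_sup (x y z : A) :
    (x ⊙ₘ y) ⊕ₘ z = (x ⊕ₘ y) ⊙ₘ (x ⊙ₘ y ⊕ₘ z) ⊔ z := by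
  apply le_antisymm
  · refine le_of_sup_eq_one (oplus_sup_neg_odot x y) ?_ ?_
    · rw [odot_comm]
      exact le_sup_left
    · refine le_trans ?_ le_sup_right
      rw [odot_le_iff, neg_neg]
  · exact sup_le (odot_le_right _ _) (le_oplus_right _ _)

theorem eq_of_neg_eq {x y : A} (hxy : ¬ₘx = ¬ₘy) : x = y := by
  rw [← neg_neg x, hxy, neg_neg]

variable (A) in
theorem isMVM_reduct : @IsMVMonoidalAlgebra A (reductSig A) :=
  let _ := reductSig A
  { sup_comm := sup_comm'
    inf_comm := fun x y => inf_comm (α := A) x y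
    sup_assoc := fun x y z => sup_assoc (α := A) x y z
    inf_assoc := fun x y z => inf_assoc (α := A) x y z
    sup_inf_self := fun x y => sup_inf_self (α := A) (a := x) (b := y)
    inf_sup_self := fun x y => inf_sup_self (α := A) (a := x) (b := y)
    sup_inf_left := sup_inf_left'
    oplus_assoc := oplus_assoc
    oplus_comm := oplus_comm
    oplus_zero := oplus_zero
    odot_assoc := odot_assoc
    odot_comm := odot_comm
    odot_one := odot_one
    sup_oplus := sup_oplus
    inf_oplus := inf_oplus
    sup_odot := sup_odot
    inf_odot := inf_odot
    ax4 := oplus_odot_eq_mid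
    -- `ax5` and `ax7` are the De Morgan duals of `ax4` and `ax6`.
    ax5 := fun x y z => eq_of_neg_eq <| by
      have e := oplus_odot_eq_mid (¬ₘx) (¬ₘy) (¬ₘz)
      simp only [← neg_oplus, ← neg_odot] at e
      exact e
    ax6 := odot_oplus_eq_sup
    ax7 := fun x y z => eq_of_neg_eq <| by
      have e := odot_oplus_eq_sup (¬ₘx) (¬ₘy) (¬ₘz)
      simp only [← neg_oplus, ← neg_odot, ← neg_inf] at e
      exact e }

/-- Negation is thus definable in the reduct, so homomorphisms of reducts preserve it and the reduct
determines the MV-algebra. -/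
theorem neg_eq_of_complement {x y : A} (h₁ : x ⊕ₘ y = 1) (h₀ : x ⊙ₘ y = 0) : y = ¬ₘx := by
  apply le_antisymm
  · rw [le_iff, ← neg_odot, odot_comm, h₀, neg_zero]
  · rwa [le_iff, neg_neg]

end operations

end MValgebra

/-! ### Elementary theory of unital Abelian `ℓ`-groups -/

namespace ULGroup

section basic

variable {G : Type u} [ULGSig G] [h : Fact (IsUnitalAbelianLGroup G)]

instance : Lattice G := h.out.toLattice

instance : AddCommGroup G where
  add_assoc := h.out.add_assoc
  add_comm := h.out.add_comm
  zero_add := h.out.zero_add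
  add_zero := h.out.add_zero
  nsmul := natMul
  nsmul_zero _ := rfl
  nsmul_succ _ _ := rfl
  zsmul := zsmulRec
  neg_add_cancel := h.out.neg_add_cancel

instance : IsOrderedAddMonoid G where
  add_le_add_left _ _ hab _ := h.out.add_le_add hab (h.out.le_refl _)

theorem zero_le_one : (0 : G) ≤ 1 := h.out.zero_le_one

variable (G) in
/-- The reduct of a unital Abelian `ℓ`-group. -/
abbrev reductSig : ULMSig G where
  negUnit := -1

variable (G) in
-- The lattice of an Abelian `ℓ`-group is automatically distributive; the lower bound of `x` comes
-- from the strong unit property of `-x`.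
theorem isULM_reduct : @IsUnitalCommDistribLMonoid G (reductSig G) :=
  let _ := reductSig G
  { h.out with
    sup_inf_left := (AddCommGroup.toDistribLattice G).le_sup_inf |> fun hd x y z =>
      le_antisymm sup_inf_le (hd x y z)
    negUnit_add_one := neg_add_cancel 1
    negUnit_le_zero := neg_nonpos.2 (zero_le_one (G := G))
    bounded := fun x => by
      obtain ⟨m, hm⟩ := h.out.strong_unit x
      obtain ⟨n, hn⟩ := h.out.strong_unit (-x)
      change x ≤ m • 1 at hm
      change -x ≤ n • 1 at hn
      refine ⟨m + n + 1, by omega, ?_, ?_⟩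
      · change (m + n + 1) • (-1 : G) ≤ x
        rw [neg_nsmul, neg_le]
        exact hn.trans (nsmul_le_nsmul_left zero_le_one (by omega))
      · exact hm.trans (nsmul_le_nsmul_left (zero_le_one (G := G)) (by omega)) }

theorem one_sub_inf (a : G) : 1 + -(a ⊓ 1) = (1 + -a) ⊔ 0 := by
  rw [neg_inf, add_sup, add_neg_cancel]

theorem val_sup {x y : G} (hx : x ≤ 1) (hy : y ≤ 1) :
    (1 + -((1 + -x + y) ⊓ 1) + y) ⊓ 1 = x ⊔ y := by
  have e : (1 + -(1 + -x + y)) = x - y := by abel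
  rw [one_sub_inf, e, sup_add, zero_add, sub_add_cancel]
  exact inf_eq_left.2 (sup_le hx hy)

theorem val_sup' {x y : G} (hx : x ≤ 1) (hy : y ≤ 1) :
    (1 + -((1 + -x + (1 + -(1 + -y))) ⊓ 1) + y) ⊓ 1 = x ⊔ y := by
  have e : 1 + -(1 + -y) = y := by abel
  rw [e, val_sup hx hy]

theorem val_one : (1 + -0 : G) = 1 := by rw [neg_zero, add_zero]

theorem eq_neg {x y : G} (hxy : y + x = 0) : y = -x := eq_neg_of_add_eq_zero_left hxy

theorem val_inf {x y : G} (hx : 0 ≤ x) (hy : 0 ≤ y) :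
    1 + -((1 + -x + (1 + -((1 + -x + y) ⊓ 1))) ⊓ 1) = x ⊓ y := by
  have e : 1 + -(1 + -x + (1 + -((1 + -x + y) ⊓ 1))) = (1 + -x + y) ⊓ 1 + (x - 1) := by abel
  have e' : 1 + -x + y + (x - 1) = y := by abel
  rw [one_sub_inf, e, inf_add, e', add_sub_cancel, inf_comm]
  exact sup_eq_left.2 (le_inf hx hy)

theorem val_odot (x y : G) : 1 + -((1 + -x + (1 + -y)) ⊓ 1) = (x + y + -1) ⊔ 0 := by
  have e : 1 + -(1 + -x + (1 + -y)) = x + y + -1 := by abel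
  rw [one_sub_inf, e]

variable (G) in
theorem isMV_unitInterval :
    @IsMVAlgebra (UnitSegment G) (groupUnitIntervalSig h.out) :=
  let _ := groupUnitIntervalSig h.out
  { oplus_assoc := fun x y z => Subtype.ext <| by
      have key : ∀ s z : G, 0 ≤ z → (s ⊓ 1 + z) ⊓ 1 = (s + z) ⊓ 1 := fun s z hz => by
        rw [inf_add, inf_assoc, inf_eq_right.2 (le_add_of_nonneg_right hz)]
      change ((x.1 + y.1) ⊓ 1 + z.1) ⊓ 1 = (x.1 + (y.1 + z.1) ⊓ 1) ⊓ 1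
      rw [key _ _ z.2.1, add_comm x.1 (_ ⊓ _), key _ _ x.2.1, add_assoc, add_comm x.1]
    oplus_comm := fun x y => Subtype.ext (congrArg (· ⊓ 1) (add_comm x.1 y.1))
    oplus_zero := fun x => Subtype.ext <| by
      change (x.1 + 0) ⊓ 1 = x.1
      rw [add_zero]
      exact inf_eq_left.2 x.2.2
    mneg_zero_oplus := fun x => Subtype.ext <| by
      change (1 + -0 + x.1) ⊓ 1 = 1 + -0
      rw [neg_zero, add_zero]
      exact inf_eq_right.2 (le_add_of_nonneg_right x.2.1)
    mneg_mneg := fun x => Subtype.ext <| by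
      change 1 + -(1 + -x.1) = x.1
      abel
    mneg_oplus_oplus := fun x y => Subtype.ext <|
      (val_sup x.2.2 y.2.2).trans ((sup_comm x.1 y.1).trans (val_sup y.2.2 x.2.2).symm) }

end basic

end ULGroup

/-! ### Negatives in unital commutative distributive `ℓ`-monoids -/

namespace ULMonoid

open ULMSig (negUnit)

variable {M : Type u} [ULMSig M] [hM : Fact (IsUnitalCommDistribLMonoid M)]

/-- If `x ⊕ y = 1` and `x ⊙ y = 0`, then `inf_one_add` gives `x + y = 1`, so `y - 1` is a negative
of `x`. Invertible elements are closed under sums and include `-1`, so generation by the unit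
interval finishes. -/
theorem exists_neg_of_complemented
    (hc : ∀ x : (unitIntervalAlg M).carrier, ∃ y, x ⊕ₘ y = 1 ∧ x ⊙ₘ y = 0) (x : M) :
    ∃ y, y + x = 0 := by
  refine unitInterval_induction (p := fun x => ∃ y, y + x = 0) ⟨1, one_add_neg⟩ ?_ ?_ x
  · intro x hx hx'
    obtain ⟨y, h₁, h₀⟩ := hc ⟨x, hx, hx'⟩
    have h₁' : (x + y.1) ⊓ 1 = 1 := congrArg Subtype.val h₁
    have h₀' : (x + y.1 + negUnit) ⊔ 0 = 0 := congrArg Subtype.val h₀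
    have e := inf_one_add (x + y.1)
    rw [h₁', h₀', add_zero] at e
    refine ⟨y.1 + negUnit, ?_⟩
    rw [add_comm, ← add_assoc, ← e, one_add_neg]
  · rintro x y ⟨x', hx⟩ ⟨y', hy⟩
    exact ⟨x' + y', by rw [add_add_add_comm, hx, hy, add_zero]⟩

/-- A unital commutative distributive `ℓ`-monoid with negatives, as a unital Abelian `ℓ`-group. -/
noncomputable def toGroupAlg (hn : ∀ x : M, ∃ y, y + x = 0) : ULGAlg.{u} where
  carrier := M
  sig := { (inferInstance : Add M), (inferInstance : Max M), (inferInstance : Min M),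
           (inferInstance : Zero M), (inferInstance : One M) with
           neg := fun x => (hn x).choose }

theorem isULG_toGroupAlg (hn : ∀ x : M, ∃ y, y + x = 0) : isULG (toGroupAlg hn) :=
  { hM.out.toIsCommLMonoid with
    neg_add_cancel := fun x => (hn x).choose_spec
    zero_le_one := hM.out.zero_le_one
    strong_unit := fun x => (hM.out.bounded x).imp fun _ h => h.2.2 }

theorem neg_one_toGroupAlg (hn : ∀ x : M, ∃ y, y + x = 0) :
    (-1 : (toGroupAlg hn).carrier) = (negUnit : M) := by
  have : Fact (IsUnitalAbelianLGroup (toGroupAlg hn).carrier) := ⟨isULG_toGroupAlg hn⟩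
  exact (ULGroup.eq_neg (G := (toGroupAlg hn).carrier) (neg_add_one (M := M))).symm

end ULMonoid

/-! ### Isomorphisms and instances -/

instance (M : ULM.{u}) : Fact (IsUnitalCommDistribLMonoid M.obj.carrier) := ⟨M.property⟩

instance (A : MVM.{u}) : Fact (IsMVMonoidalAlgebra A.obj.carrier) := ⟨A.property⟩

instance (G : ULG.{u}) : Fact (IsUnitalAbelianLGroup G.obj.carrier) := ⟨G.property⟩

instance (A : MV.{u}) : Fact (IsMVAlgebra A.obj.carrier) := ⟨A.property⟩

theorem ULM.congr_toFun {M N : ULM.{u}} {f g : M ⟶ N} (h : f = g) (x : M.obj.carrier) :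
    f.hom.toFun x = g.hom.toFun x := by rw [h]

theorem MVM.congr_toFun {A B : MVM.{u}} {f g : A ⟶ B} (h : f = g) (x : A.obj.carrier) :
    f.hom.toFun x = g.hom.toFun x := by rw [h]

theorem ULM.isIso_of_bijective {M N : ULM.{u}} (f : M ⟶ N)
    (hf : Function.Bijective f.hom.toFun) : IsIso f := by
  obtain ⟨g, hgf, hfg⟩ := Function.bijective_iff_has_inverse.1 hf
  have hg : ∀ {y x}, f.hom.toFun x = y → g y = x := fun h => h ▸ hgf _
  refine ⟨ObjectProperty.homMk (ULMAlg.Hom.mk g (fun x y => hg ?_) (fun x y => hg ?_)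
    (fun x y => hg ?_) (hg f.hom.map_zero) (hg f.hom.map_one) (hg f.hom.map_negUnit)), ?_, ?_⟩
  · rw [f.hom.map_add, hfg, hfg]
  · rw [f.hom.map_sup, hfg, hfg]
  · rw [f.hom.map_inf, hfg, hfg]
  · exact ObjectProperty.hom_ext _ (ULMAlg.Hom.ext (funext hgf))
  · exact ObjectProperty.hom_ext _ (ULMAlg.Hom.ext (funext hfg))

theorem MVM.isIso_of_bijective {A B : MVM.{u}} (f : A ⟶ B)
    (hf : Function.Bijective f.hom.toFun) : IsIso f := by
  obtain ⟨g, hgf, hfg⟩ := Function.bijective_iff_has_inverse.1 hf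
  have hg : ∀ {y x}, f.hom.toFun x = y → g y = x := fun h => h ▸ hgf _
  refine ⟨ObjectProperty.homMk (MVMAlg.Hom.mk g (fun x y => hg ?_) (fun x y => hg ?_)
    (fun x y => hg ?_) (fun x y => hg ?_) (hg f.hom.map_zero) (hg f.hom.map_one)), ?_, ?_⟩
  · rw [f.hom.map_oplus, hfg, hfg]
  · rw [f.hom.map_odot, hfg, hfg]
  · rw [f.hom.map_sup, hfg, hfg]
  · rw [f.hom.map_inf, hfg, hfg]
  · exact ObjectProperty.hom_ext _ (MVMAlg.Hom.ext (funext hgf))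
  · exact ObjectProperty.hom_ext _ (MVMAlg.Hom.ext (funext hfg))

theorem MVM.bijective_of_isIso {A B : MVM.{u}} (f : A ⟶ B) [IsIso f] :
    Function.Bijective f.hom.toFun :=
  Function.bijective_iff_has_inverse.2 ⟨(inv f).hom.toFun,
    fun x => MVM.congr_toFun (IsIso.hom_inv_id f) x,
    fun x => MVM.congr_toFun (IsIso.inv_hom_id f) x⟩

/-! ### The functors -/

theorem isMVM_gammaULM (M : ULM.{u}) : isMVM (gammaULM.obj M) :=
  ULMonoid.isMVM_unitInterval M.property

theorem goodSeqClosed_of_isMVM (A : MVM.{u}) : GoodSeqClosed A.obj.carrier A.property :=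
  MVMonoidal.goodSeqClosed A.property

theorem isULM_xiMVM (A : MVM.{u}) : isULM ((xiMVM goodSeqClosed_of_isMVM).obj A) :=
  MVMonoidal.isULM_goodSeq A.property (goodSeqClosed_of_isMVM A)

theorem isULM_groupReduct (G : ULG.{u}) : isULM (groupReduct.obj G) :=
  ULGroup.isULM_reduct G.obj.carrier

theorem isMVM_mvReduct (A : MV.{u}) : isMVM (mvReduct.obj A) :=
  MValgebra.isMVM_reduct A.obj.carrier

theorem isMV_gammaULG (G : ULG.{u}) : isMV (gammaULG.obj G) :=
  ULGroup.isMV_unitInterval G.obj.carrier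

/-- The unit interval functor. -/
abbrev gammaFunctor : ULM.{u} ⥤ MVM.{u} := isMVM.lift gammaULM isMVM_gammaULM

/-- The functor of good sequences. -/
noncomputable abbrev xiFunctor : MVM.{u} ⥤ ULM.{u} :=
  isULM.lift (xiMVM goodSeqClosed_of_isMVM) isULM_xiMVM

/-- The inclusion of unital Abelian `ℓ`-groups. -/
abbrev groupInclusion : ULG.{u} ⥤ ULM.{u} := isULM.lift groupReduct isULM_groupReduct

/-- The inclusion of MV-algebras. -/
abbrev mvInclusion : MV.{u} ⥤ MVM.{u} := isMVM.lift mvReduct isMVM_mvReduct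

/-- Mundici's unit interval functor. -/
abbrev gammaGroupFunctor : ULG.{u} ⥤ MV.{u} := isMV.lift gammaULG isMV_gammaULG

/-! ### The adjunction -/

open ULMonoid MVMonoidal

/-- The unit: an element is sent to the good sequence of the truncations of its translates. -/
noncomputable def etaHom (M : ULM.{u}) : M ⟶ (gammaFunctor ⋙ xiFunctor).obj M :=
  ObjectProperty.homMk <| ULMAlg.Hom.mk
    (fun x => ⟨etaSeq x, isGoodSeq_etaSeq x⟩)
    (fun x y => Subtype.ext (etaSeq_add x y))
    (fun x y => Subtype.ext (etaSeq_sup x y))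
    (fun x y => Subtype.ext (etaSeq_inf x y))
    (Subtype.ext (etaSeq_intElt 0))
    (Subtype.ext ((congrArg etaSeq intElt_one.symm).trans (etaSeq_intElt 1)))
    (Subtype.ext ((congrArg etaSeq intElt_neg_one.symm).trans (etaSeq_intElt (-1))))

theorem etaSeq_map {M N : ULM.{u}} (f : M ⟶ N) (x : M.obj.carrier) (n : ℤ) :
    (etaSeq (f.hom.toFun x) n).1 = f.hom.toFun (etaSeq x n).1 := by
  have hn : ∀ k : ℕ, f.hom.toFun (natMul k 1) = natMul k 1 := fun k => by
    induction k with
    | zero => exact f.hom.map_zero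
    | succ k ih => rw [natMul, f.hom.map_add, ih, f.hom.map_one, natMul]
  have hn' : ∀ k : ℕ, f.hom.toFun (natMul k ULMSig.negUnit) = natMul k ULMSig.negUnit := fun k => by
    induction k with
    | zero => exact f.hom.map_zero
    | succ k ih => rw [natMul, f.hom.map_add, ih, f.hom.map_negUnit, natMul]
  have hi : ∀ k : ℤ, f.hom.toFun (intElt k) = intElt k := fun k => by
    cases k with
    | ofNat k => exact hn k
    | negSucc k => exact hn' (k + 1)
  change ((f.hom.toFun x + intElt (-n)) ⊔ 0) ⊓ 1 = f.hom.toFun (((x + intElt (-n)) ⊔ 0) ⊓ 1)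
  rw [f.hom.map_inf, f.hom.map_sup, f.hom.map_add, hi, f.hom.map_zero, f.hom.map_one]

/-- The unit of the adjunction. -/
noncomputable def eta : 𝟭 ULM.{u} ⟶ gammaFunctor ⋙ xiFunctor where
  app := etaHom
  naturality _ _ f := ObjectProperty.hom_ext _ <| ULMAlg.Hom.ext <| funext fun x =>
    Subtype.ext <| funext fun n => Subtype.ext (etaSeq_map f x n)

/-! ### The counit and its bijectivity -/

section counit

variable (A : MVM.{u})

/-- The order is pointwise, and the sequences of `0` and `1` differ only at place `0`. -/
theorem goodSeq_eq_of_mem (a : UnitSegment (xiFunctor.obj A).obj.carrier) :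
    (a.1 : GoodSeq A.obj.carrier).1 = single 0 ((a.1 : GoodSeq A.obj.carrier).1 0) := by
  have h₀ : ∀ k : ℤ, (stepSeq 0 k : A.obj.carrier) ≤ (a.1 : GoodSeq A.obj.carrier).1 k := fun k =>
    congrFun (congrArg Subtype.val a.2.1) k
  have h₁ : ∀ k : ℤ, (a.1 : GoodSeq A.obj.carrier).1 k ≤ (stepSeq 1 k : A.obj.carrier) := fun k =>
    congrFun (congrArg Subtype.val a.2.2) k
  have hz : ∀ k : ℤ, 0 < k → (a.1 : GoodSeq A.obj.carrier).1 k = 0 := fun k hk =>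
    eq_zero_of_le ((h₁ k).trans_eq (if_neg (by omega)))
  refine eq_triple (fun k hk => ?_) rfl (hz _ (by omega)) (hz _ (by omega))
    fun k hk => hz _ (by omega)
  exact eq_one_of_le (((if_pos hk : (stepSeq 0 k : A.obj.carrier) = 1)).symm.trans_le (h₀ k))

/-- The counit: a good sequence in the unit interval is sent to its term at `0`. -/
noncomputable def epsHom : (xiFunctor ⋙ gammaFunctor).obj A ⟶ A :=
  ObjectProperty.homMk <| MVMAlg.Hom.mk
    (fun a : UnitSegment (xiFunctor.obj A).obj.carrier => (a.1 : GoodSeq A.obj.carrier).1 0)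
    (fun a b => by
      have hA : IsMVMonoidalAlgebra A.obj.carrier := A.property
      change seqAdd hA a.1.1 b.1.1 0 ⊓ (stepSeq 1 0 : A.obj.carrier) = a.1.1 0 ⊕ₘ b.1.1 0
      rw [goodSeq_eq_of_mem A a, goodSeq_eq_of_mem A b, seqAdd_single_single]
      exact inf_eq_left.2 (le_one _))
    (fun a b => by
      have hA : IsMVMonoidalAlgebra A.obj.carrier := A.property
      change seqAdd hA (seqAdd hA a.1.1 b.1.1) (stepSeq (-1)) 0 ⊔
        (stepSeq 0 0 : A.obj.carrier) = a.1.1 0 ⊙ₘ b.1.1 0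
      rw [seqAdd_stepSeq hA (goodSeqClosed hA _ _ a.1.2 b.1.2).1,
        goodSeq_eq_of_mem A a, goodSeq_eq_of_mem A b, seqAdd_single_single]
      exact sup_eq_left.2 (zero_le _))
    (fun _ _ => rfl) (fun _ _ => rfl) rfl rfl

theorem epsHom_bijective : Function.Bijective (epsHom A).hom.toFun := by
  constructor
  · intro a b h
    have h' : a.1.1 0 = b.1.1 0 := h
    refine Subtype.ext (Subtype.ext ?_)
    rw [goodSeq_eq_of_mem A a, goodSeq_eq_of_mem A b, h']
  · intro x
    refine ⟨⟨⟨single 0 x, isGoodSeq_single A.property 0 x⟩, ?_, ?_⟩, single_self 0 x⟩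
    · refine Subtype.ext (funext fun k => sup_eq_right.2 ?_)
      change stepSeq 0 k ≤ single 0 x k
      unfold stepSeq
      split_ifs with h
      · rw [single_of_lt _ h]
      · exact zero_le _
    · refine Subtype.ext (funext fun k => sup_eq_right.2 ?_)
      change single 0 x k ≤ stepSeq 1 k
      unfold stepSeq
      split_ifs with h
      · exact le_one _
      · rw [single_of_gt _ (by omega)]

end counit

/-- The counit of the adjunction. -/
noncomputable def eps : xiFunctor ⋙ gammaFunctor ⟶ 𝟭 MVM.{u} where
  app := epsHom
  naturality _ _ _ := rfl

theorem intElt_goodSeq (A : MVM.{u}) (m : ℤ) :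
    (intElt m : (xiFunctor.obj A).obj.carrier).1 = (stepSeq m : ℤ → A.obj.carrier) := by
  cases m with
  | ofNat k =>
    refine (natMul_goodSeq A.property (goodSeqClosed_of_isMVM A) 1 k rfl).trans ?_
    rw [mul_one]
    rfl
  | negSucc k =>
    refine (natMul_goodSeq A.property (goodSeqClosed_of_isMVM A) (-1) (k + 1) rfl).trans ?_
    rw [mul_neg_one]
    rfl

/-- The adjunction between the unit interval and the good sequences. -/
noncomputable def gammaXiAdj : gammaFunctor.{u} ⊣ xiFunctor.{u} where
  unit := eta
  counit := eps
  left_triangle_components M := ObjectProperty.hom_ext _ <| MVMAlg.Hom.ext <| funext fun x =>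
    Subtype.ext <| by
      change clamp (x.1 + intElt (-0)) = x.1
      rw [_root_.neg_zero, intElt_zero, add_zero]
      exact clamp_of_mem x.2.1 x.2.2
  right_triangle_components A := ObjectProperty.hom_ext _ <| ULMAlg.Hom.ext <| funext fun a =>
    Subtype.ext <| funext fun n => by
      have hA : IsMVMonoidalAlgebra A.obj.carrier := A.property
      -- Term `n` of the image is the term at `0` of `a` translated by `-n`, and this is `a n`.
      change (seqAdd hA a.1 (intElt (-n) : (xiFunctor.obj A).obj.carrier).1 0 ⊔
        (stepSeq 0 0 : A.obj.carrier)) ⊓ (stepSeq 1 0 : A.obj.carrier) = a.1 n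
      rw [intElt_goodSeq, seqAdd_stepSeq hA a.2, zero_sub, _root_.neg_neg]
      exact (inf_eq_left.2 (le_one _)).trans (sup_eq_left.2 (zero_le _))

/-- Injectivity follows from separation by truncations, which lie in the unit interval; surjectivity
from generation by the unit interval and `-1`. -/
theorem bijective_of_gamma_bijective {M N : ULM.{u}} (f : M ⟶ N)
    (hf : Function.Bijective (gammaFunctor.map f).hom.toFun) : Function.Bijective f.hom.toFun := by
  constructor
  · intro x y h
    refine eq_of_clamp_eq fun n => ?_
    have key : etaSeq x (-n) = etaSeq y (-n) := hf.1 <| Subtype.ext <|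
      (etaSeq_map f x (-n)).symm.trans
        ((congrArg (fun z => (etaSeq z (-n)).1) h).trans (etaSeq_map f y (-n)))
    have := congrArg Subtype.val key
    rwa [etaSeq, etaSeq, _root_.neg_neg] at this
  · refine unitInterval_induction ⟨ULMSig.negUnit, f.hom.map_negUnit⟩ (fun y h₀ h₁ => ?_) ?_
    · obtain ⟨x, hx⟩ := hf.2 ⟨y, h₀, h₁⟩
      exact ⟨x.1, congrArg Subtype.val hx⟩
    · rintro _ _ ⟨x, rfl⟩ ⟨y, rfl⟩
      exact ⟨x + y, f.hom.map_add x y⟩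

theorem isIso_counit (A : MVM.{u}) : IsIso (gammaXiAdj.counit.app A) :=
  MVM.isIso_of_bijective _ (epsHom_bijective A)

/-- The left triangle identity makes `Γ` of the unit the inverse of an invertible counit; `Γ`
reflects bijectivity. -/
theorem isIso_unit (M : ULM.{u}) : IsIso (gammaXiAdj.unit.app M) := by
  have := isIso_counit (gammaFunctor.obj M)
  have h := gammaXiAdj.left_triangle_components M
  have : IsIso (gammaFunctor.map (gammaXiAdj.unit.app M)) := by
    have e : gammaFunctor.map (gammaXiAdj.unit.app M) =
        inv (gammaXiAdj.counit.app (gammaFunctor.obj M)) := by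
      rw [← cancel_mono (gammaXiAdj.counit.app (gammaFunctor.obj M)), IsIso.inv_hom_id]
      exact h
    rw [e]
    infer_instance
  exact ULM.isIso_of_bijective _ (bijective_of_gamma_bijective _ (MVM.bijective_of_isIso _))

/-! ### The inclusions -/

instance : groupInclusion.{u}.Faithful where
  map_injective h := ObjectProperty.hom_ext _ <| ULGAlg.Hom.ext <|
    funext fun x => ULM.congr_toFun h x

instance : groupInclusion.{u}.Full where
  map_surjective {G H} f := ⟨ObjectProperty.homMk (ULGAlg.Hom.mk f.hom.toFun f.hom.map_add
    f.hom.map_sup f.hom.map_inf f.hom.map_zero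
    (fun x => by
      have h : f.hom.toFun (-x) + f.hom.toFun x = (0 : H.obj.carrier) :=
        (f.hom.map_add _ _).symm.trans ((congrArg f.hom.toFun (neg_add_cancel x)).trans
          f.hom.map_zero)
      exact eq_neg_of_add_eq_zero_left h)
    f.hom.map_one), rfl⟩

/-- Only `-` is not visible in the reduct, and it is determined by `+` and `0`. -/
theorem groupInclusion_obj_injective : Function.Injective groupInclusion.{u}.obj := by
  rintro ⟨⟨G, sG⟩, hG⟩ ⟨⟨H, sH⟩, hH⟩ h
  have h' := congrArg ObjectProperty.FullSubcategory.obj h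
  injection h' with hc hs
  change G = H at hc
  subst hc
  rename_i sG sH
  have hs := eq_of_heq hs
  have h₁ : sG.toAdd = sH.toAdd := congrArg (fun s : ULMSig G => s.toAdd) hs
  have h₂ : sG.toMax = sH.toMax := congrArg (fun s : ULMSig G => s.toMax) hs
  have h₃ : sG.toMin = sH.toMin := congrArg (fun s : ULMSig G => s.toMin) hs
  have h₄ : sG.toZero = sH.toZero := congrArg (fun s : ULMSig G => s.toZero) hs
  have h₅ : sG.toOne = sH.toOne := congrArg (fun s : ULMSig G => s.toOne) hs
  have h₆ : sG.toNeg = sH.toNeg := by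
    refine congrArg Neg.mk (funext fun x => ?_)
    have e := hH.neg_add_cancel x
    rw [← h₁, ← h₄] at e
    exact (@ULGroup.eq_neg G sG ⟨hG⟩ x (sH.neg x) e).symm
  cases sG
  cases sH
  subst h₁ h₂ h₃ h₄ h₅ h₆
  rfl

instance : mvInclusion.{u}.Faithful where
  map_injective h := ObjectProperty.hom_ext _ <| MVAlg.Hom.ext <|
    funext fun x => MVM.congr_toFun h x

instance : mvInclusion.{u}.Full where
  map_surjective {A B} f := ⟨ObjectProperty.homMk (MVAlg.Hom.mk f.hom.toFun f.hom.map_oplus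
    (fun x => MValgebra.neg_eq_of_complement (A := B.obj.carrier)
      ((f.hom.map_oplus _ _).symm.trans ((congrArg f.hom.toFun
        ((MValgebra.oplus_comm (A := A.obj.carrier) _ _).trans
          (MValgebra.neg_oplus_self (A := A.obj.carrier) x))).trans f.hom.map_one))
      ((f.hom.map_odot _ _).symm.trans ((congrArg f.hom.toFun
        (MValgebra.odot_neg_self (A := A.obj.carrier) x)).trans f.hom.map_zero)))
    f.hom.map_zero), rfl⟩

theorem mvInclusion_obj_injective : Function.Injective mvInclusion.{u}.obj := by
  rintro ⟨⟨A, sA⟩, hA⟩ ⟨⟨B, sB⟩, hB⟩ h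
  have h' := congrArg ObjectProperty.FullSubcategory.obj h
  injection h' with hc hs
  change A = B at hc
  subst hc
  rename_i sA sB
  have hs := eq_of_heq hs
  have h₁ : sA.toOPlus = sB.toOPlus := congrArg (fun s : MVMSig A => s.toOPlus) hs
  have h₂ : sA.toZero = sB.toZero := congrArg (fun s : MVMSig A => s.toZero) hs
  have h₃ : ∀ x y : A, sA.mneg (sA.oplus (sA.mneg x) (sA.mneg y)) =
      sB.mneg (sB.oplus (sB.mneg x) (sB.mneg y)) := fun x y =>
    congrFun (congrFun (congrArg (fun s : MVMSig A => s.odot) hs) x) y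
  have h₄ : sA.mneg sA.toZero.zero = sB.mneg sB.toZero.zero :=
    congrArg (fun s : MVMSig A => s.toOne.one) hs
  have h₅ : sA.mneg = sB.mneg := funext fun x => by
    refine (@MValgebra.neg_eq_of_complement A sA ⟨hA⟩ x (sB.mneg x) ?_ ?_).symm
    · refine Eq.trans ?_ h₄.symm
      refine (congrArg (fun s : OPlus A => s.oplus x (sB.mneg x)) h₁).trans ?_
      exact (@MValgebra.oplus_comm A sB ⟨hB⟩ _ _).trans (@MValgebra.neg_oplus_self A sB ⟨hB⟩ x)
    · refine Eq.trans ?_ (congrArg (fun s : Zero A => s.zero) h₂.symm)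
      exact (h₃ _ _).trans (@MValgebra.odot_neg_self A sB ⟨hB⟩ x)
  cases sA
  cases sB
  subst h₁ h₂ h₅
  rfl

/-! ### The restricted equivalence -/

/-- The unit intervals of a unital Abelian `ℓ`-group and of its reduct agree. -/
def gammaIso : groupInclusion.{u} ⋙ gammaFunctor ≅ gammaGroupFunctor ⋙ mvInclusion :=
  NatIso.ofComponents (fun G => isMVM.isoMk
    { hom := MVMAlg.Hom.mk (fun x => x) (fun _ _ => rfl)
        (fun x y => Subtype.ext (ULGroup.val_odot (G := G.obj.carrier) x.1 y.1).symm)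
        (fun x y => Subtype.ext (ULGroup.val_sup' (G := G.obj.carrier) x.2.2 y.2.2).symm)
        (fun x y => Subtype.ext (ULGroup.val_inf (G := G.obj.carrier) x.2.1 y.2.1).symm)
        rfl (Subtype.ext (ULGroup.val_one (G := G.obj.carrier)).symm)
      inv := MVMAlg.Hom.mk (fun x => x) (fun _ _ => rfl)
        (fun x y => Subtype.ext (ULGroup.val_odot (G := G.obj.carrier) x.1 y.1))
        (fun x y => Subtype.ext (ULGroup.val_sup' (G := G.obj.carrier) x.2.2 y.2.2))
        (fun x y => Subtype.ext (ULGroup.val_inf (G := G.obj.carrier) x.2.1 y.2.1))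
        rfl (Subtype.ext (ULGroup.val_one (G := G.obj.carrier)))
      hom_inv_id := rfl
      inv_hom_id := rfl }) fun _ => rfl

/-- The complement `¬` of the MV-algebra is pulled back along the bijective counit to the unit
interval of the monoid of good sequences. -/
theorem exists_neg_of_mv (A : MV.{u}) (x : (xiFunctor.obj (mvInclusion.obj A)).obj.carrier) :
    ∃ y, y + x = 0 := by
  refine exists_neg_of_complemented (fun u => ?_) x
  have hb := epsHom_bijective (mvInclusion.obj A)
  set e := epsHom (mvInclusion.obj A) with he
  obtain ⟨v, hv⟩ := hb.2 (¬ₘ(show A.obj.carrier from e.hom.toFun u) : A.obj.carrier)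
  refine ⟨v, hb.1 ?_, hb.1 ?_⟩
  · refine (e.hom.map_oplus u v).trans (Eq.trans ?_ e.hom.map_one.symm)
    rw [hv]
    exact (MValgebra.oplus_comm (A := A.obj.carrier) _ _).trans
      (MValgebra.neg_oplus_self (A := A.obj.carrier) _)
  · refine (e.hom.map_odot u v).trans (Eq.trans ?_ e.hom.map_zero.symm)
    rw [hv]
    exact MValgebra.odot_neg_self (A := A.obj.carrier) _

theorem mem_essImage (A : MV.{u}) :
    groupInclusion.essImage ((mvInclusion ⋙ xiFunctor).obj A) := by
  let X := xiFunctor.obj (mvInclusion.obj A)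
  have hn := exists_neg_of_mv A
  have e := neg_one_toGroupAlg hn
  exact ⟨⟨toGroupAlg hn, isULG_toGroupAlg hn⟩, ⟨isULM.isoMk
    { hom := ULMAlg.Hom.mk (fun x => x) (fun _ _ => rfl) (fun _ _ => rfl) (fun _ _ => rfl) rfl rfl e
      inv := ULMAlg.Hom.mk (fun x => x) (fun _ _ => rfl) (fun _ _ => rfl) (fun _ _ => rfl) rfl rfl
        e.symm
      hom_inv_id := rfl
      inv_hom_id := rfl }⟩⟩

/-- The inverse of Mundici's functor. -/
noncomputable def xiGroupFunctor : MV.{u} ⥤ ULG.{u} :=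
  Functor.essImage.liftFunctor (mvInclusion ⋙ xiFunctor) groupInclusion mem_essImage

/-- The good sequences of an MV-algebra and of its reduct agree. -/
noncomputable def xiIso : mvInclusion.{u} ⋙ xiFunctor ≅ xiGroupFunctor ⋙ groupInclusion :=
  (Functor.essImage.liftFunctorCompIso _ _ mem_essImage).symm

/-- Mundici's adjunction. -/
noncomputable def mundiciAdj : gammaGroupFunctor.{u} ⊣ xiGroupFunctor.{u} :=
  gammaXiAdj.restrictFullyFaithful (.ofFullyFaithful groupInclusion) (.ofFullyFaithful mvInclusion)
    gammaIso xiIso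

theorem map_mundiciAdj_unit (G : ULG.{u}) : groupInclusion.map (mundiciAdj.unit.app G) =
    gammaXiAdj.unit.app (groupInclusion.obj G) ≫ xiFunctor.map (gammaIso.hom.app G) ≫
      xiIso.hom.app (gammaGroupFunctor.obj G) :=
  Adjunction.map_restrictFullyFaithful_unit_app _ _ _ _ _ G

theorem map_mundiciAdj_counit (A : MV.{u}) : mvInclusion.map (mundiciAdj.counit.app A) =
    gammaIso.inv.app (xiGroupFunctor.obj A) ≫ gammaFunctor.map (xiIso.inv.app A) ≫
      gammaXiAdj.counit.app (mvInclusion.obj A) :=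
  Adjunction.map_restrictFullyFaithful_counit_app _ _ _ _ _ A

theorem isIso_mundiciAdj_unit (G : ULG.{u}) : IsIso (mundiciAdj.unit.app G) := by
  have := isIso_unit (groupInclusion.obj G)
  have : IsIso (groupInclusion.map (mundiciAdj.unit.app G)) := by
    rw [map_mundiciAdj_unit]
    infer_instance
  exact isIso_of_fully_faithful groupInclusion _

theorem isIso_mundiciAdj_counit (A : MV.{u}) : IsIso (mundiciAdj.counit.app A) := by
  have := isIso_counit (mvInclusion.obj A)
  have : IsIso (mvInclusion.map (mundiciAdj.counit.app A)) := by
    rw [map_mundiciAdj_counit]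
    infer_instance
  exact isIso_of_fully_faithful mvInclusion _

theorem mainTheorem7 :
    -- the constructions are well defined
    ∃ (hΓ : ∀ M : ULM.{u}, isMVM (gammaULM.obj M))
      (hc : ∀ A : MVM.{u}, GoodSeqClosed A.obj.carrier A.property)
      (hΞ : ∀ A : MVM.{u}, isULM ((xiMVM hc).obj A))
      (hI : ∀ G : ULG.{u}, isULM (groupReduct.obj G))
      (hJ : ∀ A : MV.{u}, isMVM (mvReduct.obj A))
      (hΓ' : ∀ G : ULG.{u}, isMV (gammaULG.obj G)),
    let Γ : ULM.{u} ⥤ MVM.{u} := isMVM.lift gammaULM hΓ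
    let Ξ : MVM.{u} ⥤ ULM.{u} := isULM.lift (xiMVM hc) hΞ
    let I : ULG.{u} ⥤ ULM.{u} := isULM.lift groupReduct hI
    let J : MV.{u} ⥤ MVM.{u} := isMVM.lift mvReduct hJ
    let Γ' : ULG.{u} ⥤ MV.{u} := isMV.lift gammaULG hΓ'
    -- via reducts, `ULG` and `MV` are full subcategories of `ULM` and `MVM`
    (I.Full ∧ I.Faithful ∧ Function.Injective I.obj) ∧
    (J.Full ∧ J.Faithful ∧ Function.Injective J.obj) ∧
    -- the equivalence `Γ ⊣ Ξ`, with its unit and counit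
    ∃ adj : Γ ⊣ Ξ,
      (∀ M, IsIso (adj.unit.app M)) ∧
      (∀ A, IsIso (adj.counit.app A)) ∧
      (∀ (M : ULM.{u}) (x : M.obj.carrier) (n : ℤ),
        (((adj.unit.app M).hom.toFun x : GoodSeq (Γ.obj M).obj.carrier).1 n :
          UnitSegment M.obj.carrier).1 = ((x + intElt (-n)) ⊔ 0) ⊓ 1) ∧
      (∀ (A : MVM.{u}) (a : UnitSegment (Ξ.obj A).obj.carrier),
        (adj.counit.app A).hom.toFun a = (a.1 : GoodSeq A.obj.carrier).1 0) ∧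
      -- its restriction is Mundici's equivalence `Γ' ⊣ Ξ'`
      ∃ (Ξ' : MV.{u} ⥤ ULG.{u}) (adj' : Γ' ⊣ Ξ')
        (α : I ⋙ Γ ≅ Γ' ⋙ J) (β : J ⋙ Ξ ≅ Ξ' ⋙ I),
        (∀ G, IsIso (adj'.unit.app G)) ∧
        (∀ A, IsIso (adj'.counit.app A)) ∧
        (∀ (G : ULG.{u}) (x : UnitSegment G.obj.carrier), (α.hom.app G).hom.toFun x = x) ∧
        (∀ G : ULG.{u}, I.map (adj'.unit.app G) =
          adj.unit.app (I.obj G) ≫ Ξ.map (α.hom.app G) ≫ β.hom.app (Γ'.obj G)) ∧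
        (∀ A : MV.{u}, α.hom.app (Ξ'.obj A) ≫ J.map (adj'.counit.app A) =
          Γ.map (β.inv.app A) ≫ adj.counit.app (J.obj A)) := by
  refine ⟨isMVM_gammaULM, goodSeqClosed_of_isMVM, isULM_xiMVM, isULM_groupReduct, isMVM_mvReduct,
    isMV_gammaULG, ⟨inferInstance, inferInstance, groupInclusion_obj_injective⟩,
    ⟨inferInstance, inferInstance, mvInclusion_obj_injective⟩, gammaXiAdj, isIso_unit,
    isIso_counit, fun _ _ _ => rfl, fun _ _ => rfl, xiGroupFunctor, mundiciAdj, gammaIso, xiIso,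
    isIso_mundiciAdj_unit, isIso_mundiciAdj_counit, fun _ _ => rfl, map_mundiciAdj_unit,
    fun A => ?_⟩
  -- The formula for the counit starts with the inverse of `α`, which cancels against `α`.
  rw [map_mundiciAdj_counit, Iso.hom_inv_id_app_assoc]
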